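/- Let $(C,|\cdot|)$ be either $\mathbb C$ with its usual norm or an algebraically closed field with an ultrametric norm. Let $q\in C$ satisfy $|q|=1$ and not be a root of unity, and fix for every $n\ge 1$ an element $q^{1/n}\in C$ with $(q^{1/n})^n=q$. Put $(a;q)_n=\prod_{j=0}^{n-1}(1-q^ja)$ and assume that $\sum_{n\ge0}x^n/(q;q)_n$ has positive radius of convergence. Let $C\{x\}$ be the ring of power series with positive radius of convergence, $K$ its fraction field, $K_s$ the field $K$ in the variable $t=x^{1/s}$ (so $K\subset K_s$ through $x=t^s$), with $\sigma_q$ extended to $K_s$ by $\sigma_q t=q^{1/s}t$. Let $C\{x\}[\sigma_q]$ be the skew polynomial ring with $\sigma_q f(x)=f(qx)\sigma_q$. *Newton polygon.* For $\mathcal L=\sum_{i=0}^{\nu}a_i\sigma_q^i\in C\{x\}[\sigma_q]$ it is the convex hull of $\{(i,y): a_i\ne0,\ y\ge \mathrm{ord}_x a_i\}$; it is identified with the set $\{(\mu_1,r_1),\dots,(\mu_k,r_k)\}$, $\mu_1<\dots<\mu_k$, of its finite (rational) slopes and the lengths of the projections of the corresponding sides on the horizontal axis. $\mathcal L$ is pure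 of slope $\mu$ if $\mu$ is its only finite slope. *Exponents.* For an integer $e$, the characteristic polynomial of the slope $e$ of $\mathcal L$ is $\sum_i b_i(0)T^i$, where $b_i=x^{N}q^{-e\,i(i-1)/2}x^{-ei}a_i$ and $N$ is the integer for which all $b_i$ are analytic at $0$ and some $b_i(0)\neq0$. Its nonzero roots, with multiplicity, are the exponents of the slope $e$. The exponents of a slope $\mu=d/s$ ($s>0$, $(d,s)=1$) are the exponents of the slope $d$ of the operator $\sum a_i(t^s)\sigma_{q^{1/s}}^i\in C\{t\}[\sigma_{q^{1/s}}]$. *Admissibility.* An integral slope with exponents $\lambda_1,\dots,\lambda_r$ is admissible if $\sum_{n\ge0}x^n/\prod_{a\in\Lambda}(a;q)_n$ has positive radius of convergence, where $\Lambda=\{\lambda_i\lambda_j^{-1}\}\smallsetminus q^{\mathbb Z_{\le0}}$. A slope $\mu$ of $\mathcal L$ is almost admissible if for some $n\ge1$ with $n\mu\in\mathbb Z$ the slope $n\mu$ of $\sum a_i(t^n)\sigma_{q^{1/n}}^i\in C\{t\}[\sigma_{q^{1/n}}]$ is admissible (with respect to $q^{1/n}$). $\mathcal L$ is almost admissible if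 all its slopes are. *Modules.* For $d,s\in\mathbb Z$, $s>0$, $(d,s)=1$, $\lambda\in C^*$, let $\mathcal N_{d,\lambda,s}$ be the $q$-difference module over $K$ obtained by restriction of scalars from the one-dimensional module $K_s e$ with $\Sigma_q(fe)=\sigma_q(f)\,\lambda x^{-d/s}e$. An operator $\mathcal L$ is associated to a $q$-difference module $(M,\Sigma_q)$ over $K$ if $M\cong K[\sigma_q,\sigma_q^{-1}]/K[\sigma_q,\sigma_q^{-1}]\mathcal L$, as $K$-vector spaces with the action of $\Sigma_q$, respectively of left multiplication by $\sigma_q$. **Theorem.** Let $\mathcal L=\sum_{i=0}^\nu a_i\sigma_q^i\in C\{x\}[\sigma_q]$ with $\nu\ge1$ and $a_0,a_\nu\neq0$ be almost admissible, with Newton polygon $\{(\mu_1,r_1),\dots,(\mu_k,r_k)\}$, and let $\varpi$ be a permutation of $\{1,\dots,k\}$. Then there is a factorization $$\mathcal L=\mathcal L_{\varpi,1}\circ\mathcal L_{\varpi,2}\circ\dots\circ\mathcal L_{\varpi,k}$$ such that each $\mathcal L_{\varpi,i}\in C\{x\}[\sigma_q]$ is almost admissible, pure of slope $\mu_{\varpi(i)}$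 and of order $r_{\varpi(i)}$. Moreover, for every $i$, writing $\mu_{\varpi(i)}=d/s$ with $s>0$ and $(d,s)=1$, $$\mathcal L_{\varpi,i}=\mathcal G_l\circ\dots\circ\mathcal G_1,\qquad \mathcal G_1,\dots,\mathcal G_l\in C\{x\}[\sigma_q],$$ where $\mathcal G_j$ is associated to the module $\mathcal N_{d,\lambda_j,s}$ and $\lambda_1,\dots,\lambda_l$ are exponents of the slope $\mu_{\varpi(i)}$ of $\mathcal L$ such that the multiset of all exponents of this slope is the union over $j$ of the multisets of roots of $T^s-\lambda_j^s$, ordered so that $\lambda_j\lambda_{j'}^{-1}\in q^{\mathbb Z_{>0}}$ implies $j<j'$. -/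

import Mathlib

open scoped PowerSeries

noncomputable section

namespace QDiff

universe u

instance (μ : ℚ) : NeZero μ.den := ⟨μ.den_ne_zero⟩

section Germs

variable {C : Type u} [NormedField C]

/-- A power series is convergent if its radius of convergence is positive: for some `r > 0` the
numbers `‖a_n‖ * r ^ n` are bounded. -/
def IsConvergent (f : C⟦X⟧) : Prop :=
  ∃ r : ℝ, 0 < r ∧ ∃ A : ℝ, ∀ n : ℕ, ‖PowerSeries.coeff n f‖ * r ^ n ≤ A

theorem isConvergent_of_le {f : C⟦X⟧} {A B : ℝ} (hB : 0 < B)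
    (h : ∀ n : ℕ, ‖PowerSeries.coeff n f‖ ≤ A * B ^ n) : IsConvergent f := by
  refine ⟨B⁻¹, inv_pos.mpr hB, A, fun n => ?_⟩
  have hBn : 0 < B ^ n := pow_pos hB n
  rw [inv_pow, ← div_eq_mul_inv, div_le_iff₀ hBn]
  exact h n

theorem IsConvergent.exists_le {f : C⟦X⟧} (h : IsConvergent f) :
    ∃ A B : ℝ, 0 ≤ A ∧ 0 < B ∧ ∀ n : ℕ, ‖PowerSeries.coeff n f‖ ≤ A * B ^ n := by
  obtain ⟨r, hr, A, hA⟩ := h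
  refine ⟨A, r⁻¹, ?_, inv_pos.mpr hr, fun n => ?_⟩
  · exact le_trans (by positivity) (hA 0)
  · have hrn : 0 < r ^ n := pow_pos hr n
    rw [inv_pow, ← div_eq_mul_inv, le_div_iff₀ hrn]
    exact hA n

theorem isConvergent_C (a : C) : IsConvergent (PowerSeries.C a : C⟦X⟧) := by
  refine isConvergent_of_le (A := ‖a‖) one_pos fun n => ?_
  rw [PowerSeries.coeff_C]
  split_ifs <;> simp

theorem isConvergent_X : IsConvergent (PowerSeries.X : C⟦X⟧) := by
  refine isConvergent_of_le (A := 1) one_pos fun n => ?_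
  rw [PowerSeries.coeff_X]
  split_ifs <;> simp

theorem IsConvergent.add {f g : C⟦X⟧} (hf : IsConvergent f) (hg : IsConvergent g) :
    IsConvergent (f + g) := by
  obtain ⟨A, B, hA, hB, h⟩ := hf.exists_le
  obtain ⟨A', B', hA', hB', h'⟩ := hg.exists_le
  refine isConvergent_of_le (A := A + A') (B := max B B') (lt_max_of_lt_left hB) fun n => ?_
  rw [map_add, add_mul]
  refine (norm_add_le _ _).trans (add_le_add ((h n).trans ?_) ((h' n).trans ?_))
  · gcongr
    exact le_max_left _ _
  · gcongr
    exact le_max_right _ _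

theorem IsConvergent.neg {f : C⟦X⟧} (hf : IsConvergent f) : IsConvergent (-f) := by
  obtain ⟨r, hr, A, hA⟩ := hf
  exact ⟨r, hr, A, fun n => by simpa using hA n⟩

theorem IsConvergent.mul {f g : C⟦X⟧} (hf : IsConvergent f) (hg : IsConvergent g) :
    IsConvergent (f * g) := by
  obtain ⟨A, B, hA, hB, h⟩ := hf.exists_le
  obtain ⟨A', B', hA', hB', h'⟩ := hg.exists_le
  set D := max B B' with hD
  have hDpos : 0 < D := lt_max_of_lt_left hB
  refine isConvergent_of_le (A := A * A') (B := 2 * D) (by positivity) fun n => ?_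
  rw [PowerSeries.coeff_mul]
  calc ‖∑ z ∈ Finset.HasAntidiagonal.antidiagonal n, PowerSeries.coeff z.1 f * PowerSeries.coeff z.2 g‖
      ≤ ∑ z ∈ Finset.HasAntidiagonal.antidiagonal n, A * A' * D ^ n := by
        refine (norm_sum_le _ _).trans (Finset.sum_le_sum fun z hz => ?_)
        rw [norm_mul]
        have hz' : z.1 + z.2 = n := Finset.HasAntidiagonal.mem_antidiagonal.mp hz
        calc _ ≤ (A * B ^ z.1) * (A' * B' ^ z.2) := by
              gcongr
              · exact h _
              · exact h' _
          _ ≤ (A * D ^ z.1) * (A' * D ^ z.2) := by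
              gcongr
              · exact le_max_left _ _
              · exact le_max_right _ _
          _ = A * A' * D ^ n := by rw [← hz', pow_add]; ring
    _ = (n + 1 : ℝ) * (A * A' * D ^ n) := by simp
    _ ≤ 2 ^ n * (A * A' * D ^ n) := by
        gcongr
        have : n + 1 ≤ 2 ^ n := Nat.lt_two_pow_self
        exact_mod_cast this
    _ = A * A' * (2 * D) ^ n := by rw [mul_pow]; ring

theorem IsConvergent.rescale {f : C⟦X⟧} (hf : IsConvergent f) (a : C) :
    IsConvergent (PowerSeries.rescale a f) := by
  obtain ⟨A, B, hA, hB, h⟩ := hf.exists_le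
  refine isConvergent_of_le (A := A) (B := (‖a‖ + 1) * B) (by positivity) fun n => ?_
  rw [PowerSeries.coeff_rescale, norm_mul, norm_pow]
  calc ‖a‖ ^ n * ‖PowerSeries.coeff n f‖ ≤ (‖a‖ + 1) ^ n * (A * B ^ n) := by
        gcongr
        · linarith
        · exact h n
    _ = A * ((‖a‖ + 1) * B) ^ n := by rw [mul_pow]; ring

theorem IsConvergent.expand {f : C⟦X⟧} (hf : IsConvergent f) {s : ℕ} (hs : s ≠ 0) :
    IsConvergent (PowerSeries.expand s hs f) := by
  obtain ⟨A, B, hA, hB, h⟩ := hf.exists_le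
  refine isConvergent_of_le (A := A) (B := max B 1) (lt_max_of_lt_left hB) fun n => ?_
  by_cases hn : s ∣ n
  · obtain ⟨m, rfl⟩ := hn
    rw [PowerSeries.coeff_expand_mul]
    calc _ ≤ A * B ^ m := h m
      _ ≤ A * (max B 1) ^ m := by
          gcongr
          exact le_max_left _ _
      _ ≤ A * (max B 1) ^ (s * m) := by
          gcongr
          · exact le_max_right _ _
          · exact Nat.le_mul_of_pos_left m (Nat.pos_of_ne_zero hs)
  · rw [PowerSeries.coeff_expand_of_not_dvd _ _ _ hn, norm_zero]
    positivity

variable (C) in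
/-- The ring of convergent power series. -/
def convergentSubring : Subring C⟦X⟧ where
  carrier := {f | IsConvergent f}
  mul_mem' := IsConvergent.mul
  add_mem' := IsConvergent.add
  neg_mem' := IsConvergent.neg
  one_mem' := by simpa using isConvergent_C (1 : C)
  zero_mem' := by simpa using isConvergent_C (0 : C)

end Germs

/-- The ring `C{x}` of germs of analytic functions at zero. The parameter `q` does not change the
ring; it records that the ring is considered with the automorphism `f(x) ↦ f(qx)`. -/
def Germ (C : Type u) [NormedField C] (_q : Cˣ) : Type u := convergentSubring C

section Basic

variable {C : Type u} [NormedField C]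

instance (q : Cˣ) : CommRing (Germ C q) := inferInstanceAs (CommRing (convergentSubring C))

instance (q : Cˣ) : IsDomain (Germ C q) := inferInstanceAs (IsDomain (convergentSubring C))

namespace Germ

/-- The power series of a germ. -/
def toSeries {q : Cˣ} : Germ C q →+* C⟦X⟧ := (convergentSubring C).subtype

/-- The order of vanishing at zero of a (nonzero) germ. -/
def ord {q : Cˣ} (f : Germ C q) : ℕ := (toSeries f).order.toNat

/-- The constant germs. -/
def const (q : Cˣ) (a : C) : Germ C q := ⟨PowerSeries.C a, isConvergent_C a⟩

/-- The germ of the coordinate function `x`. -/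
def coord (q : Cˣ) : Germ C q := ⟨PowerSeries.X, isConvergent_X⟩

/-- The automorphism `σ_q : f(x) ↦ f(qx)` of `C{x}`. -/
def sigma (q : Cˣ) : Germ C q ≃+* Germ C q where
  toFun f := ⟨PowerSeries.rescale (q : C) f.1, f.2.rescale _⟩
  invFun f := ⟨PowerSeries.rescale ((q⁻¹ : Cˣ) : C) f.1, f.2.rescale _⟩
  left_inv f := Subtype.ext (by simp [PowerSeries.rescale_rescale])
  right_inv f := Subtype.ext (by simp [PowerSeries.rescale_rescale])
  map_mul' f g := Subtype.ext (map_mul (PowerSeries.rescale (q : C)) f.1 g.1)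
  map_add' f g := Subtype.ext (map_add (PowerSeries.rescale (q : C)) f.1 g.1)

/-- The ramification `x = t ^ s`: the ring homomorphism `f(x) ↦ f(t ^ s)` from `C{x}` (with `σ_q`)
to `C{t}` (with `σ_p`). It is used when `p ^ s = q`. -/
def ramify (q p : Cˣ) (s : ℕ) [NeZero s] : Germ C q →+* Germ C p where
  toFun f := ⟨PowerSeries.expand s (NeZero.ne s) f.1, f.2.expand _⟩
  map_one' := Subtype.ext (map_one (PowerSeries.expand (R := C) s (NeZero.ne s)))
  map_zero' := Subtype.ext (map_zero (PowerSeries.expand (R := C) s (NeZero.ne s)))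
  map_mul' f g := Subtype.ext (map_mul (PowerSeries.expand s (NeZero.ne s)) f.1 g.1)
  map_add' f g := Subtype.ext (map_add (PowerSeries.expand s (NeZero.ne s)) f.1 g.1)

theorem ramify_injective (q p : Cˣ) (s : ℕ) [NeZero s] :
    Function.Injective (ramify q p s) := by
  intro f g h
  refine Subtype.ext (PowerSeries.ext fun n => ?_)
  have h' := congrArg (fun F : Germ C p => PowerSeries.coeff (s * n) F.1) h
  have hc : ∀ F : Germ C q, PowerSeries.coeff (s * n) (ramify q p s F).1 =
      PowerSeries.coeff n F.1 := fun F => PowerSeries.coeff_expand_mul _ _ F.1 n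
  exact (hc f).symm.trans (h'.trans (hc g))

end Germ

/-- `σ_q ^ n` acts on `C{x}` by `f(x) ↦ f(q ^ n x)`; this makes `SkewPolynomial (Germ C q)` the
skew polynomial ring `C{x}[σ_q]`, with `σ_q f(x) = f(qx) σ_q`. -/
instance (q : Cˣ) : MulSemiringAction (Multiplicative ℕ) (Germ C q) :=
  MulSemiringAction.compHom _ (powersHom (RingAut (Germ C q)) (Germ.sigma q))

/-- The field `K = C({x})` of germs of meromorphic functions at zero, the fraction field of
`C{x}`. -/
abbrev Mero (C : Type u) [NormedField C] (q : Cˣ) : Type u := FractionRing (Germ C q)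

namespace Mero

/-- The automorphism `σ_q : f(x) ↦ f(qx)` of `K`. -/
def sigma (q : Cˣ) : Mero C q ≃+* Mero C q :=
  IsFractionRing.ringEquivOfRingEquiv (Germ.sigma q)

/-- The field embedding `f(x) ↦ f(t ^ s)` of `K` in `K_s`, where `t = x ^ (1 / s)`. -/
def ramify (q p : Cˣ) (s : ℕ) [NeZero s] : Mero C q →+* Mero C p :=
  IsFractionRing.map (Germ.ramify_injective q p s)

end Mero

/-- `σ_q ^ n` acts on `K` by `f(x) ↦ f(q ^ n x)`, `n ∈ ℤ`. -/
instance (q : Cˣ) : MulSemiringAction (Multiplicative ℤ) (Mero C q) :=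
  MulSemiringAction.compHom _ (zpowersHom (RingAut (Mero C q)) (Mero.sigma q))

/-- The ring `K[σ_q, σ_q⁻¹]`, with `σ_q f(x) = f(qx) σ_q`. -/
abbrev SkewLaurent (C : Type u) [NormedField C] (q : Cˣ) : Type u :=
  SkewMonoidAlgebra (Mero C q) (Multiplicative ℤ)

/-- The generator `σ_q` of `K[σ_q, σ_q⁻¹]`. -/
def SkewLaurent.sigma (q : Cˣ) : SkewLaurent C q :=
  SkewMonoidAlgebra.single (Multiplicative.ofAdd (1 : ℤ)) 1

/-- An operator `∑ a_i(x) σ_q ^ i ∈ C{x}[σ_q]`, seen in `K[σ_q, σ_q⁻¹]`. -/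
def toSkewLaurent {q : Cˣ} (L : SkewPolynomial (Germ C q)) : SkewLaurent C q :=
  L.sum fun i a =>
    SkewMonoidAlgebra.single (Multiplicative.ofAdd (i : ℤ)) (algebraMap (Germ C q) (Mero C q) a)

/-- `L` is a `q`-difference operator associated to the `q`-difference module `(M, S)` over `K`:
there is an isomorphism of `q`-difference modules from `(M, S)` to `K[σ_q, σ_q⁻¹]` modulo the left
ideal generated by `L`, on which `σ_q` acts by left multiplication. -/
def IsAssociated {q : Cˣ} (L : SkewPolynomial (Germ C q)) {M : Type u} [AddCommGroup M]
    [Module (Mero C q) M] (S : M → M) : Prop :=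
  ∃ e : M ≃ₗ[Mero C q] (SkewLaurent C q ⧸ Ideal.span {toSkewLaurent L}),
    ∀ m : M, e (S m) = SkewLaurent.sigma q • e m

/-- The underlying space of `N_{d,c,s}`: the one-dimensional space over `K_s` with basis `1`,
regarded by restriction of scalars along `x = t ^ s` as a vector space over `K`. -/
def SimpleModule (C : Type u) [NormedField C] (_q p : Cˣ) (s : ℕ) [NeZero s] : Type u := Mero C p

instance (q p : Cˣ) (s : ℕ) [NeZero s] : AddCommGroup (SimpleModule C q p s) :=
  inferInstanceAs (AddCommGroup (Mero C p))

instance (q p : Cˣ) (s : ℕ) [NeZero s] : Module (Mero C q) (SimpleModule C q p s) :=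
  Module.compHom (Mero C p) (Mero.ramify q p s)

/-- The operator `Σ_q` of `N_{d,c,s}`: it is `σ_p`-linear (`p ^ s = q`) and sends the basis vector
`1` to `c / t ^ d`; this is the rank one module attached to the equation
`x ^ (d / s) y(qx) = c y(x)`. -/
def SimpleModule.Sigma (q p : Cˣ) (d : ℤ) (c : Cˣ) (s : ℕ) [NeZero s] :
    SimpleModule C q p s → SimpleModule C q p s :=
  fun f : Mero C p => (Mero.sigma p f *
    (algebraMap (Germ C p) (Mero C p) (Germ.const p (c : C)) *
      (algebraMap (Germ C p) (Mero C p) (Germ.coord p)) ^ (-d)) : Mero C p)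

/-- `L` has order `n`. -/
def HasOrder {q : Cˣ} (L : SkewPolynomial (Germ C q)) (n : ℕ) : Prop :=
  L.coeff n ≠ 0 ∧ ∀ j : ℕ, n < j → L.coeff j = 0

/-! ### Newton polygon -/

/-- The Newton polygon: the convex hull of the points `(i, y)` with `a_i ≠ 0` and
`y ≥ ord a_i`. -/
def newtonPolygon {q : Cˣ} (L : SkewPolynomial (Germ C q)) : Set (ℝ × ℝ) :=
  convexHull ℝ {P | ∃ i : ℕ, L.coeff i ≠ 0 ∧ P.1 = i ∧ ((L.coeff i).ord : ℝ) ≤ P.2}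

/-- The part of the Newton polygon on its supporting line of slope `m` from below. -/
def lowerFace {q : Cˣ} (L : SkewPolynomial (Germ C q)) (m : ℝ) : Set (ℝ × ℝ) :=
  {P | P ∈ newtonPolygon L ∧ ∀ Q ∈ newtonPolygon L, P.2 - m * P.1 ≤ Q.2 - m * Q.1}

/-- The Newton polygon has a (finite) side of slope `m`, whose projection on the first axis has
length `n > 0`. -/
def HasSide {q : Cˣ} (L : SkewPolynomial (Germ C q)) (m : ℝ) (n : ℕ) : Prop :=
  0 < n ∧ ∃ P Q : ℝ × ℝ, lowerFace L m = segment ℝ P Q ∧ Q.1 - P.1 = n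

/-- `m` is a finite slope of the Newton polygon. -/
def HasSlope {q : Cˣ} (L : SkewPolynomial (Germ C q)) (m : ℝ) : Prop := ∃ n : ℕ, HasSide L m n

/-- The Newton polygon is `{(μ_1, r_1), …, (μ_k, r_k)}` with `μ_1 < ⋯ < μ_k`: these are exactly
the finite slopes and the lengths of the projections of the corresponding sides. -/
def HasNewtonPolygon {q : Cˣ} (L : SkewPolynomial (Germ C q)) {k : ℕ} (μ : Fin k → ℚ)
    (r : Fin k → ℕ) : Prop :=
  StrictMono μ ∧ ∀ (m : ℝ) (n : ℕ), HasSide L m n ↔ ∃ i, m = (μ i : ℝ) ∧ n = r i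

/-- `L` is pure of slope `μ`: its Newton polygon has exactly one finite slope, `μ`. -/
def IsPure {q : Cˣ} (L : SkewPolynomial (Germ C q)) (μ : ℚ) : Prop :=
  ∀ m : ℝ, HasSlope L m ↔ m = (μ : ℝ)

/-! ### Characteristic polynomials and exponents -/

/-- The operator `∑ a_i(t ^ s) σ_p ^ i` obtained from `∑ a_i(x) σ_q ^ i` by `x = t ^ s`. -/
def ramifyOp {q : Cˣ} (p : Cˣ) (s : ℕ) [NeZero s] (L : SkewPolynomial (Germ C q)) :
    SkewPolynomial (Germ C p) :=
  L.sum fun i a => SkewPolynomial.monomial i (Germ.ramify q p s a)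

/-- The coefficient of `σ_q ^ i` in the twisted conjugate `θ ^ e L θ ^ (-e)`, where
`θ(qx) = x θ(x)`: it is `q ^ (-e * i * (i - 1) / 2) * x ^ (-e * i) * a_i(x)`. -/
def twistCoeff {q : Cˣ} (L : SkewPolynomial (Germ C q)) (e : ℤ) (i : ℕ) : LaurentSeries C :=
  HahnSeries.single (-(e * i)) ((q ^ (-(e * (i.choose 2 : ℤ))) : Cˣ) : C) *
    HahnSeries.ofPowerSeries ℤ C (L.coeff i).toSeries

/-- The least order at zero of the coefficients of `θ ^ e L θ ^ (-e)`. -/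
def twistOrd {q : Cˣ} (L : SkewPolynomial (Germ C q)) (e : ℤ) : ℤ :=
  sInf {k : ℤ | ∃ i : ℕ, L.coeff i ≠ 0 ∧ (twistCoeff L e i).order = k}

/-- The characteristic polynomial of the integral slope `e`: that of the zero slope of
`x ^ N θ ^ e L θ ^ (-e)`, where `N` is chosen so that all coefficients are analytic at zero and
one of them does not vanish there. The characteristic polynomial of the zero slope of
`∑ b_i(x) σ_q ^ i` is `∑ b_i(0) T ^ i`. -/
def charPoly {q : Cˣ} (L : SkewPolynomial (Germ C q)) (e : ℤ) : Polynomial C :=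
  ∑ i ∈ L.support, Polynomial.monomial i ((twistCoeff L e i).coeff (twistOrd L e))

open scoped Classical in
/-- The exponents of the integral slope `e`: the nonzero roots of the characteristic polynomial,
with multiplicities. -/
def intExponents {q : Cˣ} (L : SkewPolynomial (Germ C q)) (e : ℤ) : Multiset C :=
  (charPoly L e).roots.filter (· ≠ 0)

/-- The exponents of the rational slope `μ = d / s` in lowest terms: the exponents of the integral
slope `d` after the ramification `x = t ^ s`. Here `root n` is the chosen `n`-th root of `q`. -/
def exponents {q : Cˣ} (root : ℕ → Cˣ) (L : SkewPolynomial (Germ C q)) (μ : ℚ) : Multiset C :=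
  intExponents (ramifyOp (root μ.den) μ.den L) μ.num

/-! ### Admissibility -/

/-- The `q`-Pochhammer symbol `(a; q)_n = (1 - a) (1 - q a) ⋯ (1 - q ^ (n - 1) a)`. -/
def qPochhammer (a q : C) (n : ℕ) : C := ∏ j ∈ Finset.range n, (1 - q ^ j * a)

/-- The series `∑ x ^ n / ((a_1; q)_n ⋯ (a_m; q)_n)`, for `S = {a_1, …, a_m}`. -/
def phi (q : C) (S : Finset C) : C⟦X⟧ :=
  PowerSeries.mk fun n => (∏ a ∈ S, qPochhammer a q n)⁻¹

open scoped Classical in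
/-- The set of quotients `a / b` of elements of `E` that are not in `q ^ m`, `m ∈ ℤ`, `m ≤ 0`. -/
def quotientSet (q : Cˣ) (E : Multiset C) : Finset C :=
  ((E.toFinset ×ˢ E.toFinset).image fun z => z.1 * z.2⁻¹).filter
    fun a => ∀ m : ℤ, m ≤ 0 → a ≠ ((q ^ m : Cˣ) : C)

/-- The integral slope `e` of `L` is admissible. -/
def IsAdmissibleSlope {q : Cˣ} (L : SkewPolynomial (Germ C q)) (e : ℤ) : Prop :=
  IsConvergent (phi (q : C) (quotientSet q (intExponents L e)))

/-- The slope `μ` of `L` is almost admissible: for some `n > 0` such that `n μ` is an integer, it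
becomes an admissible slope (namely `n μ`) after the ramification `x = t ^ n`. -/
def IsAlmostAdmissibleSlope {q : Cˣ} (root : ℕ → Cˣ) (L : SkewPolynomial (Germ C q)) (μ : ℚ) :
    Prop :=
  ∃ (n : ℕ) (_ : NeZero n) (e : ℤ),
    (e : ℚ) = n * μ ∧ IsAdmissibleSlope (ramifyOp (root n) n L) e

/-- `L` is almost admissible: all its slopes are almost admissible. -/
def IsAlmostAdmissible {q : Cˣ} (root : ℕ → Cˣ) (L : SkewPolynomial (Germ C q)) : Prop :=
  ∀ μ : ℚ, HasSlope L (μ : ℝ) → IsAlmostAdmissibleSlope root L μ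

end Basic

end QDiff

end

/-! Factorization of almost admissible `q`-difference operators with `|q| = 1`.

Let `d / s` be a slope of `L`. After `x = t ^ s` it becomes the integral slope `d`, and the side is
described by its supporting line (`IntFace`) and its characteristic polynomial, whose nonzero roots
are the exponents. For a product the supporting lines add up, and the characteristic polynomials
multiply after a dilation of the variable by an integral power of `p = q ^ (1 / s)`
(`IntFace.mul`, `IntFace.charPoly_mul`). As `L` only involves powers of `t ^ s`, its characteristic
polynomial is a constant times a power of `T` times a product of factors `T ^ s - c ^ s`
(`exists_charPoly_eq`).

Right factors come from analytic vectors. On an analytic vector `h` of the module `N_{d,c,s}`,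
`L` acts up to a power of `t` by a linear equation with analytic coefficients, whose characteristic
polynomial is that of the slope, evaluated at `c T` (`exists_act_eq`). If `c` is a root, the
equation `L h = 0` with `h(0) = 1` is a recursion in which the coefficient of index `n` is divided
by the value at `c p ^ n`. If the products of these values are bounded below by a geometric
progression, the solution converges (`exists_solution`, `exists_act_eq_zero`): only `|q| = 1` and
the triangle inequality enter, so neither completeness nor the ultrametric inequality is needed.
The vector `h` is killed by an operator `B` of order `s` and by no nonzero operator of smaller
order, so `B` is associated to `N_{d,c,s}` (`isAssociated_of_act_eq_zero`) and divides `L` on the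
right over `K`, hence also over `C{x}` by Gauss's lemma for the valuation `ord_x`
(`exists_eq_mul_of_C_mul_eq`). This is `exists_right_factor`.

The exponents of one slope are sorted so that none is followed by another one that is `q ^ m` times
it, `m > 0`, up to an `s`-th root of unity (`exists_sorted_exponents`); then the values in the
recursion do not vanish for the first exponent of the list, nor for the next one once the factor of
the first has been split off, and so on (`exists_slope_factorization`). Almost admissibility
provides the lower bounds. It is stated with some `q ^ (1 / n)`, and it is transported to the base
`q`, and to all the `s`-th roots of the exponents at once, by elementary estimates for the products
of the numbers `1 - q ^ j a` (`isConvergent_phi_iff`, `Tame.of_pow_eq`,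
`tame_of_isAlmostAdmissibleSlope`).

A product attached to one slope has monomial characteristic polynomials at the other slopes
(`IsSlopeProduct.isFlat`), so that its extraction only dilates their exponents and the slopes can
be treated in any order (`exists_factorization`). What remains on the left has no slope, hence is a
germ (`eq_C_of_not_hasSlope`), absorbed in the leftmost factor. Finally the exponents of a factor
are, up to a common constant, exponents of `L`, and admissibility only involves their quotients
(`IsAlmostAdmissibleSlope.of_mul`). -/

noncomputable section

namespace QDiff

universe u

variable {C : Type u} [NormedField C]

/-! ### Coefficients of germs and products of operators -/

/-- The coefficient of `x ^ k` of a germ, for an arbitrary integer `k` (zero if `k < 0`). -/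
def zcoeff {q : Cˣ} (f : Germ C q) (k : ℤ) : C :=
  (HahnSeries.ofPowerSeries ℤ C f.toSeries).coeff k

section

variable {q : Cˣ}

theorem zcoeff_natCast (f : Germ C q) (n : ℕ) :
    zcoeff f n = PowerSeries.coeff n f.toSeries :=
  HahnSeries.ofPowerSeries_apply_coeff _ n

theorem zcoeff_of_neg (f : Germ C q) {k : ℤ} (hk : k < 0) : zcoeff f k = 0 := by
  rw [zcoeff, PowerSeries.coeff_coe, if_pos hk]

@[simp] theorem zcoeff_zero (k : ℤ) : zcoeff (0 : Germ C q) k = 0 := by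
  simp [zcoeff]

theorem zcoeff_sum {ι : Type*} (s : Finset ι) (f : ι → Germ C q) (k : ℤ) :
    zcoeff (∑ i ∈ s, f i) k = ∑ i ∈ s, zcoeff (f i) k := by
  simp [zcoeff, map_sum, HahnSeries.coeff_sum]

theorem Germ.toSeries_injective : Function.Injective (Germ.toSeries : Germ C q →+* C⟦X⟧) :=
  Subtype.val_injective

theorem Germ.ext_zcoeff {f g : Germ C q} (h : ∀ k, zcoeff f k = zcoeff g k) : f = g := by
  apply Germ.toSeries_injective
  ext n
  rw [← zcoeff_natCast, ← zcoeff_natCast, h]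

/-- The lowest coefficient of a product, relative to lower bounds for the orders. -/
theorem zcoeff_mul_of_vanish {f g : Germ C q} {K M : ℤ} (hf : ∀ k < K, zcoeff f k = 0)
    (hg : ∀ k < M, zcoeff g k = 0) :
    (∀ k < K + M, zcoeff (f * g) k = 0) ∧
      zcoeff (f * g) (K + M) = zcoeff f K * zcoeff g M := by
  have key : ∀ k ≤ K + M, zcoeff (f * g) k = if k = K + M then zcoeff f K * zcoeff g M else 0 := by
    intro k hk
    rw [zcoeff, map_mul, map_mul, HahnSeries.coeff_mul]
    by_cases hkk : k = K + M
    · rw [if_pos hkk, Finset.sum_eq_single (K, M)]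
      · rfl
      · rintro ⟨i, j⟩ hij hne
        rw [Finset.mem_antidiagonal] at hij
        obtain ⟨h1, h2, h3⟩ := hij
        exfalso
        have hi : K ≤ i := by
          by_contra h
          exact h1 (hf i (not_le.mp h))
        have hj : M ≤ j := by
          by_contra h
          exact h2 (hg j (not_le.mp h))
        apply hne
        simp only at h3
        ext <;> simp <;> omega
      · intro hn
        rw [Finset.mem_antidiagonal] at hn
        simp only [HahnSeries.mem_support, not_and_or, not_not] at hn
        rcases hn with h | h | h
        · rw [h, zero_mul]
        · rw [h, mul_zero]
        · exact absurd hkk.symm h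
    · rw [if_neg hkk]
      apply Finset.sum_eq_zero
      rintro ⟨i, j⟩ hij
      rw [Finset.mem_antidiagonal] at hij
      obtain ⟨h1, h2, h3⟩ := hij
      exfalso
      have hi : K ≤ i := by
        by_contra h
        exact h1 (hf i (not_le.mp h))
      have hj : M ≤ j := by
        by_contra h
        exact h2 (hg j (not_le.mp h))
      simp only at h3
      omega
  refine ⟨fun k hk => ?_, ?_⟩
  · rw [key k hk.le, if_neg hk.ne]
  · rw [key _ le_rfl, if_pos rfl]

theorem Germ.smul_eq_iterate (n : ℕ) (f : Germ C q) :
    Multiplicative.ofAdd n • f = (Germ.sigma q ^ n : RingAut (Germ C q)) f := rfl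

theorem Germ.smul_succ (n : ℕ) (f : Germ C q) :
    Multiplicative.ofAdd (n + 1) • f = Germ.sigma q (Multiplicative.ofAdd n • f) := by
  rw [Germ.smul_eq_iterate, Germ.smul_eq_iterate, pow_succ']
  rfl

theorem zcoeff_sigma (f : Germ C q) (k : ℤ) :
    zcoeff (Germ.sigma q f) k = ((q ^ k : Cˣ) : C) * zcoeff f k := by
  rcases lt_or_ge k 0 with hk | hk
  · rw [zcoeff_of_neg _ hk, zcoeff_of_neg _ hk, mul_zero]
  · lift k to ℕ using hk
    rw [zcoeff_natCast, zcoeff_natCast]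
    change PowerSeries.coeff k (PowerSeries.rescale (q : C) f.1) = _
    rw [PowerSeries.coeff_rescale]
    simp
    rfl

theorem zcoeff_smul (n : ℕ) (f : Germ C q) (k : ℤ) :
    zcoeff (Multiplicative.ofAdd n • f) k = ((q ^ (n * k) : Cˣ) : C) * zcoeff f k := by
  induction n with
  | zero => simp
  | succ n ih =>
    rw [Germ.smul_succ, zcoeff_sigma, ih, ← mul_assoc, ← Units.val_mul, ← zpow_add]
    congr 3
    push_cast
    ring

theorem coeff_mul_eq_sum (A B : SkewPolynomial (Germ C q)) (n : ℕ) :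
    (A * B).coeff n =
      ∑ z ∈ Finset.HasAntidiagonal.antidiagonal n,
        A.coeff z.1 * (Multiplicative.ofAdd z.1 • B.coeff z.2) := by
  have h := SkewMonoidAlgebra.coeff_mul_antidiagonal_of_finset A B (Multiplicative.ofAdd n)
    ((Finset.HasAntidiagonal.antidiagonal n).map ((Multiplicative.ofAdd (α := ℕ)).toEmbedding.prodMap
      (Multiplicative.ofAdd (α := ℕ)).toEmbedding)) (by
      rintro ⟨a, b⟩
      simp only [Finset.mem_map, Finset.HasAntidiagonal.mem_antidiagonal, Function.Embedding.prodMap,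
        Prod.exists]
      constructor
      · rintro ⟨c, d, h, h2⟩
        simp only [Function.Embedding.coeFn_mk, Prod.map, Prod.mk.injEq] at h2
        rw [← h2.1, ← h2.2, ← h]
        rfl
      · intro h
        exact ⟨a.toAdd, b.toAdd, congrArg Multiplicative.toAdd h, rfl⟩)
  rw [Finset.sum_map] at h
  exact h

end

/-! ### Lower faces of integral slope and characteristic polynomials -/

section

variable {p : Cˣ}

/-- The line of integral slope `e` and height `w` at the origin supports the Newton polygon of `A`
from below, and the points `(i, ord a_i)` on it have smallest abscissa `a` and largest
abscissa `b`. -/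
structure IntFace (A : SkewPolynomial (Germ C p)) (e w : ℤ) (a b : ℕ) : Prop where
  vanish : ∀ (i : ℕ) (k : ℤ), k < w + e * i → zcoeff (A.coeff i) k = 0
  left_ne : zcoeff (A.coeff a) (w + e * a) ≠ 0
  right_ne : zcoeff (A.coeff b) (w + e * b) ≠ 0
  mem : ∀ i : ℕ, zcoeff (A.coeff i) (w + e * i) ≠ 0 → a ≤ i ∧ i ≤ b

theorem IntFace.unique {A : SkewPolynomial (Germ C p)} {e w w' : ℤ} {a a' b b' : ℕ}
    (h : IntFace A e w a b) (h' : IntFace A e w' a' b') : w = w' ∧ a = a' ∧ b = b' := by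
  have hw : w = w' := by
    rcases lt_trichotomy w w' with h1 | h1 | h1
    · exact absurd (h'.vanish a _ (by omega)) h.left_ne
    · exact h1
    · exact absurd (h.vanish a' _ (by omega)) h'.left_ne
  subst hw
  have h1 := h.mem _ h'.left_ne
  have h2 := h.mem _ h'.right_ne
  have h3 := h'.mem _ h.left_ne
  have h4 := h'.mem _ h.right_ne
  omega

/-- The coefficients of a product along the sum of two supporting lines. -/
theorem zcoeff_coeff_mul {A B : SkewPolynomial (Germ C p)} {e w w' : ℤ}
    (hA : ∀ (i : ℕ) (k : ℤ), k < w + e * i → zcoeff (A.coeff i) k = 0)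
    (hB : ∀ (i : ℕ) (k : ℤ), k < w' + e * i → zcoeff (B.coeff i) k = 0) (n : ℕ) :
    (∀ k < w + w' + e * n, zcoeff ((A * B).coeff n) k = 0) ∧
      zcoeff ((A * B).coeff n) (w + w' + e * n) =
        ∑ z ∈ Finset.HasAntidiagonal.antidiagonal n, zcoeff (A.coeff z.1) (w + e * z.1) *
          (((p ^ (z.1 * (w' + e * z.2)) : Cˣ) : C) * zcoeff (B.coeff z.2) (w' + e * z.2)) := by
  have key : ∀ z ∈ Finset.HasAntidiagonal.antidiagonal n,
      (∀ k < w + w' + e * n,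
        zcoeff (A.coeff z.1 * (Multiplicative.ofAdd z.1 • B.coeff z.2)) k = 0) ∧
      zcoeff (A.coeff z.1 * (Multiplicative.ofAdd z.1 • B.coeff z.2)) (w + w' + e * n) =
        zcoeff (A.coeff z.1) (w + e * z.1) *
          (((p ^ (z.1 * (w' + e * z.2)) : Cˣ) : C) * zcoeff (B.coeff z.2) (w' + e * z.2)) := by
    rintro ⟨i, j⟩ hz
    have hn : i + j = n := Finset.HasAntidiagonal.mem_antidiagonal.mp hz
    have h := zcoeff_mul_of_vanish (hA i) (g := Multiplicative.ofAdd i • B.coeff j)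
      (M := w' + e * j) (fun k hk => by rw [zcoeff_smul, hB j k hk, mul_zero])
    have he : w + w' + e * n = (w + e * i) + (w' + e * j) := by
      rw [← hn]; push_cast; ring
    rw [he, ← zcoeff_smul]
    exact h
  rw [coeff_mul_eq_sum]
  refine ⟨fun k hk => ?_, ?_⟩
  · rw [zcoeff_sum]
    exact Finset.sum_eq_zero fun z hz => (key z hz).1 k hk
  · rw [zcoeff_sum]
    exact Finset.sum_congr rfl fun z hz => (key z hz).2

theorem IntFace.mul {A B : SkewPolynomial (Germ C p)} {e w w' : ℤ} {a a' b b' : ℕ}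
    (hA : IntFace A e w a b) (hB : IntFace B e w' a' b') :
    IntFace (A * B) e (w + w') (a + a') (b + b') := by
  have key := zcoeff_coeff_mul hA.vanish hB.vanish
  have hsingle : ∀ i j : ℕ, zcoeff (A.coeff i) (w + e * i) ≠ 0 →
      zcoeff (B.coeff j) (w' + e * j) ≠ 0 →
      (∀ z ∈ Finset.HasAntidiagonal.antidiagonal (i + j), z ≠ (i, j) →
        zcoeff (A.coeff z.1) (w + e * z.1) = 0 ∨ zcoeff (B.coeff z.2) (w' + e * z.2) = 0) →
      zcoeff ((A * B).coeff (i + j)) (w + w' + e * (i + j : ℕ)) ≠ 0 := by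
    intro i j hi hj hz
    rw [(key _).2, Finset.sum_eq_single (i, j)]
    · exact mul_ne_zero hi (mul_ne_zero (Units.ne_zero _) hj)
    · intro z hz1 hz2
      rcases hz z hz1 hz2 with h | h <;> simp [h]
    · intro h
      exact (h (Finset.HasAntidiagonal.mem_antidiagonal.mpr rfl)).elim
  refine ⟨fun i k hk => (key i).1 k hk, ?_, ?_, ?_⟩
  · refine hsingle a a' hA.left_ne hB.left_ne ?_
    rintro ⟨i, j⟩ hz hne
    by_contra! h
    have h1 := hA.mem _ h.1
    have h2 := hB.mem _ h.2
    have hn : i + j = a + a' := Finset.HasAntidiagonal.mem_antidiagonal.mp hz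
    apply hne
    simp only at h1 h2
    ext <;> simp <;> omega
  · refine hsingle b b' hA.right_ne hB.right_ne ?_
    rintro ⟨i, j⟩ hz hne
    by_contra! h
    have h1 := hA.mem _ h.1
    have h2 := hB.mem _ h.2
    have hn : i + j = b + b' := Finset.HasAntidiagonal.mem_antidiagonal.mp hz
    apply hne
    simp only at h1 h2
    ext <;> simp <;> omega
  · intro n hn
    rw [(key n).2] at hn
    obtain ⟨⟨i, j⟩, hz, h⟩ := Finset.exists_ne_zero_of_sum_ne_zero hn
    have h1 := hA.mem _ (left_ne_zero_of_mul h)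
    have h2 := hB.mem _ (right_ne_zero_of_mul (right_ne_zero_of_mul h))
    have hn : i + j = n := Finset.HasAntidiagonal.mem_antidiagonal.mp hz
    simp only at h1 h2
    omega

theorem twistCoeff_coeff (A : SkewPolynomial (Germ C p)) (e : ℤ) (i : ℕ) (k : ℤ) :
    (twistCoeff A e i).coeff k =
      ((p ^ (-(e * (i.choose 2 : ℤ))) : Cˣ) : C) * zcoeff (A.coeff i) (k + e * i) := by
  rw [twistCoeff, HahnSeries.coeff_single_mul, zcoeff, sub_neg_eq_add]

theorem IntFace.twistOrd_eq {A : SkewPolynomial (Germ C p)} {e w : ℤ} {a b : ℕ}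
    (h : IntFace A e w a b) : twistOrd A e = w := by
  have hmem : w ∈ {k : ℤ | ∃ i : ℕ, A.coeff i ≠ 0 ∧ (twistCoeff A e i).order = k} := by
    refine ⟨a, fun h0 => h.left_ne (by rw [h0, zcoeff_zero]), ?_⟩
    have h1 : (twistCoeff A e a).coeff w ≠ 0 := by
      rw [twistCoeff_coeff]
      exact mul_ne_zero (Units.ne_zero _) h.left_ne
    refine le_antisymm (HahnSeries.order_le_of_coeff_ne_zero h1) ?_
    by_contra! hlt
    have h2 : (twistCoeff A e a).coeff (twistCoeff A e a).order ≠ 0 := by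
      rw [Ne, HahnSeries.coeff_order_eq_zero]
      exact HahnSeries.ne_zero_of_coeff_ne_zero h1
    rw [twistCoeff_coeff, h.vanish _ _ (by omega), mul_zero] at h2
    exact h2 rfl
  have hlb : ∀ k ∈ {k : ℤ | ∃ i : ℕ, A.coeff i ≠ 0 ∧ (twistCoeff A e i).order = k}, w ≤ k := by
    rintro k ⟨i, hi, rfl⟩
    by_contra! hlt
    have hne : twistCoeff A e i ≠ 0 := by
      intro h0
      apply hi
      apply Germ.ext_zcoeff
      intro k
      have := twistCoeff_coeff A e i (k - e * i)
      rw [h0, sub_add_cancel, HahnSeries.coeff_zero] at this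
      rw [zcoeff_zero]
      exact (mul_eq_zero.mp this.symm).resolve_left (Units.ne_zero _)
    have h2 : (twistCoeff A e i).coeff (twistCoeff A e i).order ≠ 0 := by
      rwa [Ne, HahnSeries.coeff_order_eq_zero]
    rw [twistCoeff_coeff, h.vanish _ _ (by omega), mul_zero] at h2
    exact h2 rfl
  exact le_antisymm (csInf_le ⟨w, hlb⟩ hmem) (le_csInf ⟨w, hmem⟩ hlb)

theorem IntFace.coeff_charPoly {A : SkewPolynomial (Germ C p)} {e w : ℤ} {a b : ℕ}
    (h : IntFace A e w a b) (i : ℕ) :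
    (charPoly A e).coeff i =
      ((p ^ (-(e * (i.choose 2 : ℤ))) : Cˣ) : C) * zcoeff (A.coeff i) (w + e * i) := by
  rw [charPoly, Polynomial.finsetSum_coeff, h.twistOrd_eq]
  simp_rw [Polynomial.coeff_monomial]
  rw [Finset.sum_ite_eq' A.support i, twistCoeff_coeff]
  split_ifs with hi
  · rfl
  · rw [SkewPolynomial.notMem_support_iff] at hi
    rw [hi, zcoeff_zero, mul_zero]

theorem IntFace.charPoly_coeff_ne_zero_iff {A : SkewPolynomial (Germ C p)} {e w : ℤ} {a b : ℕ}
    (h : IntFace A e w a b) (i : ℕ) :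
    (charPoly A e).coeff i ≠ 0 ↔ zcoeff (A.coeff i) (w + e * i) ≠ 0 := by
  rw [h.coeff_charPoly, Ne, mul_eq_zero, or_iff_right (Units.ne_zero _)]

theorem IntFace.charPoly_ne_zero {A : SkewPolynomial (Germ C p)} {e w : ℤ} {a b : ℕ}
    (h : IntFace A e w a b) : charPoly A e ≠ 0 := by
  intro h0
  exact (h.charPoly_coeff_ne_zero_iff a).mpr h.left_ne (by rw [h0, Polynomial.coeff_zero])

theorem IntFace.natDegree_charPoly {A : SkewPolynomial (Germ C p)} {e w : ℤ} {a b : ℕ}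
    (h : IntFace A e w a b) : (charPoly A e).natDegree = b := by
  refine le_antisymm ?_ (Polynomial.le_natDegree_of_ne_zero
    ((h.charPoly_coeff_ne_zero_iff b).mpr h.right_ne))
  rw [Polynomial.natDegree_le_iff_coeff_eq_zero]
  intro i hi
  by_contra h0
  have := h.mem i ((h.charPoly_coeff_ne_zero_iff i).mp h0)
  omega

theorem choose_two_add (i j : ℕ) :
    ((i + j).choose 2 : ℤ) = (i.choose 2 : ℤ) + (j.choose 2 : ℤ) + i * j := by
  have h : ∀ n : ℕ, ((n.choose 2 : ℕ) : ℤ) * 2 = n * (n - 1) := by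
    intro n
    induction n with
    | zero => simp
    | succ n ih =>
      rw [Nat.choose_succ_succ' n 1, Nat.choose_one_right]
      push_cast
      linarith
  have h1 := h i
  have h2 := h j
  have h3 := h (i + j)
  push_cast at h3
  have : ((i + j).choose 2 : ℤ) * 2 = ((i.choose 2 : ℤ) + (j.choose 2 : ℤ) + i * j) * 2 := by
    linarith
  exact mul_right_cancel₀ two_ne_zero this

/-- Characteristic polynomials are multiplicative up to a dilation of the variable, which appears
because `σ_p` does not commute with powers of the coordinate. -/
theorem IntFace.charPoly_mul {A B : SkewPolynomial (Germ C p)} {e w w' : ℤ} {a a' b b' : ℕ}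
    (hA : IntFace A e w a b) (hB : IntFace B e w' a' b') :
    charPoly (A * B) e =
      (charPoly A e).comp (Polynomial.C ((p ^ w' : Cˣ) : C) * Polynomial.X) * charPoly B e := by
  ext n
  rw [(hA.mul hB).coeff_charPoly, (zcoeff_coeff_mul hA.vanish hB.vanish n).2,
    Polynomial.coeff_mul, Finset.mul_sum]
  refine Finset.sum_congr rfl ?_
  rintro ⟨i, j⟩ hz
  have hn : i + j = n := Finset.HasAntidiagonal.mem_antidiagonal.mp hz
  subst hn
  rw [Polynomial.comp_C_mul_X_coeff, hA.coeff_charPoly, hB.coeff_charPoly, choose_two_add]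
  have hp : ((p ^ (-(e * ((i.choose 2 : ℤ) + (j.choose 2 : ℤ) + i * j))) : Cˣ) : C) *
      ((p ^ (i * (w' + e * j)) : Cˣ) : C) =
      ((p ^ (-(e * (i.choose 2 : ℤ))) : Cˣ) : C) * ((p ^ w' : Cˣ) : C) ^ i *
        ((p ^ (-(e * (j.choose 2 : ℤ))) : Cˣ) : C) := by
    rw [← Units.val_pow_eq_pow_val, ← Units.val_mul, ← Units.val_mul, ← Units.val_mul,
      ← zpow_natCast, ← zpow_mul, ← zpow_add, ← zpow_add, ← zpow_add]
    congr 2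
    ring
  calc _ = (((p ^ (-(e * ((i.choose 2 : ℤ) + (j.choose 2 : ℤ) + i * j))) : Cˣ) : C) *
      ((p ^ (i * (w' + e * j)) : Cˣ) : C)) *
        (zcoeff (A.coeff i) (w + e * i) * zcoeff (B.coeff j) (w' + e * j)) := by ring
    _ = _ := by rw [hp]; ring

end

/-! ### Newton polygons -/

section

variable {q : Cˣ}

theorem Germ.order_toSeries {f : Germ C q} (hf : f ≠ 0) :
    (Germ.toSeries f).order = (f.ord : ℕ∞) := by
  rw [Germ.ord, ENat.natCast_toNat]
  rw [Ne, PowerSeries.order_eq_top]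
  intro h
  exact hf (Germ.toSeries_injective (by rw [h, map_zero]))

theorem zcoeff_ord_ne_zero {f : Germ C q} (hf : f ≠ 0) : zcoeff f f.ord ≠ 0 := by
  rw [zcoeff_natCast]
  exact ((PowerSeries.order_eq_nat).mp (Germ.order_toSeries hf)).1

theorem zcoeff_of_lt_ord {f : Germ C q} {k : ℤ} (hk : k < f.ord) : zcoeff f k = 0 := by
  by_cases hf : f = 0
  · rw [hf, zcoeff_zero]
  rcases lt_or_ge k 0 with h0 | h0
  · exact zcoeff_of_neg f h0
  · lift k to ℕ using h0
    rw [zcoeff_natCast]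
    exact ((PowerSeries.order_eq_nat).mp (Germ.order_toSeries hf)).2 k (by exact_mod_cast hk)

theorem ord_le_of_zcoeff_ne_zero {f : Germ C q} {k : ℤ} (hk : zcoeff f k ≠ 0) :
    (f.ord : ℤ) ≤ k := by
  by_contra! h
  exact hk (zcoeff_of_lt_ord h)

theorem ne_zero_of_zcoeff_ne_zero {f : Germ C q} {k : ℤ} (hk : zcoeff f k ≠ 0) : f ≠ 0 := by
  rintro rfl
  exact hk (zcoeff_zero k)

/-- The line of slope `m` and height `w` at the origin supports the Newton polygon of `L` from
below, and the points `(i, ord a_i)` on it have smallest abscissa `a` and largest abscissa `b`. -/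
structure Face (L : SkewPolynomial (Germ C q)) (m w : ℝ) (a b : ℕ) : Prop where
  bound : ∀ i : ℕ, L.coeff i ≠ 0 → w + m * i ≤ ((L.coeff i).ord : ℝ)
  left_ne : L.coeff a ≠ 0
  left_eq : ((L.coeff a).ord : ℝ) = w + m * a
  right_ne : L.coeff b ≠ 0
  right_eq : ((L.coeff b).ord : ℝ) = w + m * b
  mem : ∀ i : ℕ, L.coeff i ≠ 0 → ((L.coeff i).ord : ℝ) = w + m * i → a ≤ i ∧ i ≤ b

theorem exists_face {L : SkewPolynomial (Germ C q)} (hL : L ≠ 0) (m : ℝ) :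
    ∃ w a b, Face L m w a b := by
  have hne : L.support.Nonempty := by
    rw [Finset.nonempty_iff_ne_empty, Ne, SkewPolynomial.support_eq_empty]
    exact hL
  obtain ⟨i₀, hi₀, hmin⟩ :=
    L.support.exists_min_image (fun i => ((L.coeff i).ord : ℝ) - m * i) hne
  set w := ((L.coeff i₀).ord : ℝ) - m * i₀ with hw
  set T := L.support.filter fun i => ((L.coeff i).ord : ℝ) = w + m * i with hT
  have hTne : T.Nonempty := ⟨i₀, by rw [hT, Finset.mem_filter]; exact ⟨hi₀, by rw [hw]; ring⟩⟩
  have hTmem : ∀ i ∈ T, L.coeff i ≠ 0 ∧ ((L.coeff i).ord : ℝ) = w + m * i := by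
    intro i hi
    rwa [hT, Finset.mem_filter, SkewPolynomial.mem_support_iff] at hi
  have ha := hTmem _ (T.min'_mem hTne)
  have hb := hTmem _ (T.max'_mem hTne)
  refine ⟨w, T.min' hTne, T.max' hTne, ?_, ha.1, ha.2, hb.1, hb.2, ?_⟩
  · intro i hi
    have := hmin i (SkewPolynomial.mem_support_iff.mpr hi)
    linarith
  · intro i hi hi2
    have hmem : i ∈ T := by
      rw [hT, Finset.mem_filter, SkewPolynomial.mem_support_iff]
      exact ⟨hi, hi2⟩
    exact ⟨T.min'_le i hmem, T.le_max' i hmem⟩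

theorem Face.mem_newtonPolygon {L : SkewPolynomial (Germ C q)} {i : ℕ} (hi : L.coeff i ≠ 0) :
    ((i : ℝ), ((L.coeff i).ord : ℝ)) ∈ newtonPolygon L :=
  subset_convexHull ℝ _ ⟨i, hi, rfl, le_rfl⟩

theorem Face.newtonPolygon_subset {L : SkewPolynomial (Germ C q)} {m w : ℝ} {a b : ℕ}
    (h : Face L m w a b) {P : ℝ × ℝ} (hP : P ∈ newtonPolygon L) :
    w ≤ P.2 - m * P.1 ∧ (P.2 - m * P.1 = w → (a : ℝ) ≤ P.1 ∧ P.1 ≤ b) := by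
  let S : Set (ℝ × ℝ) :=
    {P | w ≤ P.2 - m * P.1 ∧ (P.2 - m * P.1 = w → (a : ℝ) ≤ P.1 ∧ P.1 ≤ b)}
  suffices hS : newtonPolygon L ⊆ S from hS hP
  refine convexHull_min ?_ ?_
  · rintro P ⟨i, hi, hP1, hP2⟩
    have hb := h.bound i hi
    refine ⟨by rw [hP1]; linarith, fun he => ?_⟩
    rw [hP1] at he ⊢
    have := h.mem i hi (by linarith)
    exact_mod_cast this
  · rintro P ⟨hP1, hP2⟩ Q ⟨hQ1, hQ2⟩ s t hs ht hst
    have hval : (s • P + t • Q).2 - m * (s • P + t • Q).1 =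
        s * (P.2 - m * P.1) + t * (Q.2 - m * Q.1) := by
      simp only [Prod.snd_add, Prod.smul_snd, Prod.fst_add, Prod.smul_fst, smul_eq_mul]
      ring
    have hw : w = s * w + t * w := by rw [← add_mul, hst, one_mul]
    have h1 := mul_le_mul_of_nonneg_left hP1 hs
    have h2 := mul_le_mul_of_nonneg_left hQ1 ht
    refine ⟨by rw [hval]; linarith, fun he => ?_⟩
    rw [hval] at he
    have e1 : s * (P.2 - m * P.1) = s * w := by linarith
    have e2 : t * (Q.2 - m * Q.1) = t * w := by linarith
    have hfst : (s • P + t • Q).1 = s * P.1 + t * Q.1 := by simp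
    rw [hfst]
    have b1 : s * a ≤ s * P.1 ∧ s * P.1 ≤ s * b := by
      rcases hs.eq_or_lt with h0 | h0
      · simp [← h0]
      · have := hP2 (mul_left_cancel₀ h0.ne' e1)
        exact ⟨mul_le_mul_of_nonneg_left this.1 hs, mul_le_mul_of_nonneg_left this.2 hs⟩
    have b2 : t * a ≤ t * Q.1 ∧ t * Q.1 ≤ t * b := by
      rcases ht.eq_or_lt with h0 | h0
      · simp [← h0]
      · have := hQ2 (mul_left_cancel₀ h0.ne' e2)
        exact ⟨mul_le_mul_of_nonneg_left this.1 ht, mul_le_mul_of_nonneg_left this.2 ht⟩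
    have ea : (a : ℝ) = s * a + t * a := by rw [← add_mul, hst, one_mul]
    have eb : (b : ℝ) = s * b + t * b := by rw [← add_mul, hst, one_mul]
    constructor <;> linarith

/-- The face of the Newton polygon in the direction of slope `m` is the segment between the two
extreme points of the support on the supporting line. -/
theorem Face.lowerFace_eq {L : SkewPolynomial (Germ C q)} {m w : ℝ} {a b : ℕ}
    (h : Face L m w a b) :
    lowerFace L m = segment ℝ ((a : ℝ), w + m * a) ((b : ℝ), w + m * b) := by
  have ha : ((a : ℝ), w + m * a) ∈ newtonPolygon L := by
    rw [← h.left_eq]; exact Face.mem_newtonPolygon h.left_ne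
  have hb : ((b : ℝ), w + m * b) ∈ newtonPolygon L := by
    rw [← h.right_eq]; exact Face.mem_newtonPolygon h.right_ne
  ext P
  constructor
  · rintro ⟨hP, hmin⟩
    have h1 := h.newtonPolygon_subset hP
    have h2 := hmin _ ha
    simp only at h2
    have he : P.2 - m * P.1 = w := by linarith
    obtain ⟨h3, h4⟩ := h1.2 he
    have hPeq : P = (P.1, w + m * P.1) := by
      ext
      · rfl
      · simp only; linarith
    rw [hPeq]
    have hmem : P.1 ∈ segment ℝ (a : ℝ) (b : ℝ) := by
      rw [segment_eq_Icc (h3.trans h4)]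
      exact ⟨h3, h4⟩
    obtain ⟨s, t, hs, ht, hst, hx⟩ := hmem
    refine ⟨s, t, hs, ht, hst, ?_⟩
    have hw : w = s * w + t * w := by rw [← add_mul, hst, one_mul]
    simp only [smul_eq_mul] at hx
    ext
    · simpa using hx
    · simp only [Prod.snd_add, Prod.smul_snd, smul_eq_mul]
      rw [← hx]
      linear_combination -hw
  · rintro ⟨s, t, hs, ht, hst, rfl⟩
    refine ⟨(convex_convexHull ℝ _) ha hb hs ht hst, fun Q hQ => ?_⟩
    have h1 := (h.newtonPolygon_subset hQ).1
    have hw : w = s * w + t * w := by rw [← add_mul, hst, one_mul]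
    simp only [Prod.snd_add, Prod.smul_snd, Prod.fst_add, Prod.smul_fst, smul_eq_mul]
    linarith

theorem Face.le {L : SkewPolynomial (Germ C q)} {m w : ℝ} {a b : ℕ}
    (h : Face L m w a b) : a ≤ b := (h.mem a h.left_ne h.left_eq).2

theorem Face.hasSide_iff {L : SkewPolynomial (Germ C q)} {m w : ℝ} {a b : ℕ}
    (h : Face L m w a b) (n : ℕ) : HasSide L m n ↔ 0 < n ∧ b = a + n := by
  have hab : (a : ℝ) ≤ b := by exact_mod_cast h.le
  have key : ∀ P Q R : ℝ × ℝ, R ∈ segment ℝ P Q → P.1 ≤ Q.1 → P.1 ≤ R.1 ∧ R.1 ≤ Q.1 := by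
    rintro P Q R ⟨s, t, hs, ht, hst, rfl⟩ hPQ
    have e1 : P.1 = s * P.1 + t * P.1 := by rw [← add_mul, hst, one_mul]
    have e2 : Q.1 = s * Q.1 + t * Q.1 := by rw [← add_mul, hst, one_mul]
    have h1 := mul_le_mul_of_nonneg_left hPQ hs
    have h2 := mul_le_mul_of_nonneg_left hPQ ht
    simp only [Prod.fst_add, Prod.smul_fst, smul_eq_mul]
    constructor <;> linarith
  constructor
  · rintro ⟨hn, P, Q, hPQ, hlen⟩
    refine ⟨hn, ?_⟩
    rw [h.lowerFace_eq] at hPQ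
    have hn' : (0 : ℝ) < n := by exact_mod_cast hn
    have hle : P.1 ≤ Q.1 := by linarith
    have h1 := key _ _ P (hPQ ▸ left_mem_segment ℝ P Q) hab
    have h2 := key _ _ Q (hPQ ▸ right_mem_segment ℝ P Q) hab
    have h3 := key _ _ _ (hPQ ▸ left_mem_segment ℝ ((a : ℝ), w + m * a) ((b : ℝ), w + m * b)) hle
    have h4 := key _ _ _ (hPQ ▸ right_mem_segment ℝ ((a : ℝ), w + m * a) ((b : ℝ), w + m * b)) hle
    simp only at h1 h2 h3 h4
    have : (b : ℝ) = a + n := by linarith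
    exact_mod_cast this
  · rintro ⟨hn, rfl⟩
    refine ⟨hn, _, _, h.lowerFace_eq, ?_⟩
    push_cast
    ring

theorem Face.hasSlope_iff {L : SkewPolynomial (Germ C q)} {m w : ℝ} {a b : ℕ}
    (h : Face L m w a b) : HasSlope L m ↔ a < b := by
  constructor
  · rintro ⟨n, hn⟩
    have := (h.hasSide_iff n).mp hn
    omega
  · intro hab
    exact ⟨b - a, (h.hasSide_iff _).mpr ⟨by omega, by omega⟩⟩

/-- An operator with all its order on the side of slope `m` has no other slope. -/
theorem Face.slope_unique {L : SkewPolynomial (Germ C q)} {m w : ℝ} {n : ℕ}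
    (h : Face L m w 0 n) (hord : ∀ i, n < i → L.coeff i = 0) {m' w' : ℝ} {a b : ℕ}
    (h' : Face L m' w' a b) (hab : a < b) : m' = m := by
  have hbn : b ≤ n := by
    by_contra! hlt
    exact h'.right_ne (hord b hlt)
  have hbn' : (b : ℝ) ≤ n := by exact_mod_cast hbn
  have hab' : (a : ℝ) < b := by exact_mod_cast hab
  have ha0 : (0 : ℝ) ≤ a := by positivity
  have h0 := h.left_eq
  have h1 := h.right_eq
  have e1 := h'.bound 0 h.left_ne
  have e2 := h'.bound n h.right_ne
  have e3 := h.bound a h'.left_ne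
  have e4 := h.bound b h'.right_ne
  have e5 := h'.left_eq
  have e6 := h'.right_eq
  simp only [Nat.cast_zero, mul_zero, add_zero] at h0 e1
  rcases lt_trichotomy m' m with hlt | heq | hlt
  · nlinarith
  · exact heq
  · nlinarith

/-! ### Ramification of operators -/

variable {p : Cˣ} {s : ℕ} [NeZero s]

theorem coeff_ramifyOp (L : SkewPolynomial (Germ C q)) (i : ℕ) :
    (ramifyOp p s L).coeff i = Germ.ramify q p s (L.coeff i) := by
  have h : ∀ (T : Finset ℕ) (f : ℕ → SkewPolynomial (Germ C p)),
      (∑ j ∈ T, f j).coeff i = ∑ j ∈ T, (f j).coeff i := by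
    intro T f
    classical
    induction T using Finset.induction_on with
    | empty => simp
    | insert j T hj ih => rw [Finset.sum_insert hj, Finset.sum_insert hj,
        SkewPolynomial.coeff_add, ih]
  rw [ramifyOp, SkewPolynomial.sum_def, h]
  simp_rw [SkewPolynomial.coeff_monomial]
  rw [Finset.sum_ite_eq' L.support i]
  split_ifs with hi
  · rfl
  · rw [SkewPolynomial.notMem_support_iff] at hi
    rw [hi, map_zero]

theorem zcoeff_ramify_mul (f : Germ C q) (k : ℤ) :
    zcoeff (Germ.ramify q p s f) (s * k) = zcoeff f k := by
  rcases lt_or_ge k 0 with hk | hk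
  · rw [zcoeff_of_neg _ hk, zcoeff_of_neg]
    exact mul_neg_of_pos_of_neg (by exact_mod_cast Nat.pos_of_ne_zero (NeZero.ne s)) hk
  · lift k to ℕ using hk
    rw [← Nat.cast_mul, zcoeff_natCast, zcoeff_natCast]
    exact PowerSeries.coeff_expand_mul s (NeZero.ne s) f.1 k

theorem zcoeff_ramify_of_not_dvd (f : Germ C q) {k : ℤ} (hk : ¬ (s : ℤ) ∣ k) :
    zcoeff (Germ.ramify q p s f) k = 0 := by
  rcases lt_or_ge k 0 with h0 | h0
  · exact zcoeff_of_neg _ h0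
  · lift k to ℕ using h0
    rw [zcoeff_natCast]
    exact PowerSeries.coeff_expand_of_not_dvd s (NeZero.ne s) f.1 (fun h => hk (by exact_mod_cast h))

theorem Germ.ramify_sigma (hp : p ^ s = q) (f : Germ C q) :
    Germ.ramify q p s (Germ.sigma q f) = Germ.sigma p (Germ.ramify q p s f) := by
  apply Germ.ext_zcoeff
  intro k
  rw [zcoeff_sigma]
  by_cases hk : (s : ℤ) ∣ k
  · obtain ⟨j, rfl⟩ := hk
    rw [zcoeff_ramify_mul, zcoeff_ramify_mul, zcoeff_sigma, ← hp, zpow_mul, zpow_natCast]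
  · rw [zcoeff_ramify_of_not_dvd _ hk, zcoeff_ramify_of_not_dvd _ hk, mul_zero]

theorem Germ.ramify_smul (hp : p ^ s = q) (n : ℕ) (f : Germ C q) :
    Germ.ramify q p s (Multiplicative.ofAdd n • f) =
      Multiplicative.ofAdd n • Germ.ramify q p s f := by
  induction n with
  | zero => simp
  | succ n ih => rw [Germ.smul_succ, Germ.smul_succ, Germ.ramify_sigma hp, ih]

theorem ramifyOp_mul (hp : p ^ s = q) (A B : SkewPolynomial (Germ C q)) :
    ramifyOp p s (A * B) = ramifyOp p s A * ramifyOp p s B := by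
  ext n
  rw [coeff_ramifyOp, coeff_mul_eq_sum, coeff_mul_eq_sum, map_sum]
  refine Finset.sum_congr rfl fun z _ => ?_
  rw [map_mul, Germ.ramify_smul hp, coeff_ramifyOp, coeff_ramifyOp]

theorem ord_ramify {f : Germ C q} (hf : f ≠ 0) :
    (Germ.ramify q p s f).ord = s * f.ord := by
  have h1 : (Germ.ramify q p s f) ≠ 0 := by
    rwa [Ne, map_eq_zero_iff _ (Germ.ramify_injective q p s)]
  have hs : 0 < s := Nat.pos_of_ne_zero (NeZero.ne s)
  apply le_antisymm
  · have : zcoeff (Germ.ramify q p s f) ((s : ℤ) * f.ord) ≠ 0 := by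
      rw [zcoeff_ramify_mul]
      exact zcoeff_ord_ne_zero hf
    exact_mod_cast ord_le_of_zcoeff_ne_zero this
  · have h2 := zcoeff_ord_ne_zero h1
    by_cases hk : (s : ℤ) ∣ (Germ.ramify q p s f).ord
    · obtain ⟨j, hj⟩ := hk
      rw [hj, zcoeff_ramify_mul] at h2
      have := ord_le_of_zcoeff_ne_zero h2
      have h3 : ((Germ.ramify q p s f).ord : ℤ) ≥ s * f.ord := by
        rw [hj]
        exact mul_le_mul_of_nonneg_left this (by positivity)
      exact_mod_cast h3
    · exact absurd (zcoeff_ramify_of_not_dvd f hk) h2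

/-- Integral supporting lines in terms of coefficients and in terms of orders. -/
theorem face_iff_intFace (A : SkewPolynomial (Germ C q)) (e w : ℤ) (a b : ℕ) :
    Face A e w a b ↔ IntFace A e w a b := by
  constructor
  · intro h
    refine ⟨fun i k hk => ?_, ?_, ?_, fun i hi => ?_⟩
    · by_cases h0 : A.coeff i = 0
      · rw [h0, zcoeff_zero]
      · have := h.bound i h0
        have h2 : w + e * i ≤ (A.coeff i).ord := by exact_mod_cast this
        exact zcoeff_of_lt_ord (by omega)
    · have : ((A.coeff a).ord : ℤ) = w + e * a := by exact_mod_cast h.left_eq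
      rw [← this]
      exact zcoeff_ord_ne_zero h.left_ne
    · have : ((A.coeff b).ord : ℤ) = w + e * b := by exact_mod_cast h.right_eq
      rw [← this]
      exact zcoeff_ord_ne_zero h.right_ne
    · have h0 := ne_zero_of_zcoeff_ne_zero hi
      have h1 := ord_le_of_zcoeff_ne_zero hi
      have h2 : w + e * i ≤ ((A.coeff i).ord : ℤ) := by exact_mod_cast h.bound i h0
      have h3 : ((A.coeff i).ord : ℤ) = w + e * i := le_antisymm h1 h2
      exact h.mem i h0 (by exact_mod_cast h3)
  · intro h
    have hb : ∀ i, A.coeff i ≠ 0 → w + e * i ≤ ((A.coeff i).ord : ℤ) := by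
      intro i hi
      by_contra! hlt
      exact zcoeff_ord_ne_zero hi (h.vanish i _ hlt)
    have ha0 := ne_zero_of_zcoeff_ne_zero h.left_ne
    have hb0 := ne_zero_of_zcoeff_ne_zero h.right_ne
    have ha1 := le_antisymm (ord_le_of_zcoeff_ne_zero h.left_ne) (hb a ha0)
    have hb1 := le_antisymm (ord_le_of_zcoeff_ne_zero h.right_ne) (hb b hb0)
    refine ⟨fun i hi => ?_, ha0, by exact_mod_cast ha1, hb0, by exact_mod_cast hb1,
      fun i hi he => h.mem i ?_⟩
    · exact_mod_cast hb i hi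
    · have he' : ((A.coeff i).ord : ℤ) = w + e * i := by exact_mod_cast he
      rw [← he']
      exact zcoeff_ord_ne_zero hi

theorem face_ramifyOp_iff (A : SkewPolynomial (Germ C q)) (m w : ℝ) (a b : ℕ) :
    Face (ramifyOp p s A) (s * m) (s * w) a b ↔ Face A m w a b := by
  have hs : (0 : ℝ) < s := by exact_mod_cast Nat.pos_of_ne_zero (NeZero.ne s)
  have hne : ∀ i, (ramifyOp p s A).coeff i ≠ 0 ↔ A.coeff i ≠ 0 := fun i => by
    rw [coeff_ramifyOp, Ne, map_eq_zero_iff _ (Germ.ramify_injective q p s)]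
  have hord : ∀ i, A.coeff i ≠ 0 → (((ramifyOp p s A).coeff i).ord : ℝ) =
      s * ((A.coeff i).ord : ℝ) := fun i hi => by
    rw [coeff_ramifyOp, ord_ramify hi]
    push_cast
    ring
  have hline : ∀ i : ℕ, (s : ℝ) * w + s * m * i = s * (w + m * i) := fun i => by ring
  constructor
  · rintro ⟨h1, h2, h3, h4, h5, h6⟩
    rw [hne] at h2 h4
    rw [hord _ h2, hline] at h3
    rw [hord _ h4, hline] at h5
    refine ⟨fun i hi => ?_, h2, mul_left_cancel₀ hs.ne' h3, h4, mul_left_cancel₀ hs.ne' h5,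
      fun i hi he => h6 i ((hne i).mpr hi) ?_⟩
    · have := h1 i ((hne i).mpr hi)
      rw [hord _ hi, hline] at this
      exact le_of_mul_le_mul_left this hs
    · rw [hord _ hi, hline, he]
  · rintro ⟨h1, h2, h3, h4, h5, h6⟩
    refine ⟨fun i hi => ?_, (hne a).mpr h2, ?_, (hne b).mpr h4, ?_, fun i hi he => ?_⟩
    · rw [hne] at hi
      rw [hord _ hi, hline]
      exact mul_le_mul_of_nonneg_left (h1 i hi) hs.le
    · rw [hord _ h2, hline, h3]
    · rw [hord _ h4, hline, h5]
    · rw [hne] at hi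
      rw [hord _ hi, hline] at he
      exact h6 i hi (mul_left_cancel₀ hs.ne' he)

/-- After the ramification `x = t ^ s` the slope `m` becomes the integral slope `e = s m`. -/
theorem Face.exists_intFace {L : SkewPolynomial (Germ C q)} {m w : ℝ} {a b : ℕ}
    (h : Face L m w a b) (p : Cˣ) (s : ℕ) [NeZero s] {e : ℤ} (he : (e : ℝ) = s * m) :
    ∃ v : ℤ, (v : ℝ) = s * w ∧ IntFace (ramifyOp p s L) e v a b := by
  refine ⟨s * ((L.coeff a).ord : ℤ) - e * a, ?_, ?_⟩
  · push_cast
    rw [he, h.left_eq]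
    ring
  · rw [← face_iff_intFace]
    have h1 := (face_ramifyOp_iff (p := p) (s := s) L m w a b).mpr h
    rw [← he] at h1
    convert h1 using 1
    push_cast
    rw [he, h.left_eq]
    ring

theorem IntFace.face_of_ramifyOp {L : SkewPolynomial (Germ C q)} {e v : ℤ} {a b : ℕ}
    (h : IntFace (ramifyOp p s L) e v a b) {m : ℝ} (he : (e : ℝ) = s * m) :
    Face L m (v / s) a b := by
  have hs : (s : ℝ) ≠ 0 := by exact_mod_cast NeZero.ne s
  rw [← face_iff_intFace, he] at h
  rw [← face_ramifyOp_iff (p := p) (s := s)]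
  convert h using 1
  field_simp

theorem Face.slope_rat {L : SkewPolynomial (Germ C q)} {m w : ℝ} {a b : ℕ}
    (h : Face L m w a b) (hab : a < b) : ∃ μ : ℚ, m = (μ : ℝ) := by
  refine ⟨(((L.coeff b).ord : ℚ) - ((L.coeff a).ord : ℚ)) / ((b : ℚ) - a), ?_⟩
  have hab' : (a : ℝ) < b := by exact_mod_cast hab
  push_cast
  rw [h.left_eq, h.right_eq, eq_div_iff (by linarith)]
  ring

theorem rat_num_eq_den_mul (μ : ℚ) : (μ.num : ℝ) = (μ.den : ℝ) * ((μ : ℚ) : ℝ) := by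
  have h := Rat.den_mul_eq_num μ
  exact_mod_cast h.symm

end

/-! ### Units and divisibility in the ring of germs -/

/-- A sequence bounded by a convolution of its previous terms with a geometric sequence grows at
most geometrically. -/
theorem exists_geometric_bound {y : ℕ → ℝ} {A B : ℝ} (hA : 0 ≤ A) (hB : 0 < B)
    (h : ∀ n, y (n + 1) ≤ ∑ k ∈ Finset.range (n + 1), A * B ^ (n + 1 - k) * y k)
    (hy : ∀ n, 0 ≤ y n) : ∀ n, y n ≤ y 0 * (B * (1 + A)) ^ n := by
  -- The normalized partial sums grow at most by the factor `1 + A` at each step.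
  have hS : ∀ n, ∑ k ∈ Finset.range (n + 1), (B ^ k)⁻¹ * y k ≤ y 0 * (1 + A) ^ n := by
    intro n
    induction n with
    | zero => simp
    | succ n ih =>
      rw [Finset.sum_range_succ]
      have h1 : (B ^ (n + 1))⁻¹ * y (n + 1) ≤
          A * ∑ k ∈ Finset.range (n + 1), (B ^ k)⁻¹ * y k := by
        rw [inv_mul_le_iff₀ (by positivity)]
        refine (h n).trans (le_of_eq ?_)
        rw [Finset.mul_sum, Finset.mul_sum]
        refine Finset.sum_congr rfl fun k hk => ?_
        have hk' : k ≤ n + 1 := (Finset.mem_range.mp hk).le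
        have : B ^ (n + 1) = B ^ (n + 1 - k) * B ^ k := by
          rw [← pow_add, Nat.sub_add_cancel hk']
        rw [this]
        field_simp
      calc _ ≤ (1 + A) * ∑ k ∈ Finset.range (n + 1), (B ^ k)⁻¹ * y k := by linarith
        _ ≤ (1 + A) * (y 0 * (1 + A) ^ n) := by gcongr
        _ = _ := by ring
  intro n
  have h1 : (B ^ n)⁻¹ * y n ≤ ∑ k ∈ Finset.range (n + 1), (B ^ k)⁻¹ * y k :=
    Finset.single_le_sum (f := fun k => (B ^ k)⁻¹ * y k)
      (fun k _ => mul_nonneg (by positivity) (hy k)) (Finset.self_mem_range_succ n)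
  have h2 := h1.trans (hS n)
  rw [inv_mul_le_iff₀ (by positivity)] at h2
  calc y n ≤ _ := h2
    _ = _ := by rw [mul_pow]; ring

theorem IsConvergent.inv {f : C⟦X⟧} (hf : IsConvergent f)
    (h0 : PowerSeries.constantCoeff f ≠ 0) : IsConvergent f⁻¹ := by
  obtain ⟨A, B, hA, hB, h⟩ := hf.exists_le
  set c := PowerSeries.constantCoeff f with hc
  have hrec : ∀ n, ‖PowerSeries.coeff (n + 1) f⁻¹‖ ≤
      ∑ k ∈ Finset.range (n + 1), (‖c‖⁻¹ * A) * B ^ (n + 1 - k) * ‖PowerSeries.coeff k f⁻¹‖ := by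
    intro n
    rw [PowerSeries.coeff_inv, if_neg (Nat.succ_ne_zero n), ← hc, norm_mul, norm_neg, norm_inv]
    rw [Finset.Nat.sum_antidiagonal_eq_sum_range_succ_mk, Finset.sum_range_succ']
    rw [← Finset.sum_range_reflect]
    have hlast : (if n + 1 - 0 < n + 1 then
      PowerSeries.coeff 0 f * PowerSeries.coeff (n + 1 - 0) f⁻¹ else 0) = 0 := if_neg (by omega)
    simp only [hlast, add_zero]
    refine (mul_le_mul_of_nonneg_left (norm_sum_le _ _) (by positivity)).trans ?_
    rw [Finset.mul_sum]
    refine Finset.sum_le_sum fun k hk => ?_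
    have hk' : k ≤ n := Nat.lt_succ_iff.mp (Finset.mem_range.mp hk)
    have e1 : n + 1 - 1 - k + 1 = n + 1 - k := by omega
    have e2 : n + 1 - (n + 1 - k) = k := by omega
    rw [e1, e2, if_pos (by omega), norm_mul]
    calc _ ≤ ‖c‖⁻¹ * ((A * B ^ (n + 1 - k)) * ‖PowerSeries.coeff k f⁻¹‖) := by
          gcongr
          exact h _
      _ = _ := by ring
  have := exists_geometric_bound (y := fun n => ‖PowerSeries.coeff n f⁻¹‖)
    (by positivity) hB hrec (fun n => norm_nonneg _)
  exact isConvergent_of_le (by positivity) this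

section

variable {q : Cˣ}

/-- The germ of a convergent power series. -/
def Germ.ofSeries (q : Cˣ) (f : C⟦X⟧) (hf : IsConvergent f) : Germ C q := ⟨f, hf⟩

theorem zcoeff_ofSeries_mk (a : ℕ → C) (h : IsConvergent (PowerSeries.mk a)) (n : ℕ) :
    zcoeff (Germ.ofSeries q (PowerSeries.mk a) h) n = a n := by
  rw [zcoeff_natCast]
  exact PowerSeries.coeff_mk _ _

theorem Germ.exists_norm_le (f : Germ C q) :
    ∃ A B : ℝ, 0 ≤ A ∧ 0 < B ∧ ∀ n : ℕ, ‖zcoeff f n‖ ≤ A * B ^ n := by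
  obtain ⟨A, B, hA, hB, h⟩ := f.2.exists_le
  refine ⟨A, B, hA, hB, fun n => ?_⟩
  rw [zcoeff_natCast]
  exact h n

theorem zcoeff_zero_eq (f : Germ C q) :
    zcoeff f 0 = PowerSeries.constantCoeff (Germ.toSeries f) := by
  have := zcoeff_natCast f 0
  rw [Nat.cast_zero] at this
  rw [this, PowerSeries.coeff_zero_eq_constantCoeff]

theorem Germ.isUnit_of_zcoeff_zero_ne_zero {f : Germ C q} (h : zcoeff f 0 ≠ 0) : IsUnit f := by
  rw [zcoeff_zero_eq] at h
  refine IsUnit.of_mul_eq_one ⟨(Germ.toSeries f)⁻¹, IsConvergent.inv f.2 h⟩ ?_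
  exact Subtype.ext (PowerSeries.mul_inv_cancel _ h)

theorem zcoeff_const (a : C) (k : ℤ) : zcoeff (Germ.const q a) k = if k = 0 then a else 0 := by
  rcases lt_or_ge k 0 with hk | hk
  · rw [zcoeff_of_neg _ hk, if_neg hk.ne]
  · lift k to ℕ using hk
    rw [zcoeff_natCast]
    change PowerSeries.coeff k (PowerSeries.C a) = _
    rw [PowerSeries.coeff_C]
    simp

theorem zcoeff_const_mul (a : C) (f : Germ C q) (k : ℤ) :
    zcoeff (Germ.const q a * f) k = a * zcoeff f k := by
  rw [zcoeff, map_mul, map_mul]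
  change (HahnSeries.ofPowerSeries ℤ C (PowerSeries.C a) * _).coeff k = _
  rw [HahnSeries.ofPowerSeries_C, HahnSeries.C_mul_eq_smul, HahnSeries.coeff_smul]
  rfl

theorem zcoeff_coord_pow_mul (n : ℕ) (f : Germ C q) (k : ℤ) :
    zcoeff (Germ.coord q ^ n * f) k = zcoeff f (k - n) := by
  rw [zcoeff, map_mul, map_mul, map_pow]
  change (HahnSeries.ofPowerSeries ℤ C (PowerSeries.X ^ n) * _).coeff k = _
  rw [HahnSeries.ofPowerSeries_X_pow, HahnSeries.coeff_single_mul, one_mul]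
  rfl

theorem Germ.coord_ne_zero : Germ.coord q ≠ 0 := by
  intro h
  have h1 := zcoeff_coord_pow_mul (q := q) 1 1 1
  have h2 : zcoeff (1 : Germ C q) 0 = 1 := by
    have := zcoeff_const (q := q) 1 0
    rw [if_pos rfl] at this
    rw [← this]
    exact congrArg (fun f : Germ C q => zcoeff f 0)
      (Subtype.ext (map_one (PowerSeries.C (R := C))).symm)
  rw [pow_one, h, zero_mul, zcoeff_zero] at h1
  simp [h2] at h1

theorem Germ.exists_coord_pow_mul {f : Germ C q} {n : ℕ} (h : ∀ k < (n : ℤ), zcoeff f k = 0) :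
    ∃ g : Germ C q, f = Germ.coord q ^ n * g := by
  obtain ⟨A, B, hA, hB, hb⟩ := f.exists_norm_le
  have hconv : IsConvergent (PowerSeries.mk fun k : ℕ => zcoeff f (k + n : ℕ)) := by
    refine isConvergent_of_le (A := A * B ^ n) hB fun k => ?_
    rw [PowerSeries.coeff_mk]
    refine (hb _).trans (le_of_eq ?_)
    rw [pow_add]
    ring
  refine ⟨Germ.ofSeries q _ hconv, Germ.ext_zcoeff fun k => ?_⟩
  rw [zcoeff_coord_pow_mul]
  rcases lt_or_ge k n with hk | hk
  · rw [h k hk, zcoeff_of_neg _ (by omega)]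
  · obtain ⟨j, rfl⟩ : ∃ j : ℕ, k = j + n := ⟨(k - n).toNat, by omega⟩
    rw [add_sub_cancel_right, zcoeff_ofSeries_mk, Nat.cast_add]

theorem Germ.eq_coord_pow_mul_unit {f : Germ C q} (hf : f ≠ 0) :
    ∃ (n : ℕ) (u : Germ C q), IsUnit u ∧ f = Germ.coord q ^ n * u := by
  obtain ⟨u, hu⟩ := Germ.exists_coord_pow_mul (f := f) (n := f.ord)
    (fun k hk => zcoeff_of_lt_ord hk)
  refine ⟨f.ord, u, Germ.isUnit_of_zcoeff_zero_ne_zero ?_, hu⟩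
  have := zcoeff_ord_ne_zero hf
  rw [hu] at this
  rw [zcoeff_coord_pow_mul] at this
  rw [← hu] at this
  simpa using this

theorem Germ.sigma_const (a : C) : Germ.sigma q (Germ.const q a) = Germ.const q a := by
  apply Germ.ext_zcoeff
  intro k
  rw [zcoeff_sigma, zcoeff_const]
  split_ifs with h
  · simp [h]
  · simp

theorem Germ.sigma_coord : Germ.sigma q (Germ.coord q) = Germ.const q q * Germ.coord q := by
  apply Germ.ext_zcoeff
  intro k
  have h : ∀ k, zcoeff (Germ.coord q) k = zcoeff (Germ.const q (1 : C)) (k - 1) := by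
    intro k
    have := zcoeff_coord_pow_mul (q := q) 1 (Germ.const q 1) k
    rw [pow_one] at this
    rw [← Nat.cast_one (R := ℤ), ← this]
    congr 1
    have h1 : Germ.const q (1 : C) = 1 := Subtype.ext (map_one (PowerSeries.C (R := C)))
    rw [h1, mul_one]
  rw [zcoeff_sigma, zcoeff_const_mul, h, zcoeff_const]
  split_ifs with h1
  · have : k = 1 := by omega
    simp [this]
  · simp

theorem Germ.ramify_coord {p : Cˣ} {s : ℕ} [NeZero s] :
    Germ.ramify q p s (Germ.coord q) = Germ.coord p ^ s :=
  Subtype.ext (PowerSeries.expand_X s (NeZero.ne s))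

/-- A germ in `t` is a combination of `1, t, …, t ^ (s - 1)` with coefficients germs in
`x = t ^ s`. -/
theorem Germ.exists_sum_coord_pow_mul_ramify (q : Cˣ) {p : Cˣ} (s : ℕ) [NeZero s] (f : Germ C p) :
    ∃ g : ℕ → Germ C q,
      f = ∑ i ∈ Finset.range s, Germ.coord p ^ i * Germ.ramify q p s (g i) := by
  obtain ⟨A, B, hA, hB, hb⟩ := f.exists_norm_le
  have hconv : ∀ i : ℕ, IsConvergent (PowerSeries.mk fun k : ℕ => zcoeff f (s * k + i : ℕ)) := by
    intro i
    refine isConvergent_of_le (A := A * B ^ i) (pow_pos hB s) fun k => ?_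
    rw [PowerSeries.coeff_mk]
    refine (hb _).trans (le_of_eq ?_)
    rw [pow_add, pow_mul]
    ring
  have hs : (0 : ℤ) < s := by exact_mod_cast Nat.pos_of_ne_zero (NeZero.ne s)
  refine ⟨fun i => Germ.ofSeries q _ (hconv i), Germ.ext_zcoeff fun k => ?_⟩
  rw [zcoeff_sum]
  simp_rw [zcoeff_coord_pow_mul]
  rcases lt_or_ge k 0 with hk | hk
  · rw [zcoeff_of_neg _ hk]
    exact (Finset.sum_eq_zero fun i _ => zcoeff_of_neg _ (by omega)).symm
  lift k to ℕ using hk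
  rw [Finset.sum_eq_single (k % s)]
  · have he : (k : ℤ) - (k % s : ℕ) = s * (k / s : ℕ) := by
      have := Nat.div_add_mod k s
      have h2 : (k : ℤ) = s * (k / s : ℕ) + (k % s : ℕ) := by exact_mod_cast this.symm
      omega
    rw [he, zcoeff_ramify_mul, zcoeff_ofSeries_mk, Nat.div_add_mod]
  · intro i hi hne
    apply zcoeff_ramify_of_not_dvd
    intro hd
    apply hne
    have hi' := Finset.mem_range.mp hi
    have h1 : (k : ℤ) % s = i % s := (Int.modEq_iff_dvd.mpr hd).symm
    have h2 : k % s = i % s := by exact_mod_cast h1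
    rw [h2, Nat.mod_eq_of_lt hi']
  · intro h
    exact absurd (Finset.mem_range.mpr (Nat.mod_lt _ (Nat.pos_of_ne_zero (NeZero.ne s)))) h

end

/-! ### Analytic solutions in the presence of small divisors -/

/-- The solution of the recursion `h_0 = 1`, `h_{n+1} = ∑_{l ≤ n} R (n + 1) l * h_l`. -/
def recSeq (R : ℕ → ℕ → C) : ℕ → C
  | 0 => 1
  | n + 1 => ∑ l : Fin (n + 1), R (n + 1) l * recSeq R l

theorem recSeq_succ (R : ℕ → ℕ → C) (n : ℕ) :
    recSeq R (n + 1) = ∑ l ∈ Finset.range (n + 1), R (n + 1) l * recSeq R l := by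
  rw [recSeq, Finset.sum_range]

/-- A linear `q`-difference equation with analytic coefficients whose characteristic polynomial
vanishes at `1` has an analytic solution with value `1` at zero, when the products of the
successive values of the characteristic polynomial decrease at most geometrically. -/
theorem exists_solution {p : Cˣ} (hp : ‖(p : C)‖ = 1) (T : Finset ℕ) (c : ℕ → Germ C p)
    (h1 : ∑ i ∈ T, zcoeff (c i) 0 = 0)
    (hdiv : ∃ A > (0 : ℝ), ∃ B > (0 : ℝ), ∀ n : ℕ,
      A * B ^ n ≤ ∏ j ∈ Finset.range n, ‖∑ i ∈ T, zcoeff (c i) 0 * ((p : C) ^ (j + 1)) ^ i‖) :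
    ∃ h : Germ C p, zcoeff h 0 = 1 ∧ ∑ i ∈ T, c i * (Multiplicative.ofAdd i • h) = 0 := by
  obtain ⟨A₀, hA₀, B₀, hB₀, hdiv⟩ := hdiv
  -- `Q m x` is the polynomial formed by the coefficients of order `m`.
  set Q : ℕ → C → C := fun m x => ∑ i ∈ T, zcoeff (c i) m * x ^ i with hQ
  have hQ0 : ∀ x, Q 0 x = ∑ i ∈ T, zcoeff (c i) 0 * x ^ i := fun x => by simp [hQ]
  obtain ⟨A, B, hA, hB, hbound⟩ : ∃ A B : ℝ, 0 ≤ A ∧ 1 ≤ B ∧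
      ∀ m l : ℕ, ‖Q m ((p : C) ^ l)‖ ≤ A * B ^ m := by
    choose a b ha hb hab using fun i => (c i).2.exists_le
    refine ⟨∑ i ∈ T, a i, 1 + ∑ i ∈ T, b i, Finset.sum_nonneg fun i _ => ha i, ?_, ?_⟩
    · have : 0 ≤ ∑ i ∈ T, b i := Finset.sum_nonneg fun i _ => (hb i).le
      linarith
    · intro m l
      rw [Finset.sum_mul]
      refine (norm_sum_le _ _).trans (Finset.sum_le_sum fun i hi => ?_)
      rw [norm_mul, norm_pow, norm_pow, hp, one_pow, one_pow, mul_one, zcoeff_natCast]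
      refine (hab i m).trans ?_
      have h3 : b i ≤ 1 + ∑ j ∈ T, b j := by
        have := Finset.single_le_sum (f := b) (fun j _ => (hb j).le) hi
        linarith
      exact mul_le_mul_of_nonneg_left (pow_le_pow_left₀ (hb i).le h3 m) (ha i)
  set D : ℕ → ℝ := fun n => ∏ j ∈ Finset.range n, ‖Q 0 ((p : C) ^ (j + 1))‖ with hD
  have hDlow : ∀ n, A₀ * B₀ ^ n ≤ D n := fun n => by simpa only [hD, hQ0] using hdiv n
  have hDpos : ∀ n, 0 < D n := fun n => (by positivity : 0 < A₀ * B₀ ^ n).trans_le (hDlow n)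
  have hDsucc : ∀ n, D (n + 1) = D n * ‖Q 0 ((p : C) ^ (n + 1))‖ := fun n =>
    Finset.prod_range_succ _ n
  have hQne : ∀ n, Q 0 ((p : C) ^ (n + 1)) ≠ 0 := by
    intro n h0
    have := hDpos (n + 1)
    rw [hDsucc, h0, norm_zero, mul_zero] at this
    exact lt_irrefl _ this
  set M : ℝ := 1 + A with hM
  have hDmono : ∀ l k, D (l + k) ≤ M ^ k * D l := by
    intro l k
    induction k with
    | zero => simp
    | succ k ih =>
      rw [← add_assoc, hDsucc]
      have h2 := hbound 0 (l + k + 1)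
      rw [pow_zero, mul_one] at h2
      calc _ ≤ (M ^ k * D l) * M := by
            refine mul_le_mul ih (by linarith) (norm_nonneg _) ?_
            have := (hDpos l).le
            positivity
        _ = _ := by ring
  set R : ℕ → ℕ → C := fun n l => -(Q 0 ((p : C) ^ n))⁻¹ * Q (n - l) ((p : C) ^ l) with hR
  set y := recSeq R with hy
  have hrec : ∀ n, Q 0 ((p : C) ^ (n + 1)) * y (n + 1) =
      -∑ l ∈ Finset.range (n + 1), Q (n + 1 - l) ((p : C) ^ l) * y l := by
    intro n
    rw [hy, recSeq_succ, Finset.mul_sum, ← Finset.sum_neg_distrib]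
    refine Finset.sum_congr rfl fun l _ => ?_
    rw [hR]
    have := hQne n
    simp only
    field_simp
  -- `‖y n‖ * D n` is at most `A` times a convolution of its previous terms with `(B M) ^ k`:
  -- the small divisor at step `n + 1` is the last factor of `D (n + 1)`, and the factors of `D n`
  -- after the first `l` ones are at most `M`.
  have hz : ∀ n, ‖y n‖ * D n ≤ ‖y 0‖ * D 0 * ((B * M) * (1 + A)) ^ n := by
    refine exists_geometric_bound (y := fun n => ‖y n‖ * D n) hA (by positivity) ?_
      (fun n => mul_nonneg (norm_nonneg _) (hDpos n).le)
    intro n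
    have e1 : ‖y (n + 1)‖ * D (n + 1) =
        ‖∑ l ∈ Finset.range (n + 1), Q (n + 1 - l) ((p : C) ^ l) * y l‖ * D n := by
      rw [← norm_neg (∑ l ∈ Finset.range (n + 1), Q (n + 1 - l) ((p : C) ^ l) * y l), ← hrec,
        norm_mul, hDsucc]
      ring
    rw [e1]
    refine (mul_le_mul_of_nonneg_right (norm_sum_le _ _) (hDpos n).le).trans ?_
    rw [Finset.sum_mul]
    refine Finset.sum_le_sum fun l hl => ?_
    have hl' : l ≤ n := Nat.lt_succ_iff.mp (Finset.mem_range.mp hl)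
    have h3 : D n ≤ M ^ (n + 1 - l) * D l := by
      have h4 := hDmono l (n - l)
      rw [Nat.add_sub_cancel' hl'] at h4
      refine h4.trans (mul_le_mul_of_nonneg_right ?_ (hDpos l).le)
      exact pow_le_pow_right₀ (by linarith) (by omega)
    rw [norm_mul]
    calc _ ≤ (A * B ^ (n + 1 - l)) * ‖y l‖ * (M ^ (n + 1 - l) * D l) := by
          refine mul_le_mul (mul_le_mul_of_nonneg_right (hbound _ _) (norm_nonneg _)) h3
            (hDpos n).le (by positivity)
      _ = _ := by rw [mul_pow]; ring
  have hy0 : y 0 = 1 := by rw [hy, recSeq]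
  have hconv : IsConvergent (PowerSeries.mk y) := by
    refine isConvergent_of_le (A := A₀⁻¹) (B := (B * M) * (1 + A) * B₀⁻¹) (by positivity)
      fun n => ?_
    rw [PowerSeries.coeff_mk]
    have h2 := hz n
    have hD0 : D 0 = 1 := by simp [hD]
    rw [hy0, hD0, norm_one, one_mul, one_mul] at h2
    have h3 : ‖y n‖ * (A₀ * B₀ ^ n) ≤ ((B * M) * (1 + A)) ^ n :=
      (mul_le_mul_of_nonneg_left (hDlow n) (norm_nonneg _)).trans h2
    rw [← le_div_iff₀ (by positivity)] at h3
    refine h3.trans (le_of_eq ?_)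
    rw [mul_pow _ B₀⁻¹, inv_pow]
    field_simp
  set h : Germ C p := Germ.ofSeries p (PowerSeries.mk y) hconv with hh
  have hcoeff : ∀ n : ℕ, zcoeff h n = y n := zcoeff_ofSeries_mk y hconv
  refine ⟨h, by simpa [hy0] using hcoeff 0, ?_⟩
  have hprod : ∀ n : ℕ, zcoeff (∑ i ∈ T, c i * (Multiplicative.ofAdd i • h)) n =
      ∑ l ∈ Finset.range (n + 1), Q (n - l) ((p : C) ^ l) * y l := by
    intro n
    rw [zcoeff_sum]
    have e1 : ∀ i ∈ T, zcoeff (c i * (Multiplicative.ofAdd i • h)) n =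
        ∑ l ∈ Finset.range (n + 1), zcoeff (c i) ((n - l : ℕ) : ℤ) * ((p : C) ^ l) ^ i * y l := by
      intro i _
      rw [zcoeff_natCast, map_mul, PowerSeries.coeff_mul,
        Finset.Nat.sum_antidiagonal_eq_sum_range_succ_mk, ← Finset.sum_range_reflect]
      refine Finset.sum_congr rfl fun l hl => ?_
      have hl' : l ≤ n := Nat.lt_succ_iff.mp (Finset.mem_range.mp hl)
      have e2 : n - (n - l) = l := by omega
      simp only [Nat.succ_eq_add_one, add_tsub_cancel_right, e2]
      rw [← zcoeff_natCast, ← zcoeff_natCast, zcoeff_smul, hcoeff, ← Nat.cast_mul, zpow_natCast,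
        Units.val_pow_eq_pow_val, mul_comm i l, pow_mul]
      ring
    rw [Finset.sum_congr rfl e1, Finset.sum_comm]
    refine Finset.sum_congr rfl fun l _ => ?_
    rw [hQ, Finset.sum_mul]
  apply Germ.ext_zcoeff
  intro k
  rw [zcoeff_zero]
  rcases lt_or_ge k 0 with hk | hk
  · exact zcoeff_of_neg _ hk
  lift k to ℕ using hk
  rw [hprod, Finset.sum_range_succ, Nat.sub_self]
  cases k with
  | zero =>
    rw [Finset.sum_range_zero, zero_add, hy0, pow_zero, mul_one, hQ0]
    simpa using h1
  | succ n => rw [hrec]; exact add_neg_cancel _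

/-! ### Operators acting on the rank one modules over `K_s` -/

section

variable {q : Cˣ}

theorem Mero.sigma_algebraMap (f : Germ C q) :
    Mero.sigma q (algebraMap (Germ C q) (Mero C q) f) =
      algebraMap (Germ C q) (Mero C q) (Germ.sigma q f) :=
  IsFractionRing.ringEquivOfRingEquiv_algebraMap _ _

theorem Mero.ramify_algebraMap {p : Cˣ} {s : ℕ} [NeZero s] (f : Germ C q) :
    Mero.ramify q p s (algebraMap (Germ C q) (Mero C q) f) =
      algebraMap (Germ C p) (Mero C p) (Germ.ramify q p s f) :=
  IsLocalization.map_eq (M := nonZeroDivisors (Germ C q)) (S := Mero C q)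
    (T := nonZeroDivisors (Germ C p)) (Q := Mero C p)
    (nonZeroDivisors_le_comap_nonZeroDivisors_of_injective _ (Germ.ramify_injective q p s)) f

theorem Mero.smul_succ (n : ℕ) (f : Mero C q) :
    Multiplicative.ofAdd ((n + 1 : ℕ) : ℤ) • f =
      Mero.sigma q (Multiplicative.ofAdd (n : ℤ) • f) := by
  have h : ∀ m : ℤ, Multiplicative.ofAdd m • f = (Mero.sigma q ^ m : RingAut (Mero C q)) f :=
    fun m => rfl
  rw [h, h, zpow_natCast, zpow_natCast, pow_succ']
  rfl

theorem Mero.smul_algebraMap (n : ℕ) (f : Germ C q) :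
    Multiplicative.ofAdd (n : ℤ) • algebraMap (Germ C q) (Mero C q) f =
      algebraMap (Germ C q) (Mero C q) (Multiplicative.ofAdd n • f) := by
  induction n with
  | zero => simp
  | succ n ih => rw [Mero.smul_succ, ih, Mero.sigma_algebraMap, Germ.smul_succ]

theorem Mero.ramify_sigma {p : Cˣ} {s : ℕ} [NeZero s] (hp : p ^ s = q) (f : Mero C q) :
    Mero.ramify q p s (Mero.sigma q f) = Mero.sigma p (Mero.ramify q p s f) := by
  obtain ⟨a, b, hb, rfl⟩ := IsFractionRing.div_surjective (A := Germ C q) f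
  simp only [map_div₀, Mero.sigma_algebraMap, Mero.ramify_algebraMap, Germ.ramify_sigma hp]

variable (p : Cˣ)

/-- The coordinate `x` as an element of the field of meromorphic germs. -/
def Mero.coord (q : Cˣ) : Mero C q := algebraMap (Germ C q) (Mero C q) (Germ.coord q)

/-- A constant as an element of the field of meromorphic germs. -/
def Mero.const (q : Cˣ) (a : C) : Mero C q := algebraMap (Germ C q) (Mero C q) (Germ.const q a)

theorem Mero.coord_ne_zero : Mero.coord q ≠ 0 := by
  rw [Mero.coord, Ne, IsFractionRing.to_map_eq_zero_iff]
  exact Germ.coord_ne_zero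

theorem Germ.const_mul (a b : C) : Germ.const q (a * b) = Germ.const q a * Germ.const q b :=
  Subtype.ext (map_mul (PowerSeries.C (R := C)) a b)

theorem Germ.const_one : Germ.const q (1 : C) = 1 :=
  Subtype.ext (map_one (PowerSeries.C (R := C)))

theorem Mero.const_mul (a b : C) : Mero.const q (a * b) = Mero.const q a * Mero.const q b := by
  rw [Mero.const, Germ.const_mul, map_mul]
  rfl

theorem Mero.const_one : Mero.const q (1 : C) = 1 := by
  rw [Mero.const, Germ.const_one, map_one]

theorem Mero.const_pow (a : C) (n : ℕ) : Mero.const q (a ^ n) = Mero.const q a ^ n := by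
  induction n with
  | zero => rw [pow_zero, pow_zero, Mero.const_one]
  | succ n ih => rw [pow_succ, pow_succ, Mero.const_mul, ih]

theorem Mero.const_ne_zero (c : Cˣ) : Mero.const q (c : C) ≠ 0 := by
  intro h
  have h1 : Mero.const q ((c : C) * ((c⁻¹ : Cˣ) : C)) = 0 := by rw [Mero.const_mul, h, zero_mul]
  rw [Units.mul_inv, Mero.const_one] at h1
  exact one_ne_zero h1

theorem Mero.const_inv (c : Cˣ) : Mero.const q ((c⁻¹ : Cˣ) : C) = (Mero.const q (c : C))⁻¹ := by
  refine eq_inv_of_mul_eq_one_left ?_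
  rw [← Mero.const_mul, Units.inv_mul, Mero.const_one]

theorem Mero.const_zpow (c : Cˣ) (n : ℤ) :
    Mero.const q ((c ^ n : Cˣ) : C) = Mero.const q (c : C) ^ n := by
  cases n with
  | ofNat n =>
    rw [Int.ofNat_eq_natCast, zpow_natCast, zpow_natCast, Units.val_pow_eq_pow_val,
      Mero.const_pow]
  | negSucc n =>
    rw [zpow_negSucc, zpow_negSucc, Mero.const_inv, Units.val_pow_eq_pow_val, Mero.const_pow]

theorem Mero.sigma_const (a : C) : Mero.sigma q (Mero.const q a) = Mero.const q a := by
  rw [Mero.const, Mero.sigma_algebraMap, Germ.sigma_const]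

theorem Mero.sigma_coord_zpow (n : ℤ) :
    Mero.sigma q (Mero.coord q ^ n) = Mero.const q ((q ^ n : Cˣ) : C) * Mero.coord q ^ n := by
  rw [map_zpow₀, Mero.coord, Mero.sigma_algebraMap, Germ.sigma_coord, map_mul, mul_zpow,
    Mero.const_zpow]
  rfl

variable {p}
variable {s : ℕ} [NeZero s]

/-- The inclusion of `C{x}[σ_q]` in `K[σ_q, σ_q⁻¹]` as a ring homomorphism. -/
def toSkewLaurentHom (q : Cˣ) : SkewPolynomial (Germ C q) →+* SkewLaurent C q :=
  SkewMonoidAlgebra.liftNCRingHom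
    ((SkewMonoidAlgebra.singleOneRingHom (k := Mero C q) (G := Multiplicative ℤ)).comp
      (algebraMap (Germ C q) (Mero C q)))
    ((SkewMonoidAlgebra.of (Mero C q) (Multiplicative ℤ)).comp
      (AddMonoidHom.toMultiplicative (Nat.castAddMonoidHom ℤ)))
    (by
      intro x y
      have h := Mero.smul_algebraMap y.toAdd x
      simp only [RingHom.comp_apply, MonoidHom.comp_apply, SkewMonoidAlgebra.of_apply]
      change SkewMonoidAlgebra.single 1 _ * SkewMonoidAlgebra.single
        (Multiplicative.ofAdd (y.toAdd : ℤ)) 1 = SkewMonoidAlgebra.single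
        (Multiplicative.ofAdd (y.toAdd : ℤ)) 1 * SkewMonoidAlgebra.single 1 _
      rw [SkewMonoidAlgebra.single_mul_single, SkewMonoidAlgebra.single_mul_single, h]
      simp)

theorem toSkewLaurentHom_apply (L : SkewPolynomial (Germ C q)) :
    toSkewLaurentHom q L = toSkewLaurent L := by
  change (SkewMonoidAlgebra.coeff L).sum _ = (SkewMonoidAlgebra.coeff L).sum _
  refine Finset.sum_congr rfl fun i _ => ?_
  change (SkewMonoidAlgebra.single 1 _ * SkewMonoidAlgebra.single
        (Multiplicative.ofAdd ((Multiplicative.toAdd i : ℕ) : ℤ)) 1 : SkewLaurent C q) = _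
  rw [SkewMonoidAlgebra.single_mul_single]
  simp

theorem addEnd_mul_apply {M : Type*} [AddCommMonoid M] (x y : AddMonoid.End M) (m : M) :
    (x * y) m = x (y m) := rfl

theorem addEnd_sum_apply {M ι : Type*} [AddCommMonoid M] (T : Finset ι) (f : ι → AddMonoid.End M)
    (m : M) : (∑ i ∈ T, f i) m = ∑ i ∈ T, f i m :=
  map_sum (AddMonoidHom.eval m) f T

/-- The operator `Σ_q` of `N_{d,c,s}`, as a unit of the ring of additive endomorphisms. -/
def sigmaUnit (p : Cˣ) (d : ℤ) (c : Cˣ) : (AddMonoid.End (Mero C p))ˣ where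
  val := (AddMonoidHom.mulRight (Mero.const p (c : C) * Mero.coord p ^ (-d))).comp
    ((Mero.sigma p : Mero C p →+* Mero C p) : Mero C p →+ Mero C p)
  inv := (((Mero.sigma p).symm : Mero C p →+* Mero C p) : Mero C p →+ Mero C p).comp
    (AddMonoidHom.mulRight (Mero.const p (c : C) * Mero.coord p ^ (-d))⁻¹)
  val_inv := by
    ext f
    have h : Mero.const p (c : C) * Mero.coord p ^ (-d) ≠ 0 :=
      mul_ne_zero (Mero.const_ne_zero c) (zpow_ne_zero _ Mero.coord_ne_zero)
    change Mero.sigma p ((Mero.sigma p).symm (f * _)) * _ = f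
    rw [RingEquiv.apply_symm_apply, inv_mul_cancel_right₀ h]
  inv_val := by
    ext f
    have h : Mero.const p (c : C) * Mero.coord p ^ (-d) ≠ 0 :=
      mul_ne_zero (Mero.const_ne_zero c) (zpow_ne_zero _ Mero.coord_ne_zero)
    change (Mero.sigma p).symm ((Mero.sigma p f * _) * _) = f
    rw [mul_inv_cancel_right₀ h, RingEquiv.symm_apply_apply]

theorem sigmaUnit_apply (d : ℤ) (c : Cˣ) (f : Mero C p) :
    (sigmaUnit p d c : AddMonoid.End (Mero C p)) f =
      Mero.sigma p f * (Mero.const p (c : C) * Mero.coord p ^ (-d)) := rfl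

/-- The multiplication by elements of `K` on `K_s`. -/
def ramifyMul (q p : Cˣ) (s : ℕ) [NeZero s] : Mero C q →+* AddMonoid.End (Mero C p) :=
  (Module.toAddMonoidEnd (Mero C p) (Mero C p)).comp (Mero.ramify q p s)

theorem sigmaUnit_mul_ramifyMul (hp : p ^ s = q) (d : ℤ) (c : Cˣ) (a : Mero C q) :
    (sigmaUnit p d c : AddMonoid.End (Mero C p)) * ramifyMul q p s a =
      ramifyMul q p s (Mero.sigma q a) * (sigmaUnit p d c : AddMonoid.End (Mero C p)) := by
  ext f
  change (sigmaUnit p d c : AddMonoid.End (Mero C p)) (Mero.ramify q p s a * f) =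
    Mero.ramify q p s (Mero.sigma q a) * (sigmaUnit p d c : AddMonoid.End (Mero C p)) f
  rw [sigmaUnit_apply, sigmaUnit_apply, Mero.ramify_sigma hp, map_mul, mul_assoc]

theorem sigmaUnit_zpow_mul_ramifyMul (hp : p ^ s = q) (d : ℤ) (c : Cˣ) (n : ℤ) (a : Mero C q) :
    ((sigmaUnit p d c ^ n : (AddMonoid.End (Mero C p))ˣ) : AddMonoid.End (Mero C p)) *
        ramifyMul q p s a =
      ramifyMul q p s (Multiplicative.ofAdd n • a) *
        ((sigmaUnit p d c ^ n : (AddMonoid.End (Mero C p))ˣ) : AddMonoid.End (Mero C p)) := by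
  have hnat : ∀ (n : ℕ) (a : Mero C q),
      ((sigmaUnit p d c ^ n : (AddMonoid.End (Mero C p))ˣ) : AddMonoid.End (Mero C p)) *
        ramifyMul q p s a =
      ramifyMul q p s (Multiplicative.ofAdd (n : ℤ) • a) *
        ((sigmaUnit p d c ^ n : (AddMonoid.End (Mero C p))ˣ) : AddMonoid.End (Mero C p)) := by
    intro n a
    induction n with
    | zero => simp
    | succ n ih =>
      rw [pow_succ', Units.val_mul, mul_assoc, ih, ← mul_assoc, sigmaUnit_mul_ramifyMul hp,
        mul_assoc, Mero.smul_succ]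
  cases n with
  | ofNat n => exact hnat n a
  | negSucc n =>
    rw [zpow_negSucc, Units.inv_mul_eq_iff_eq_mul, ← mul_assoc, hnat, smul_smul,
      ← ofAdd_add, mul_assoc, Units.mul_inv, mul_one]
    have h0 : ((n + 1 : ℕ) : ℤ) + Int.negSucc n = 0 := by omega
    rw [h0, ofAdd_zero, one_smul]

/-- The action of `K[σ_q, σ_q⁻¹]` on the module `N_{d,c,s}`. -/
def laurentAct (hp : p ^ s = q) (d : ℤ) (c : Cˣ) : SkewLaurent C q →+* AddMonoid.End (Mero C p) :=
  SkewMonoidAlgebra.liftNCRingHom (ramifyMul q p s)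
    ((Units.coeHom (AddMonoid.End (Mero C p))).comp (zpowersHom _ (sigmaUnit p d c)))
    (fun {x y} => (sigmaUnit_zpow_mul_ramifyMul hp d c y.toAdd x).symm)

theorem laurentAct_single (hp : p ^ s = q) (d : ℤ) (c : Cˣ) (n : ℤ) (a : Mero C q)
    (f : Mero C p) :
    laurentAct hp d c (SkewMonoidAlgebra.single (Multiplicative.ofAdd n) a) f =
      Mero.ramify q p s a * ((sigmaUnit p d c ^ n : (AddMonoid.End (Mero C p))ˣ) :
        AddMonoid.End (Mero C p)) f := by
  have h : laurentAct hp d c (SkewMonoidAlgebra.single (Multiplicative.ofAdd n) a) =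
      ramifyMul q p s a * ((sigmaUnit p d c ^ n : (AddMonoid.End (Mero C p))ˣ) :
        AddMonoid.End (Mero C p)) := SkewMonoidAlgebra.liftNC_single _ _ _ _
  rw [h]
  rfl

theorem laurentAct_smul (hp : p ^ s = q) (d : ℤ) (c : Cˣ) (a : Mero C q) (P : SkewLaurent C q)
    (f : Mero C p) :
    laurentAct hp d c (a • P) f = Mero.ramify q p s a * laurentAct hp d c P f := by
  have h : laurentAct hp d c (a • P) = ramifyMul q p s a * laurentAct hp d c P :=
    SkewMonoidAlgebra.liftNC_smul _ _ a P
  rw [h]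
  rfl

/-- The action of `C{x}[σ_q]` on the module `N_{d,c,s}`. -/
def act (hp : p ^ s = q) (d : ℤ) (c : Cˣ) :
    SkewPolynomial (Germ C q) →+* AddMonoid.End (Mero C p) :=
  (laurentAct hp d c).comp (toSkewLaurentHom q)

theorem act_eq_sum (hp : p ^ s = q) (d : ℤ) (c : Cˣ) (L : SkewPolynomial (Germ C q))
    (T : Finset ℕ) (hT : L.support ⊆ T) (f : Mero C p) :
    act hp d c L f = ∑ i ∈ T,
      algebraMap (Germ C p) (Mero C p) (Germ.ramify q p s (L.coeff i)) *
        ((sigmaUnit p d c ^ i : (AddMonoid.End (Mero C p))ˣ) : AddMonoid.End (Mero C p)) f := by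
  have h0 : act hp d c L f = laurentAct hp d c (toSkewLaurent L) f := by
    rw [← toSkewLaurentHom_apply]
    rfl
  rw [h0, toSkewLaurent, SkewPolynomial.sum_eq_of_subset _ (fun i => by simp) hT, map_sum,
    addEnd_sum_apply]
  refine Finset.sum_congr rfl fun i _ => ?_
  rw [laurentAct_single, zpow_natCast, Mero.ramify_algebraMap]

/-- The iterates of `Σ_q` on the analytic vectors of `N_{d,c,s}`. -/
theorem sigmaUnit_pow_apply (d : ℤ) (c : Cˣ) (n : ℕ) (h : Germ C p) :
    ((sigmaUnit p d c ^ n : (AddMonoid.End (Mero C p))ˣ) : AddMonoid.End (Mero C p))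
      (algebraMap (Germ C p) (Mero C p) h) =
      algebraMap (Germ C p) (Mero C p) (Multiplicative.ofAdd n • h) *
        (Mero.const p ((c ^ n * p ^ (-(d * (n.choose 2 : ℤ))) : Cˣ) : C) *
          Mero.coord p ^ (-(d * n))) := by
  induction n with
  | zero => simp [Mero.const_one]
  | succ n ih =>
    rw [pow_succ', Units.val_mul, addEnd_mul_apply, ih, sigmaUnit_apply, map_mul, map_mul,
      Mero.sigma_algebraMap, ← Germ.smul_succ, Mero.sigma_const, Mero.sigma_coord_zpow]
    have e1 : (c ^ (n + 1) * p ^ (-(d * ((n + 1).choose 2 : ℤ))) : Cˣ) =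
        (c ^ n * p ^ (-(d * (n.choose 2 : ℤ)))) * p ^ (-(d * n)) * c := by
      have h2 := choose_two_add n 1
      norm_num at h2
      rw [h2, mul_add, neg_add, zpow_add, pow_succ]
      ac_rfl
    have e2 : Mero.coord p ^ (-(d * ((n + 1 : ℕ) : ℤ))) =
        Mero.coord p ^ (-(d * n)) * Mero.coord p ^ (-d) := by
      rw [← zpow_add₀ Mero.coord_ne_zero]
      congr 1
      push_cast
      ring
    rw [e1, e2, Units.val_mul _ c, Units.val_mul _ (p ^ (-(d * (n : ℤ)))), Mero.const_mul,
      Mero.const_mul]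
    ring

/-- A germ of order at least `n` is `t ^ n` times a germ. -/
theorem Mero.exists_coord_zpow_mul {f : Germ C p} {n : ℤ} (hf : ∀ k < n, zcoeff f k = 0) :
    ∃ g : Germ C p, algebraMap (Germ C p) (Mero C p) f =
        Mero.coord p ^ n * algebraMap (Germ C p) (Mero C p) g ∧ zcoeff g 0 = zcoeff f n := by
  rcases le_or_gt 0 n with hn | hn
  · lift n to ℕ using hn
    obtain ⟨g, rfl⟩ := Germ.exists_coord_pow_mul hf
    refine ⟨g, ?_, ?_⟩
    · rw [map_mul, map_pow, zpow_natCast]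
      rfl
    · rw [zcoeff_coord_pow_mul, sub_self]
  · obtain ⟨m, rfl⟩ : ∃ m : ℕ, n = -m := ⟨n.natAbs, by omega⟩
    refine ⟨Germ.coord p ^ m * f, ?_, ?_⟩
    · rw [map_mul, map_pow, zpow_neg, zpow_natCast]
      exact (inv_mul_cancel_left₀ (pow_ne_zero _ Mero.coord_ne_zero) _).symm
    · rw [zcoeff_coord_pow_mul, zero_sub]

theorem zcoeff_mul_zero (f g : Germ C q) : zcoeff (f * g) 0 = zcoeff f 0 * zcoeff g 0 := by
  have h := (zcoeff_mul_of_vanish (f := f) (g := g) (K := 0) (M := 0)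
    (fun k hk => zcoeff_of_neg f hk) (fun k hk => zcoeff_of_neg g hk)).2
  simpa using h

/-- On analytic vectors of `N_{d,c,s}` an operator acts, up to a power of the coordinate, by
analytic coefficients whose values at zero are those of the characteristic polynomial. -/
theorem exists_act_eq (hp : p ^ s = q) (d : ℤ) (c : Cˣ) {L : SkewPolynomial (Germ C q)} {w : ℤ}
    {a b : ℕ} (hL : IntFace (ramifyOp p s L) d w a b) :
    ∃ g : ℕ → Germ C p,
      (∀ i, zcoeff (g i) 0 = (charPoly (ramifyOp p s L) d).coeff i * (c : C) ^ i) ∧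
      ∀ h : Germ C p, act hp d c L (algebraMap (Germ C p) (Mero C p) h) =
        Mero.coord p ^ w * algebraMap (Germ C p) (Mero C p)
          (∑ i ∈ L.support, g i * (Multiplicative.ofAdd i • h)) := by
  have hv : ∀ (i : ℕ) (k : ℤ), k < w + d * i → zcoeff (Germ.ramify q p s (L.coeff i)) k = 0 := by
    intro i k hk
    rw [← coeff_ramifyOp]
    exact hL.vanish i k hk
  choose g hg hg0 using fun i => Mero.exists_coord_zpow_mul (hv i)
  refine ⟨fun i => Germ.const p ((c ^ i * p ^ (-(d * (i.choose 2 : ℤ))) : Cˣ) : C) * g i,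
    fun i => ?_, fun h => ?_⟩
  · rw [zcoeff_const_mul, hg0, hL.coeff_charPoly, coeff_ramifyOp, Units.val_mul,
      Units.val_pow_eq_pow_val]
    ring
  · rw [act_eq_sum hp d c L L.support subset_rfl, map_sum, Finset.mul_sum]
    refine Finset.sum_congr rfl fun i _ => ?_
    rw [hg, sigmaUnit_pow_apply, map_mul, map_mul, zpow_add₀ Mero.coord_ne_zero,
      zpow_neg (Mero.coord p)]
    have h0 : Mero.coord p ^ (d * (i : ℤ)) ≠ 0 := zpow_ne_zero _ Mero.coord_ne_zero
    change _ = _ * (Mero.const p _ * _ * _)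
    field_simp

/-- If an operator annihilates an analytic vector with value `1` at zero in `N_{d,c,s}`, then `c`
is a root of its characteristic polynomial. -/
theorem eval_charPoly_eq_zero_of_act_eq_zero (hp : p ^ s = q) (d : ℤ) (c : Cˣ)
    {L : SkewPolynomial (Germ C q)} {w : ℤ} {a b : ℕ}
    (hL : IntFace (ramifyOp p s L) d w a b) {h : Germ C p} (h0 : zcoeff h 0 = 1)
    (hact : act hp d c L (algebraMap (Germ C p) (Mero C p) h) = 0) :
    (charPoly (ramifyOp p s L) d).eval (c : C) = 0 := by
  obtain ⟨g, hg, hgact⟩ := exists_act_eq hp d c hL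
  rw [hgact, mul_eq_zero, or_iff_right (zpow_ne_zero _ Mero.coord_ne_zero),
    IsFractionRing.to_map_eq_zero_iff] at hact
  have h1 := congrArg (fun f => zcoeff f 0) hact
  simp only [zcoeff_zero, zcoeff_sum, zcoeff_mul_zero, zcoeff_smul, mul_zero, zpow_zero,
    Units.val_one, h0, mul_one, hg] at h1
  rw [← h1, Polynomial.eval_eq_sum, Polynomial.sum]
  refine Finset.sum_subset (fun i hi => ?_) (fun i _ hi => ?_)
  · rw [SkewPolynomial.mem_support_iff]
    intro hz
    rw [Polynomial.mem_support_iff, hL.charPoly_coeff_ne_zero_iff, coeff_ramifyOp, hz,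
      map_zero, zcoeff_zero] at hi
    exact hi rfl
  · rw [Polynomial.notMem_support_iff] at hi
    rw [hi, zero_mul]

/-- For a root `c` of the characteristic polynomial, an operator annihilates an analytic vector of
`N_{d,c,s}` with value `1` at zero, when the products of the values of this polynomial at
`c p, c p ^ 2, …` decrease at most geometrically. -/
theorem exists_act_eq_zero (hp : p ^ s = q) (hpn : ‖(p : C)‖ = 1) (d : ℤ) (c : Cˣ)
    {L : SkewPolynomial (Germ C q)} {w : ℤ} {a b : ℕ}
    (hL : IntFace (ramifyOp p s L) d w a b)
    (hroot : (charPoly (ramifyOp p s L) d).eval (c : C) = 0)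
    (hdiv : ∃ A > (0 : ℝ), ∃ B > (0 : ℝ), ∀ n : ℕ, A * B ^ n ≤
      ∏ j ∈ Finset.range n, ‖(charPoly (ramifyOp p s L) d).eval ((c : C) * (p : C) ^ (j + 1))‖) :
    ∃ h : Germ C p, zcoeff h 0 = 1 ∧
      act hp d c L (algebraMap (Germ C p) (Mero C p) h) = 0 := by
  obtain ⟨g, hg, hgact⟩ := exists_act_eq hp d c hL
  have heval : ∀ x : C, ∑ i ∈ L.support, zcoeff (g i) 0 * x ^ i =
      (charPoly (ramifyOp p s L) d).eval ((c : C) * x) := by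
    intro x
    rw [Polynomial.eval_eq_sum, Polynomial.sum]
    simp_rw [hg, mul_pow, ← mul_assoc]
    refine (Finset.sum_subset (fun i hi => ?_) (fun i _ hi => ?_)).symm
    · rw [SkewPolynomial.mem_support_iff]
      intro hz
      rw [Polynomial.mem_support_iff, hL.charPoly_coeff_ne_zero_iff, coeff_ramifyOp, hz,
        map_zero, zcoeff_zero] at hi
      exact hi rfl
    · rw [Polynomial.notMem_support_iff] at hi
      rw [hi, zero_mul, zero_mul]
  obtain ⟨h, h0, hsol⟩ := exists_solution hpn L.support g (by
    have := heval 1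
    simp only [one_pow, mul_one] at this
    rw [this, hroot]) (by simpa only [heval] using hdiv)
  exact ⟨h, h0, by rw [hgact, hsol, map_zero, mul_zero]⟩

end

/-! ### Division of operators -/

section

variable {q : Cˣ}

theorem coeff_sum_monomial (n : ℕ) (r : ℕ → Germ C q) (i : ℕ) :
    (∑ j ∈ Finset.range n, SkewPolynomial.monomial j (r j)).coeff i =
      if i < n then r i else 0 := by
  induction n with
  | zero => simp
  | succ n ih =>
    rw [Finset.sum_range_succ, SkewPolynomial.coeff_add, ih, SkewPolynomial.coeff_monomial]
    by_cases h : n = i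
    · subst h; simp
    · rw [if_neg h, add_zero]
      by_cases h2 : i < n
      · rw [if_pos h2, if_pos (by omega)]
      · rw [if_neg h2, if_neg (by omega)]

theorem exists_coeff_eq_zero (L : SkewPolynomial (Germ C q)) :
    ∃ n, ∀ i, n ≤ i → L.coeff i = 0 := by
  refine ⟨L.support.sup id + 1, fun i hi => ?_⟩
  rw [← SkewPolynomial.notMem_support_iff]
  intro h
  have := Finset.le_sup (f := id) h
  simp only [id] at this
  omega

theorem coeff_C_mul (a : Germ C q) (L : SkewPolynomial (Germ C q)) (i : ℕ) :
    (SkewPolynomial.C a * L).coeff i = a * L.coeff i :=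
  SkewMonoidAlgebra.coeff_single_one_mul L a _

theorem coeff_monomial_mul (n : ℕ) (a : Germ C q) (L : SkewPolynomial (Germ C q)) (j : ℕ) :
    (SkewPolynomial.monomial n a * L).coeff (n + j) =
      a * (Multiplicative.ofAdd n • L.coeff j) := by
  rw [coeff_mul_eq_sum, Finset.sum_eq_single (n, j)]
  · rw [SkewPolynomial.coeff_monomial, if_pos rfl]
  · rintro ⟨i, k⟩ hz hne
    have hn : i + k = n + j := Finset.HasAntidiagonal.mem_antidiagonal.mp hz
    rw [SkewPolynomial.coeff_monomial, if_neg, zero_mul]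
    rintro rfl
    exact hne (by rw [Prod.mk.injEq]; exact ⟨rfl, by omega⟩)
  · intro h
    exact (h (Finset.HasAntidiagonal.mem_antidiagonal.mpr rfl)).elim

theorem exists_eq_C_mul {L : SkewPolynomial (Germ C q)} {r : Germ C q}
    (h : ∀ i, ∃ g, L.coeff i = r * g) : ∃ L', L = SkewPolynomial.C r * L' := by
  obtain ⟨n, hn⟩ := exists_coeff_eq_zero L
  choose g hg using h
  refine ⟨∑ j ∈ Finset.range n, SkewPolynomial.monomial j (g j), ?_⟩
  ext i
  rw [coeff_C_mul, coeff_sum_monomial]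
  split_ifs with hi
  · exact hg i
  · rw [mul_zero]
    exact hn i (not_lt.mp hi)

theorem C_mul_left_cancel {r : Germ C q} (hr : r ≠ 0) {A B : SkewPolynomial (Germ C q)}
    (h : SkewPolynomial.C r * A = SkewPolynomial.C r * B) : A = B := by
  ext i
  have := congrArg (fun L => SkewPolynomial.coeff L i) h
  simp only [coeff_C_mul] at this
  exact mul_left_cancel₀ hr this

theorem smul_ne_zero_of_ne_zero {n : ℕ} {f : Germ C q} (hf : f ≠ 0) :
    Multiplicative.ofAdd n • f ≠ 0 := by
  intro h
  refine hf (Germ.ext_zcoeff fun k => ?_)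
  have h1 := zcoeff_smul n f k
  rw [h, zcoeff_zero] at h1
  rw [zcoeff_zero]
  exact (mul_eq_zero.mp h1.symm).resolve_left (Units.ne_zero _)

/-- Right division with remainder, after multiplication by a nonzero germ. -/
theorem exists_pseudo_division {B : SkewPolynomial (Germ C q)} {s : ℕ} (hs : B.coeff s ≠ 0)
    (hB : ∀ i, s < i → B.coeff i = 0) (n : ℕ) :
    ∀ L : SkewPolynomial (Germ C q), (∀ i, n + s ≤ i → L.coeff i = 0) →
      ∃ (c : Germ C q) (A R : SkewPolynomial (Germ C q)), c ≠ 0 ∧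
        SkewPolynomial.C c * L = A * B + R ∧ ∀ i, s ≤ i → R.coeff i = 0 := by
  induction n with
  | zero =>
    intro L hL
    refine ⟨1, 0, L, one_ne_zero, ?_, fun i hi => hL i (by omega)⟩
    rw [SkewPolynomial.C_1, one_mul, zero_mul, zero_add]
  | succ n ih =>
    intro L hL
    obtain ⟨c, A, R, hc, hA, hR⟩ := ih
      (SkewPolynomial.C (Multiplicative.ofAdd n • B.coeff s) * L -
        SkewPolynomial.monomial n (L.coeff (n + s)) * B) (by
      intro i hi
      obtain ⟨j, rfl⟩ : ∃ j, i = n + j := ⟨i - n, by omega⟩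
      rw [SkewPolynomial.coeff_sub, coeff_C_mul, coeff_monomial_mul]
      rcases (show s ≤ j by omega).eq_or_lt with h | h
      · rw [← h, mul_comm, sub_self]
      · rw [hL _ (by omega), hB j h, smul_zero, mul_zero, mul_zero, sub_zero])
    refine ⟨c * (Multiplicative.ofAdd n • B.coeff s),
      A + SkewPolynomial.C c * SkewPolynomial.monomial n (L.coeff (n + s)), R,
      mul_ne_zero hc (smul_ne_zero_of_ne_zero hs), ?_, hR⟩
    rw [SkewPolynomial.C_mul, mul_assoc, add_mul, mul_assoc (SkewPolynomial.C c), add_right_comm,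
      ← hA, mul_sub, sub_add_cancel]

/-- Gauss's lemma for the `x`-adic valuation: a right factor over the fraction field, one of whose
coefficients is a unit, is a right factor over the ring of germs. -/
theorem exists_eq_mul_of_C_mul_eq {L A B : SkewPolynomial (Germ C q)} {c : Germ C q} (hc : c ≠ 0)
    {j : ℕ} (hj : zcoeff (B.coeff j) 0 ≠ 0) (h : SkewPolynomial.C c * L = A * B) :
    ∃ L', L = L' * B := by
  by_cases hA : A = 0
  · refine ⟨0, C_mul_left_cancel hc ?_⟩
    rw [h, hA, zero_mul, mul_zero]
  have hB : B ≠ 0 := by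
    rintro rfl
    exact hj (by simp)
  obtain ⟨n, u, hu, hcu⟩ := Germ.eq_coord_pow_mul_unit hc
  -- The Gauss valuation is read off the face of slope zero.
  obtain ⟨w, a, b, hfA⟩ : ∃ w a b, IntFace A 0 w a b := by
    obtain ⟨w, a, b, hf⟩ := exists_face hA 0
    obtain ⟨v, hv⟩ : ∃ v : ℤ, (v : ℝ) = w :=
      ⟨(A.coeff a).ord, by have := hf.left_eq; simpa using this⟩
    refine ⟨v, a, b, (face_iff_intFace A 0 v a b).mp ?_⟩
    rw [hv, Int.cast_zero]
    exact hf
  obtain ⟨a', b', hfB⟩ : ∃ a b, IntFace B 0 0 a b := by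
    obtain ⟨w, a, b, hf⟩ := exists_face hB 0
    have hle := hf.bound j (ne_zero_of_zcoeff_ne_zero hj)
    have hord := ord_le_of_zcoeff_ne_zero hj
    have h0 : (B.coeff j).ord = 0 := by omega
    have hw : w = 0 := by
      have h1 := hf.left_eq
      have h2 : (0 : ℝ) ≤ ((B.coeff a).ord : ℝ) := by positivity
      rw [h0] at hle
      simp only [zero_mul, add_zero, Nat.cast_zero] at hle h1
      linarith
    refine ⟨a, b, (face_iff_intFace B 0 0 a b).mp ?_⟩
    rw [Int.cast_zero, ← hw]
    convert hf
  have hw : (n : ℤ) ≤ w := by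
    have hface := (hfA.mul hfB).left_ne
    rw [← h, coeff_C_mul, hcu, mul_assoc, zcoeff_coord_pow_mul] at hface
    by_contra! hlt
    exact hface (zcoeff_of_neg _ (by omega))
  obtain ⟨A', rfl⟩ : ∃ A', A = SkewPolynomial.C (Germ.coord q ^ n) * A' :=
    exists_eq_C_mul fun i => Germ.exists_coord_pow_mul fun k hk => hfA.vanish i k (by omega)
  obtain ⟨v, hv⟩ := hu.exists_left_inv
  refine ⟨SkewPolynomial.C v * A', ?_⟩
  have h2 : SkewPolynomial.C u * L = A' * B := by
    refine C_mul_left_cancel (pow_ne_zero n (Germ.coord_ne_zero (q := q))) ?_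
    rw [← mul_assoc, ← mul_assoc, ← h, hcu, SkewPolynomial.C_mul]
  rw [mul_assoc, ← h2, ← mul_assoc, ← SkewPolynomial.C_mul, hv, SkewPolynomial.C_1, one_mul]

/-- A nonzero operator is the product of a nonzero germ and of an operator one of whose
coefficients does not vanish at zero. -/
theorem exists_primitive {B : SkewPolynomial (Germ C q)} (hB : B ≠ 0) :
    ∃ (n : ℕ) (B' : SkewPolynomial (Germ C q)) (j : ℕ),
      B = SkewPolynomial.C (Germ.coord q ^ n) * B' ∧ zcoeff (B'.coeff j) 0 ≠ 0 := by
  obtain ⟨w, a, b, hf⟩ := exists_face hB 0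
  have hle : ∀ i, B.coeff i ≠ 0 → (B.coeff a).ord ≤ (B.coeff i).ord := by
    intro i hi
    have h1 := hf.left_eq
    have h2 := hf.bound i hi
    simp only [zero_mul, add_zero] at h1 h2
    rw [← h1] at h2
    exact_mod_cast h2
  obtain ⟨B', hB'⟩ : ∃ B', B = SkewPolynomial.C (Germ.coord q ^ (B.coeff a).ord) * B' := by
    refine exists_eq_C_mul fun i => Germ.exists_coord_pow_mul fun k hk => ?_
    by_cases hi : B.coeff i = 0
    · rw [hi, zcoeff_zero]
    · exact zcoeff_of_lt_ord (lt_of_lt_of_le hk (by exact_mod_cast hle i hi))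
  refine ⟨_, B', a, hB', ?_⟩
  have h1 := zcoeff_ord_ne_zero hf.left_ne
  have h2 : B.coeff a = Germ.coord q ^ (B.coeff a).ord * B'.coeff a := by
    conv_lhs => rw [hB', coeff_C_mul]
  have h3 : zcoeff (B.coeff a) (B.coeff a).ord = zcoeff (B'.coeff a) 0 := by
    generalize (B.coeff a).ord = n at h2
    rw [h2, zcoeff_coord_pow_mul, sub_self]
  rwa [h3] at h1

/-! ### Annihilators of analytic vectors -/

variable {p : Cˣ} {s : ℕ} [NeZero s]

/-- The indices of the points of the Newton polygon on a side of slope `d / s` are congruent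
modulo `s`. -/
theorem IntFace.dvd_index_sub {L : SkewPolynomial (Germ C q)} {d w : ℤ} {a b : ℕ}
    (h : IntFace (ramifyOp p s L) d w a b) (hds : IsCoprime d (s : ℤ)) {i : ℕ}
    (hi : (charPoly (ramifyOp p s L) d).coeff i ≠ 0) : (s : ℤ) ∣ (i : ℤ) - a := by
  rw [h.charPoly_coeff_ne_zero_iff] at hi
  have ha := h.left_ne
  rw [coeff_ramifyOp] at hi ha
  have h1 : (s : ℤ) ∣ w + d * i := by
    by_contra hn
    exact hi (zcoeff_ramify_of_not_dvd _ hn)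
  have h2 : (s : ℤ) ∣ w + d * a := by
    by_contra hn
    exact ha (zcoeff_ramify_of_not_dvd _ hn)
  have h3 : (s : ℤ) ∣ d * ((i : ℤ) - a) := by
    have := dvd_sub h1 h2
    rwa [add_sub_add_left_eq_sub, ← mul_sub] at this
  exact hds.symm.dvd_of_dvd_mul_left h3

theorem exists_intFace_ramifyOp {L : SkewPolynomial (Germ C q)} (hL : L ≠ 0) (p : Cˣ) (s : ℕ)
    [NeZero s] (d : ℤ) : ∃ w a b, IntFace (ramifyOp p s L) d w a b := by
  obtain ⟨w, a, b, h⟩ := exists_face hL ((d : ℝ) / s)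
  have hs : (s : ℝ) ≠ 0 := by exact_mod_cast NeZero.ne s
  obtain ⟨v, -, hv⟩ := h.exists_intFace p s (e := d) (by field_simp)
  exact ⟨v, a, b, hv⟩

theorem IntFace.le {A : SkewPolynomial (Germ C p)} {e w : ℤ} {a b : ℕ}
    (h : IntFace A e w a b) : a ≤ b := (h.mem a h.left_ne).2

/-- If the characteristic polynomial has a nonzero root, the side has positive length. -/
theorem IntFace.lt_of_eval_eq_zero {A : SkewPolynomial (Germ C p)} {e w : ℤ} {a b : ℕ}
    (h : IntFace A e w a b) (c : Cˣ) (hc : (charPoly A e).eval (c : C) = 0) : a < b := by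
  refine lt_of_le_of_ne h.le fun hab => ?_
  subst hab
  have h1 : charPoly A e = Polynomial.monomial a ((charPoly A e).coeff a) := by
    ext i
    rw [Polynomial.coeff_monomial]
    split_ifs with hi
    · rw [hi]
    · by_contra hne
      have := h.mem i ((h.charPoly_coeff_ne_zero_iff i).mp hne)
      omega
  rw [h1, Polynomial.eval_monomial, mul_eq_zero] at hc
  rcases hc with hc | hc
  · exact (h.charPoly_coeff_ne_zero_iff a).mpr h.left_ne hc
  · exact Units.ne_zero (c ^ a) (by rw [Units.val_pow_eq_pow_val, hc])

/-- No nonzero operator of order less than `s` annihilates an analytic vector of `N_{d,c,s}` with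
value `1` at zero: all sides of slope `d / s` have length at least `s`. -/
theorem eq_zero_of_act_eq_zero (hp : p ^ s = q) {d : ℤ} (hds : IsCoprime d (s : ℤ)) (c : Cˣ)
    {h : Germ C p} (h0 : zcoeff h 0 = 1) {L : SkewPolynomial (Germ C q)}
    (hL : ∀ i, s ≤ i → L.coeff i = 0)
    (hact : act hp d c L (algebraMap (Germ C p) (Mero C p) h) = 0) : L = 0 := by
  by_contra hne
  obtain ⟨w, a, b, hf⟩ := exists_intFace_ramifyOp hne p s d
  have hlt := hf.lt_of_eval_eq_zero c (eval_charPoly_eq_zero_of_act_eq_zero hp d c hf h0 hact)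
  have hdvd := hf.dvd_index_sub hds ((hf.charPoly_coeff_ne_zero_iff b).mpr hf.right_ne)
  have hb : b < s := by
    by_contra! hle
    refine hf.right_ne ?_
    rw [coeff_ramifyOp, hL b hle, map_zero, zcoeff_zero]
  have := Int.le_of_dvd (by omega) hdvd
  omega

/-- An operator of order `s` annihilating an analytic vector of `N_{d,c,s}` with value `1` at zero
is pure of slope `d / s`, with characteristic polynomial proportional to `X ^ s - c ^ s`. -/
theorem intFace_of_act_eq_zero (hp : p ^ s = q) {d : ℤ} (hds : IsCoprime d (s : ℤ)) (c : Cˣ)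
    {h : Germ C p} (h0 : zcoeff h 0 = 1) {B : SkewPolynomial (Germ C q)} (hB0 : B ≠ 0)
    (hB : ∀ i, s < i → B.coeff i = 0)
    (hact : act hp d c B (algebraMap (Germ C p) (Mero C p) h) = 0) :
    ∃ w, IntFace (ramifyOp p s B) d w 0 s ∧ ∃ β : C, β ≠ 0 ∧
      charPoly (ramifyOp p s B) d =
        Polynomial.C β * (Polynomial.X ^ s - Polynomial.C ((c : C) ^ s)) := by
  obtain ⟨w, a, b, hf⟩ := exists_intFace_ramifyOp hB0 p s d
  have hroot := eval_charPoly_eq_zero_of_act_eq_zero hp d c hf h0 hact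
  have hlt := hf.lt_of_eval_eq_zero c hroot
  have hdvd := hf.dvd_index_sub hds ((hf.charPoly_coeff_ne_zero_iff b).mpr hf.right_ne)
  have hb : b ≤ s := by
    by_contra! hle
    refine hf.right_ne ?_
    rw [coeff_ramifyOp, hB b hle, map_zero, zcoeff_zero]
  have hle := Int.le_of_dvd (by omega) hdvd
  obtain rfl : a = 0 := by omega
  obtain rfl : b = s := by omega
  refine ⟨w, hf, (charPoly (ramifyOp p b B) d).coeff b,
    (hf.charPoly_coeff_ne_zero_iff b).mpr hf.right_ne, ?_⟩
  have hbpos : 0 < b := hlt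
  have h1 : charPoly (ramifyOp p b B) d =
      Polynomial.C ((charPoly (ramifyOp p b B) d).coeff b) * Polynomial.X ^ b +
        Polynomial.C ((charPoly (ramifyOp p b B) d).coeff 0) := by
    ext i
    rw [Polynomial.coeff_add, Polynomial.coeff_C_mul, Polynomial.coeff_X_pow, Polynomial.coeff_C]
    by_cases hi0 : i = 0
    · subst hi0
      simp [hbpos.ne]
    by_cases hib : i = b
    · subst hib
      simp [hi0]
    · rw [if_neg hib, if_neg hi0, mul_zero, zero_add]
      by_contra hne
      have h2 := hf.dvd_index_sub hds hne
      have h3 := hf.mem i ((hf.charPoly_coeff_ne_zero_iff i).mp hne)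
      have := Int.le_of_dvd (by omega) h2
      omega
  rw [h1, Polynomial.eval_add, Polynomial.eval_mul, Polynomial.eval_C, Polynomial.eval_C,
    Polynomial.eval_pow, Polynomial.eval_X] at hroot
  have h2 := eq_neg_of_add_eq_zero_right hroot
  conv_lhs => rw [h1, h2]
  rw [map_neg, map_mul]
  ring

/-! ### The modules `N_{d,c,s}` -/

theorem Mero.exists_sum_coord_pow_mul_ramify (f : Mero C p) :
    ∃ g : ℕ → Mero C q, f = ∑ i ∈ Finset.range s, Mero.ramify q p s (g i) * Mero.coord p ^ i := by
  obtain ⟨a, b, hb, rfl⟩ := IsFractionRing.div_surjective (A := Germ C p) f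
  obtain ⟨n, u, hu, hbu⟩ := Germ.eq_coord_pow_mul_unit (nonZeroDivisors.ne_zero hb)
  obtain ⟨v, hv⟩ := hu.exists_left_inv
  obtain ⟨g, hg⟩ := Germ.exists_sum_coord_pow_mul_ramify q s
    (a * v * Germ.coord p ^ (s * n - n))
  have hsn : n ≤ s * n := Nat.le_mul_of_pos_left n (Nat.pos_of_ne_zero (NeZero.ne s))
  have hcoord : Mero.ramify q p s (Mero.coord q) = Mero.coord p ^ s := by
    rw [Mero.coord, Mero.ramify_algebraMap, Germ.ramify_coord, map_pow]
    rfl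
  have hT : Mero.coord p ≠ 0 := Mero.coord_ne_zero
  refine ⟨fun i => (Mero.coord q ^ n)⁻¹ * algebraMap (Germ C q) (Mero C q) (g i), ?_⟩
  have h1 := congrArg (algebraMap (Germ C p) (Mero C p)) hg
  rw [map_sum, map_mul, map_mul, map_pow] at h1
  have h2 : ∀ i, Mero.ramify q p s ((Mero.coord q ^ n)⁻¹ * algebraMap (Germ C q) (Mero C q) (g i)) *
      Mero.coord p ^ i = (Mero.coord p ^ (s * n))⁻¹ * algebraMap (Germ C p) (Mero C p)
        (Germ.coord p ^ i * Germ.ramify q p s (g i)) := by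
    intro i
    rw [map_mul, map_inv₀, map_pow, hcoord, Mero.ramify_algebraMap, map_mul, map_pow, pow_mul]
    change _ = _ * (Mero.coord p ^ i * _)
    ring
  simp_rw [h2]
  rw [← Finset.mul_sum, ← h1, hbu, map_mul, map_pow]
  change _ / (Mero.coord p ^ n * _) = _ * (_ * Mero.coord p ^ (s * n - n))
  have hv' : algebraMap (Germ C p) (Mero C p) v * algebraMap (Germ C p) (Mero C p) u = 1 := by
    rw [← map_mul, hv, map_one]
  have hu' : algebraMap (Germ C p) (Mero C p) u ≠ 0 := right_ne_zero_of_mul_eq_one hv'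
  have hpow : Mero.coord p ^ (s * n) = Mero.coord p ^ (s * n - n) * Mero.coord p ^ n := by
    rw [← pow_add, Nat.sub_add_cancel hsn]
  rw [hpow, div_eq_iff (mul_ne_zero (pow_ne_zero _ hT) hu')]
  have h3 : Mero.coord p ^ (s * n - n) ≠ 0 := pow_ne_zero _ hT
  have h4 : Mero.coord p ^ n ≠ 0 := pow_ne_zero _ hT
  calc _ = algebraMap (Germ C p) (Mero C p) a * 1 := (mul_one _).symm
    _ = _ := by
      rw [← hv']
      field_simp

/-- An element of `K_s`, as an element of the `K`-vector space `N_{d,c,s}`. -/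
def toModule (q : Cˣ) (s : ℕ) [NeZero s] (f : Mero C p) : SimpleModule C q p s := f

theorem smul_toModule (a : Mero C q) (f : Mero C p) :
    a • toModule q s f = toModule q s (Mero.ramify q p s a * f) := rfl

theorem toModule_sum (T : Finset ℕ) (f : ℕ → Mero C p) :
    toModule q s (∑ i ∈ T, f i) = ∑ i ∈ T, toModule q s (f i) := rfl

variable (q p s) in
theorem span_toModule_coord_pow :
    Submodule.span (Mero C q)
      (Set.range fun i : Fin s => toModule q s (Mero.coord p ^ (i : ℕ))) = ⊤ := by
  rw [eq_top_iff]
  rintro f -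
  obtain ⟨g, hg⟩ := Mero.exists_sum_coord_pow_mul_ramify (q := q) (s := s) (p := p) f
  have hf : f = toModule q s (∑ i ∈ Finset.range s, Mero.ramify q p s (g i) * Mero.coord p ^ i) :=
    hg
  rw [hf, toModule_sum, Finset.sum_range]
  refine Submodule.sum_mem _ fun i _ => ?_
  rw [← smul_toModule]
  exact Submodule.smul_mem _ (g i) (Submodule.subset_span ⟨i, rfl⟩)

theorem SimpleModule.finite : Module.Finite (Mero C q) (SimpleModule C q p s) :=
  Module.finite_def.mpr (Submodule.fg_def.mpr
    ⟨_, Set.finite_range _, span_toModule_coord_pow q p s⟩)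

theorem SimpleModule.finrank_le : Module.finrank (Mero C q) (SimpleModule C q p s) ≤ s := by
  have h := finrank_range_le_card (R := Mero C q)
    (fun i : Fin s => toModule q s (Mero.coord p ^ (i : ℕ)))
  rwa [Set.finrank, span_toModule_coord_pow, finrank_top, Fintype.card_fin] at h

/-- The vector `Σ_q ^ i v` of `N_{d,c,s}`. -/
def iterVec (q : Cˣ) (s : ℕ) [NeZero s] (d : ℤ) (c : Cˣ) (v : Mero C p) (i : ℕ) :
    SimpleModule C q p s :=
  toModule q s (((sigmaUnit p d c ^ i : (AddMonoid.End (Mero C p))ˣ) :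
    AddMonoid.End (Mero C p)) v)

/-- A linear relation between the iterates of a vector gives an operator annihilating it. -/
theorem exists_act_eq_zero_of_relation (hp : p ^ s = q) (d : ℤ) (c : Cˣ) (v : Mero C p) {n : ℕ}
    {g : Fin n → Mero C q} (hg : ∑ i, g i • iterVec q s d c v i = 0) :
    ∃ b : Mero C q, b ≠ 0 ∧ ∃ B : SkewPolynomial (Germ C q),
      (∀ i : Fin n, algebraMap (Germ C q) (Mero C q) (B.coeff i) = b * g i) ∧
      (∀ i, n ≤ i → B.coeff i = 0) ∧ act hp d c B v = 0 := by
  obtain ⟨b, hb⟩ := IsLocalization.exist_integer_multiples (nonZeroDivisors (Germ C q))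
    Finset.univ g
  have hb' : ∀ i : Fin n, ∃ r : Germ C q, algebraMap (Germ C q) (Mero C q) r =
      algebraMap (Germ C q) (Mero C q) b * g i := by
    intro i
    obtain ⟨r, hr⟩ := hb i (Finset.mem_univ i)
    exact ⟨r, by rw [hr, Algebra.smul_def]⟩
  choose r hr using hb'
  have hb0 : algebraMap (Germ C q) (Mero C q) b ≠ 0 := by
    rw [Ne, IsFractionRing.to_map_eq_zero_iff]
    exact nonZeroDivisors.coe_ne_zero b
  set R : ℕ → Germ C q := fun i => if h : i < n then r ⟨i, h⟩ else 0 with hR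
  set B : SkewPolynomial (Germ C q) := ∑ j ∈ Finset.range n, SkewPolynomial.monomial j (R j) with hB
  have hBc : ∀ i : Fin n, B.coeff i = r i := by
    intro i
    rw [hB, coeff_sum_monomial, if_pos i.2, hR]
    simp
  have hB0 : ∀ i, n ≤ i → B.coeff i = 0 := by
    intro i hi
    rw [hB, coeff_sum_monomial, if_neg (by omega)]
  refine ⟨_, hb0, B, fun i => by rw [hBc, hr], hB0, ?_⟩
  rw [act_eq_sum hp d c B (Finset.range n), Finset.sum_range]
  · have h1 : toModule q s (∑ i : Fin n,
        algebraMap (Germ C p) (Mero C p) (Germ.ramify q p s (B.coeff i)) *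
          ((sigmaUnit p d c ^ (i : ℕ) : (AddMonoid.End (Mero C p))ˣ) :
            AddMonoid.End (Mero C p)) v) =
        algebraMap (Germ C q) (Mero C q) b • ∑ i, g i • iterVec q s d c v i := by
      rw [Finset.smul_sum]
      refine Finset.sum_congr rfl fun i _ => ?_
      rw [smul_smul, ← hr, ← hBc]
      change _ = toModule q s (Mero.ramify q p s _ * _)
      rw [Mero.ramify_algebraMap]
      rfl
    rw [hg, smul_zero] at h1
    exact h1
  · intro i hi
    rw [SkewPolynomial.mem_support_iff] at hi
    rw [Finset.mem_range]
    by_contra! h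
    exact hi (hB0 i h)

/-- An analytic vector of `N_{d,c,s}` with value `1` at zero is cyclic: its first `s` iterates are
linearly independent, the dimension being at most `s`. -/
theorem linearIndependent_iterVec (hp : p ^ s = q) {d : ℤ} (hds : IsCoprime d (s : ℤ)) (c : Cˣ)
    {h : Germ C p} (h0 : zcoeff h 0 = 1) :
    LinearIndependent (Mero C q) fun i : Fin s =>
      iterVec q s d c (algebraMap (Germ C p) (Mero C p) h) i := by
  rw [Fintype.linearIndependent_iff]
  intro g hg i
  obtain ⟨b, hb, B, hB, hBs, hact⟩ := exists_act_eq_zero_of_relation hp d c _ hg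
  have hB0 := eq_zero_of_act_eq_zero hp hds c h0 hBs hact
  have h1 := hB i
  rw [hB0, SkewPolynomial.coeff_zero, map_zero] at h1
  exact (mul_eq_zero.mp h1.symm).resolve_left hb

/-- Every vector of `N_{d,c,s}` is annihilated by a nonzero operator of order at most `s`, since
`N_{d,c,s}` has dimension at most `s`. -/
theorem exists_annihilator (hp : p ^ s = q) (d : ℤ) (c : Cˣ) (v : Mero C p) :
    ∃ B : SkewPolynomial (Germ C q), B ≠ 0 ∧ (∀ i, s < i → B.coeff i = 0) ∧
      act hp d c B v = 0 := by
  have hdep : ¬ LinearIndependent (Mero C q) fun i : Fin (s + 1) => iterVec q s d c v i := by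
    intro hli
    have := SimpleModule.finite (q := q) (p := p) (s := s)
    have h1 := hli.fintype_card_le_finrank
    rw [Fintype.card_fin] at h1
    have := SimpleModule.finrank_le (q := q) (p := p) (s := s)
    omega
  rw [Fintype.not_linearIndependent_iff] at hdep
  obtain ⟨g, hg, i, hi⟩ := hdep
  obtain ⟨b, hb, B, hB, hBs, hact⟩ := exists_act_eq_zero_of_relation hp d c _ hg
  refine ⟨B, ?_, fun j hj => hBs j hj, hact⟩
  rintro rfl
  have h1 := hB i
  rw [SkewPolynomial.coeff_zero, map_zero] at h1
  exact mul_ne_zero hb hi h1.symm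

/-- The class of `σ_q ^ n` modulo the left ideal generated by an operator. -/
def sigmaClass (B : SkewPolynomial (Germ C q)) (n : ℤ) :
    SkewLaurent C q ⧸ Ideal.span {toSkewLaurent B} :=
  Submodule.Quotient.mk (SkewMonoidAlgebra.single (Multiplicative.ofAdd n) 1)

theorem toSkewLaurent_eq_sum {B : SkewPolynomial (Germ C q)} {m : ℕ}
    (hB : ∀ i, m < i → B.coeff i = 0) :
    toSkewLaurent B = ∑ j ∈ Finset.range (m + 1), SkewMonoidAlgebra.single
      (Multiplicative.ofAdd (j : ℤ)) (algebraMap (Germ C q) (Mero C q) (B.coeff j)) := by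
  rw [toSkewLaurent, SkewPolynomial.sum_eq_of_subset (s := Finset.range (m + 1)) _
    (fun i => by rw [map_zero, SkewMonoidAlgebra.single_zero])]
  intro i hi
  rw [SkewPolynomial.mem_support_iff] at hi
  rw [Finset.mem_range]
  by_contra! hlt
  exact hi (hB i hlt)

/-- The relation between the classes of `σ_q ^ n, …, σ_q ^ (n + m)` given by `σ_q ^ n B`. -/
theorem sum_smul_sigmaClass {B : SkewPolynomial (Germ C q)} {m : ℕ}
    (hB : ∀ i, m < i → B.coeff i = 0) (n : ℤ) :
    ∑ j ∈ Finset.range (m + 1), (Multiplicative.ofAdd n •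
      algebraMap (Germ C q) (Mero C q) (B.coeff j)) • sigmaClass B (n + j) = 0 := by
  have h1 : SkewMonoidAlgebra.single (Multiplicative.ofAdd n) 1 * toSkewLaurent B ∈
      Ideal.span {toSkewLaurent B} := Ideal.mul_mem_left _ _ (Ideal.subset_span rfl)
  rw [← Submodule.Quotient.mk_eq_zero] at h1
  have h2 : ∀ j ∈ Finset.range (m + 1), SkewMonoidAlgebra.single (Multiplicative.ofAdd n) 1 *
      SkewMonoidAlgebra.single (Multiplicative.ofAdd (j : ℤ))
        (algebraMap (Germ C q) (Mero C q) (B.coeff j)) =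
      (Multiplicative.ofAdd n • algebraMap (Germ C q) (Mero C q) (B.coeff j)) •
        (SkewMonoidAlgebra.single (Multiplicative.ofAdd (n + j)) 1 : SkewLaurent C q) := by
    intro j _
    rw [SkewMonoidAlgebra.single_mul_single, SkewMonoidAlgebra.smul_single, one_mul,
      smul_eq_mul, mul_one, ofAdd_add]
  have h3 : SkewMonoidAlgebra.single (Multiplicative.ofAdd n) 1 * toSkewLaurent B =
      ∑ j ∈ Finset.range (m + 1),
        (Multiplicative.ofAdd n • algebraMap (Germ C q) (Mero C q) (B.coeff j)) •
        (SkewMonoidAlgebra.single (Multiplicative.ofAdd (n + j)) 1 : SkewLaurent C q) := by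
    rw [toSkewLaurent_eq_sum hB, Finset.mul_sum]
    exact Finset.sum_congr rfl h2
  rw [← h1, h3]
  exact (map_sum (Submodule.mkQ (Ideal.span {toSkewLaurent B})) _ _).symm

theorem Mero.smul_algebraMap_ne_zero (n : ℤ) {f : Germ C q} (hf : f ≠ 0) :
    Multiplicative.ofAdd n • algebraMap (Germ C q) (Mero C q) f ≠ 0 := by
  rw [smul_ne_zero_iff_ne, Ne, IsFractionRing.to_map_eq_zero_iff]
  exact hf

/-- The quotient of `K[σ_q, σ_q⁻¹]` by the left ideal generated by an operator of order `m` with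
nonzero constant term is spanned by the classes of `1, σ_q, …, σ_q ^ (m - 1)`. -/
theorem span_sigmaClass {B : SkewPolynomial (Germ C q)} {m : ℕ} (hm : 0 < m)
    (hB0 : B.coeff 0 ≠ 0) (hBs : B.coeff m ≠ 0) (hB : ∀ i, m < i → B.coeff i = 0) :
    Submodule.span (Mero C q) (Set.range fun i : Fin m => sigmaClass B (i : ℕ)) = ⊤ := by
  set W := Submodule.span (Mero C q) (Set.range fun i : Fin m => sigmaClass B (i : ℕ)) with hW
  have hup : ∀ n : ℤ, (∀ j < m, sigmaClass B (n + (j : ℕ)) ∈ W) →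
      sigmaClass B (n + (m : ℕ)) ∈ W := by
    intro n hn
    have h1 := sum_smul_sigmaClass hB n
    rw [Finset.sum_range_succ] at h1
    rw [← Submodule.smul_mem_iff W (Mero.smul_algebraMap_ne_zero n hBs),
      eq_neg_of_add_eq_zero_right h1]
    exact W.neg_mem (W.sum_mem fun j hj => W.smul_mem _ (hn j (Finset.mem_range.mp hj)))
  have hdown : ∀ n : ℤ, (∀ j < m, sigmaClass B (n + (j + 1 : ℕ)) ∈ W) →
      sigmaClass B n ∈ W := by
    intro n hn
    have h1 := sum_smul_sigmaClass hB n
    rw [Finset.sum_range_succ'] at h1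
    have h2 := eq_neg_of_add_eq_zero_right h1
    rw [Nat.cast_zero, add_zero] at h2
    rw [← Submodule.smul_mem_iff W (Mero.smul_algebraMap_ne_zero n hB0), h2]
    exact W.neg_mem (W.sum_mem fun j hj => W.smul_mem _ (hn j (Finset.mem_range.mp hj)))
  -- The classes of any `m` consecutive powers of `σ_q` lie in the span: the two previous facts
  -- move the block of consecutive powers by one step upwards or downwards.
  have hwin : ∀ n : ℤ, ∀ j < m, sigmaClass B (n + (j : ℕ)) ∈ W := by
    intro n
    induction n using Int.induction_on with
    | zero =>
      intro j hj
      rw [zero_add]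
      exact Submodule.subset_span ⟨⟨j, hj⟩, rfl⟩
    | succ n ih =>
      intro j hj
      rcases (show j + 1 ≤ m from hj).lt_or_eq with h1 | h1
      · have := ih (j + 1) h1
        push_cast at this
        rwa [add_comm (j : ℤ), ← add_assoc] at this
      · have := hup _ ih
        rw [← h1] at this
        push_cast at this
        rwa [add_comm (j : ℤ), ← add_assoc] at this
    | pred n ih =>
      intro j hj
      cases j with
      | zero =>
        rw [Nat.cast_zero, add_zero]
        refine hdown _ fun j hj => ?_
        have := ih j hj
        push_cast
        rwa [show (-(n : ℤ) - 1 + (j + 1)) = -n + j by ring]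
      | succ j =>
        have := ih j (by omega)
        push_cast
        rwa [show (-(n : ℤ) - 1 + (j + 1)) = -n + j by ring]
  rw [eq_top_iff]
  rintro x -
  obtain ⟨P, rfl⟩ := Submodule.Quotient.mk_surjective _ x
  induction P using SkewMonoidAlgebra.induction_on with
  | zero => exact W.zero_mem
  | single g a =>
    have h1 := hwin g.toAdd 0 hm
    rw [Nat.cast_zero, add_zero] at h1
    have h3 : (SkewMonoidAlgebra.single g a : SkewLaurent C q) =
        a • SkewMonoidAlgebra.single g 1 := by
      rw [SkewMonoidAlgebra.smul_single, smul_eq_mul, mul_one]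
    rw [h3]
    exact W.smul_mem a h1
  | add P Q hP hQ => exact W.add_mem hP hQ

/-- The `K`-linear map from `K[σ_q, σ_q⁻¹]` to `N_{d,c,s}` defined by a vector. -/
def orbitMap (hp : p ^ s = q) (d : ℤ) (c : Cˣ) (v : Mero C p) :
    SkewLaurent C q →ₗ[Mero C q] SimpleModule C q p s where
  toFun P := toModule q s (laurentAct hp d c P v)
  map_add' P Q := by rw [map_add]; rfl
  map_smul' a P := by rw [laurentAct_smul]; rfl

theorem le_ker_orbitMap (hp : p ^ s = q) (d : ℤ) (c : Cˣ) {v : Mero C p}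
    {B : SkewPolynomial (Germ C q)} (hact : act hp d c B v = 0) :
    (Ideal.span {toSkewLaurent B}).restrictScalars (Mero C q) ≤
      LinearMap.ker (orbitMap hp d c v) := by
  have hBact : laurentAct hp d c (toSkewLaurent B) v = 0 := by
    rw [← toSkewLaurentHom_apply]
    exact hact
  intro x hx
  obtain ⟨a, rfl⟩ := Submodule.mem_span_singleton.mp hx
  rw [LinearMap.mem_ker]
  change toModule q s (laurentAct hp d c (a * toSkewLaurent B) v) = 0
  rw [map_mul, addEnd_mul_apply, hBact, map_zero]
  rfl

/-- The map from the module of an operator to `N_{d,c,s}` defined by an annihilated vector. -/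
def quotientMap (hp : p ^ s = q) (d : ℤ) (c : Cˣ) {v : Mero C p}
    {B : SkewPolynomial (Germ C q)} (hact : act hp d c B v = 0) :
    (SkewLaurent C q ⧸ Ideal.span {toSkewLaurent B}) →ₗ[Mero C q] SimpleModule C q p s :=
  (Submodule.liftQ _ (orbitMap hp d c v) (le_ker_orbitMap hp d c hact)).comp
    (Submodule.Quotient.restrictScalarsEquiv (Mero C q)
      (Ideal.span {toSkewLaurent B})).symm.toLinearMap

theorem quotientMap_mk (hp : p ^ s = q) (d : ℤ) (c : Cˣ) {v : Mero C p}
    {B : SkewPolynomial (Germ C q)} (hact : act hp d c B v = 0) (P : SkewLaurent C q) :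
    quotientMap hp d c hact (Submodule.Quotient.mk P) =
      toModule q s (laurentAct hp d c P v) := rfl

theorem quotientMap_sigma_smul (hp : p ^ s = q) (d : ℤ) (c : Cˣ) {v : Mero C p}
    {B : SkewPolynomial (Germ C q)} (hact : act hp d c B v = 0)
    (x : SkewLaurent C q ⧸ Ideal.span {toSkewLaurent B}) :
    quotientMap hp d c hact (SkewLaurent.sigma q • x) =
      SimpleModule.Sigma q p d c s (quotientMap hp d c hact x) := by
  obtain ⟨P, rfl⟩ := Submodule.Quotient.mk_surjective _ x
  rw [← Submodule.Quotient.mk_smul, quotientMap_mk, quotientMap_mk, smul_eq_mul, map_mul,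
    addEnd_mul_apply, SkewLaurent.sigma, laurentAct_single, map_one, one_mul, zpow_one]
  rfl

/-- An operator of order `s` annihilating an analytic vector of `N_{d,c,s}` is associated to this
module: the vector is cyclic, and both sides have dimension `s`. -/
theorem isAssociated_of_act_eq_zero (hp : p ^ s = q) {d : ℤ} (hds : IsCoprime d (s : ℤ)) (c : Cˣ)
    {h : Germ C p} (h0 : zcoeff h 0 = 1) {B : SkewPolynomial (Germ C q)}
    (hB0 : B.coeff 0 ≠ 0) (hBs : B.coeff s ≠ 0) (hB : ∀ i, s < i → B.coeff i = 0)
    (hact : act hp d c B (algebraMap (Germ C p) (Mero C p) h) = 0) :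
    IsAssociated B (SimpleModule.Sigma q p d c s) := by
  have hspan := span_sigmaClass (Nat.pos_of_ne_zero (NeZero.ne s)) hB0 hBs hB
  have hfin : Module.Finite (Mero C q) (SkewLaurent C q ⧸ Ideal.span {toSkewLaurent B}) :=
    Module.finite_def.mpr (Submodule.fg_def.mpr ⟨_, Set.finite_range _, hspan⟩)
  have hfinN := SimpleModule.finite (q := q) (p := p) (s := s)
  have hfr : Module.finrank (Mero C q)
      (SkewLaurent C q ⧸ Ideal.span {toSkewLaurent B}) ≤ s := by
    have h1 := finrank_range_le_card (R := Mero C q) (fun i : Fin s => sigmaClass B (i : ℕ))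
    rwa [Set.finrank, hspan, finrank_top, Fintype.card_fin] at h1
  have hli := linearIndependent_iterVec (d := d) hp hds c h0
  have hfrN : Module.finrank (Mero C q) (SimpleModule C q p s) = s := by
    refine le_antisymm SimpleModule.finrank_le ?_
    have := hli.fintype_card_le_finrank
    rwa [Fintype.card_fin] at this
  have hsurj : Function.Surjective (quotientMap hp d c hact) := by
    rw [← LinearMap.range_eq_top, eq_top_iff,
      ← hli.span_eq_top_of_card_eq_finrank (by rw [Fintype.card_fin, hfrN]), Submodule.span_le]
    rintro _ ⟨i, rfl⟩
    refine ⟨sigmaClass B (i : ℕ), ?_⟩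
    rw [sigmaClass, quotientMap_mk, laurentAct_single, map_one, one_mul, zpow_natCast]
    rfl
  have hinj : Function.Injective (quotientMap hp d c hact) := by
    have h1 := LinearMap.finrank_le_finrank_of_surjective hsurj
    exact (LinearMap.injective_iff_surjective_of_finrank_eq_finrank (by omega)).mpr hsurj
  have hbij : Function.Bijective (quotientMap hp d c hact) := ⟨hinj, hsurj⟩
  refine ⟨(LinearEquiv.ofBijective _ hbij).symm, fun m => ?_⟩
  rw [LinearEquiv.symm_apply_eq]
  refine Eq.trans ?_ (quotientMap_sigma_smul hp d c hact _).symm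
  exact congrArg (SimpleModule.Sigma q p d c s)
    (LinearEquiv.apply_symm_apply (LinearEquiv.ofBijective _ hbij) m).symm

/-- Rescaling the basis vector by a power of `t` multiplies the constant by a power of `p`. -/
theorem IsAssociated.mul_zpow {G : SkewPolynomial (Germ C q)} {d : ℤ} {c : Cˣ} {k : ℤ}
    (h : IsAssociated G (SimpleModule.Sigma q p d (c * p ^ k) s)) :
    IsAssociated G (SimpleModule.Sigma q p d c s) := by
  obtain ⟨e, he⟩ := h
  have hT : Mero.coord p ^ (-k) ≠ 0 := zpow_ne_zero _ Mero.coord_ne_zero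
  let m : SimpleModule C q p s ≃ₗ[Mero C q] SimpleModule C q p s :=
    { toFun := fun f : Mero C p => toModule q s (Mero.coord p ^ (-k) * f)
      invFun := fun f : Mero C p => toModule q s ((Mero.coord p ^ (-k))⁻¹ * f)
      map_add' := fun f g => mul_add (Mero.coord p ^ (-k)) (f : Mero C p) (g : Mero C p)
      map_smul' := fun a f =>
        mul_left_comm (Mero.coord p ^ (-k)) (Mero.ramify q p s a) (f : Mero C p)
      left_inv := fun f => inv_mul_cancel_left₀ hT (f : Mero C p)
      right_inv := fun f => mul_inv_cancel_left₀ hT (f : Mero C p) }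
  suffices hm : ∀ f : Mero C p, Mero.coord p ^ (-k) * (Mero.sigma p f *
      (Mero.const p (c : C) * Mero.coord p ^ (-d))) =
      Mero.sigma p (Mero.coord p ^ (-k) * f) *
        (Mero.const p ((c * p ^ k : Cˣ) : C) * Mero.coord p ^ (-d)) by
    refine ⟨m.trans e, fun f => ?_⟩
    change e (m _) = SkewLaurent.sigma q • e (m f)
    rw [← he]
    exact congrArg e (hm f)
  intro f
  rw [map_mul, Mero.sigma_coord_zpow, Units.val_mul, Mero.const_mul]
  have h1 : Mero.const p ((p ^ (-k) : Cˣ) : C) * Mero.const p ((p ^ k : Cˣ) : C) = 1 := by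
    rw [← Mero.const_mul, ← Units.val_mul, ← zpow_add, neg_add_cancel, zpow_zero, Units.val_one,
      Mero.const_one]
  linear_combination (-(Mero.coord p ^ (-k) * Mero.sigma p f *
    (Mero.const p (c : C) * Mero.coord p ^ (-d)))) * h1

/-- Associated operators are insensitive to left multiplication by a nonzero germ. -/
theorem IsAssociated.C_mul {G : SkewPolynomial (Germ C q)} {a : Germ C q} (ha : a ≠ 0) {M : Type u}
    [AddCommGroup M] [Module (Mero C q) M] {S : M → M} (h : IsAssociated G S) :
    IsAssociated (SkewPolynomial.C a * G) S := by
  have hI : Ideal.span {toSkewLaurent (SkewPolynomial.C a * G)} =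
      Ideal.span {toSkewLaurent G} := by
    have ha' : algebraMap (Germ C q) (Mero C q) a ≠ 0 := by
      rwa [Ne, IsFractionRing.to_map_eq_zero_iff]
    have h1 : toSkewLaurent (SkewPolynomial.C a) =
        SkewMonoidAlgebra.single 1 (algebraMap (Germ C q) (Mero C q) a) := by
      rw [toSkewLaurent, SkewPolynomial.sum_C_index (by simp)]
      rfl
    have h2 : toSkewLaurent (SkewPolynomial.C a * G) =
        SkewMonoidAlgebra.single 1 (algebraMap (Germ C q) (Mero C q) a) * toSkewLaurent G := by
      rw [← toSkewLaurentHom_apply, map_mul, toSkewLaurentHom_apply, toSkewLaurentHom_apply, h1]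
    apply le_antisymm
    · rw [Ideal.span_singleton_le_iff_mem, h2]
      exact Ideal.mul_mem_left _ _ (Ideal.subset_span rfl)
    · rw [Ideal.span_singleton_le_iff_mem]
      have h3 : toSkewLaurent G = SkewMonoidAlgebra.single 1
          (algebraMap (Germ C q) (Mero C q) a)⁻¹ * toSkewLaurent (SkewPolynomial.C a * G) := by
        rw [h2, ← mul_assoc, SkewMonoidAlgebra.single_mul_single, one_smul,
          inv_mul_cancel₀ ha', mul_one, SkewMonoidAlgebra.single_one_one, one_mul]
      rw [h3]
      exact Ideal.mul_mem_left _ _ (Ideal.subset_span rfl)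
  unfold IsAssociated
  rw [hI]
  exact h

/-- Extraction of an irreducible right factor: a root `c` of the characteristic polynomial of the
slope `d / s`, none of whose multiples by the positive powers of `p` is too close to a root, gives
a right factor associated to `N_{d,c,s}`. -/
theorem exists_right_factor (hp : p ^ s = q) (hpn : ‖(p : C)‖ = 1) {d : ℤ}
    (hds : IsCoprime d (s : ℤ)) (c : Cˣ) {L : SkewPolynomial (Germ C q)} (hL0 : L.coeff 0 ≠ 0)
    (hroot : (charPoly (ramifyOp p s L) d).eval (c : C) = 0)
    (hdiv : ∃ A > (0 : ℝ), ∃ B > (0 : ℝ), ∀ n : ℕ, A * B ^ n ≤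
      ∏ j ∈ Finset.range n, ‖(charPoly (ramifyOp p s L) d).eval ((c : C) * (p : C) ^ (j + 1))‖) :
    ∃ L' B : SkewPolynomial (Germ C q), L = L' * B ∧ L'.coeff 0 ≠ 0 ∧
      IsAssociated B (SimpleModule.Sigma q p d c s) ∧ (∀ i, s < i → B.coeff i = 0) ∧
      ∃ w, IntFace (ramifyOp p s B) d w 0 s ∧ ∃ β : C, β ≠ 0 ∧
        charPoly (ramifyOp p s B) d =
          Polynomial.C β * (Polynomial.X ^ s - Polynomial.C ((c : C) ^ s)) := by
  have hLne : L ≠ 0 := by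
    rintro rfl
    exact hL0 (SkewPolynomial.coeff_zero 0)
  obtain ⟨w, a, b, hf⟩ := exists_intFace_ramifyOp hLne p s d
  obtain ⟨h, h0, hact⟩ := exists_act_eq_zero hp hpn d c hf hroot hdiv
  obtain ⟨B₀, hB₀, hB₀s, hB₀act⟩ :=
    exists_annihilator hp d c (algebraMap (Germ C p) (Mero C p) h)
  obtain ⟨n, B, j, hBB, hj⟩ := exists_primitive hB₀
  have hr : Germ.coord q ^ n ≠ 0 := pow_ne_zero _ Germ.coord_ne_zero
  have hBs : ∀ i, s < i → B.coeff i = 0 := by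
    intro i hi
    have h1 := hB₀s i hi
    rw [hBB, coeff_C_mul] at h1
    exact (mul_eq_zero.mp h1).resolve_left hr
  have hCact : ∀ (r : Germ C q) (f : Mero C p), act hp d c (SkewPolynomial.C r) f =
      algebraMap (Germ C p) (Mero C p) (Germ.ramify q p s r) * f := by
    intro r f
    rw [act_eq_sum hp d c _ {0} (SkewPolynomial.support_C_subset r), Finset.sum_singleton,
      SkewPolynomial.coeff_C_zero, pow_zero]
    rfl
  have hBact : act hp d c B (algebraMap (Germ C p) (Mero C p) h) = 0 := by
    rw [hBB, map_mul, addEnd_mul_apply, hCact, mul_eq_zero, IsFractionRing.to_map_eq_zero_iff,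
      map_eq_zero_iff _ (Germ.ramify_injective q p s)] at hB₀act
    exact hB₀act.resolve_left hr
  have hBne : B ≠ 0 := by
    rintro rfl
    exact hj (by simp)
  obtain ⟨w', hfB, hβ⟩ := intFace_of_act_eq_zero hp hds c h0 hBne hBs hBact
  have hB0ne : B.coeff 0 ≠ 0 := by
    intro h1
    apply hfB.left_ne
    rw [coeff_ramifyOp, h1, map_zero, zcoeff_zero]
  have hBsne : B.coeff s ≠ 0 := by
    intro h1
    apply hfB.right_ne
    rw [coeff_ramifyOp, h1, map_zero, zcoeff_zero]
  obtain ⟨N, hN⟩ := exists_coeff_eq_zero L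
  obtain ⟨r, A, R, hr0, hdivn, hR⟩ := exists_pseudo_division hBsne hBs N L
    (fun i hi => hN i (by omega))
  have hR0 : R = 0 := by
    refine eq_zero_of_act_eq_zero hp hds c h0 hR ?_
    have h1 := congrArg (fun P => act hp d c P (algebraMap (Germ C p) (Mero C p) h)) hdivn
    simp only [map_mul, map_add, addEnd_mul_apply, hact, map_zero] at h1
    change 0 = act hp d c A (act hp d c B _) + act hp d c R _ at h1
    rw [hBact, map_zero, zero_add] at h1
    exact h1.symm
  rw [hR0, add_zero] at hdivn
  obtain ⟨L', hL'⟩ := exists_eq_mul_of_C_mul_eq hr0 hj hdivn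
  refine ⟨L', B, hL', ?_, isAssociated_of_act_eq_zero hp hds c h0 hB0ne hBsne hBs hBact, hBs,
    w', hfB, hβ⟩
  intro h1
  apply hL0
  rw [hL', coeff_mul_eq_sum]
  simp [h1]

end

/-! ### Small divisors -/

/-- The partial products of the sequence are bounded below by a geometric progression. -/
def GeomBelow (f : ℕ → ℝ) : Prop :=
  ∃ A > (0 : ℝ), ∃ B > (0 : ℝ), ∀ n : ℕ, A * B ^ n ≤ ∏ j ∈ Finset.range n, f j

theorem GeomBelow.const {a : ℝ} (ha : 0 < a) : GeomBelow fun _ => a :=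
  ⟨1, one_pos, a, ha, fun n => by simp⟩

theorem GeomBelow.mul {f g : ℕ → ℝ} (hf : GeomBelow f) (hg : GeomBelow g) :
    GeomBelow fun j => f j * g j := by
  obtain ⟨A, hA, B, hB, h⟩ := hf
  obtain ⟨A', hA', B', hB', h'⟩ := hg
  refine ⟨A * A', mul_pos hA hA', B * B', mul_pos hB hB', fun n => ?_⟩
  rw [Finset.prod_mul_distrib, mul_pow, mul_mul_mul_comm]
  exact mul_le_mul (h n) (h' n) (by positivity) (le_trans (by positivity) (h n))

theorem GeomBelow.mono {f g : ℕ → ℝ} (hf : GeomBelow f) (h0 : ∀ j, 0 ≤ f j) (h : ∀ j, f j ≤ g j) :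
    GeomBelow g := by
  obtain ⟨A, hA, B, hB, h'⟩ := hf
  exact ⟨A, hA, B, hB, fun n => (h' n).trans
    (Finset.prod_le_prod (fun j _ => h0 j) fun j _ => h j)⟩

theorem GeomBelow.of_le_mul {f g : ℕ → ℝ} {D : ℝ} (hf : GeomBelow f) (h0 : ∀ j, 0 ≤ f j)
    (hD : 0 < D) (h : ∀ j, f j ≤ D * g j) : GeomBelow g := by
  refine (hf.mul (GeomBelow.const (inv_pos.mpr hD))).mono
    (fun j => mul_nonneg (h0 j) (inv_pos.mpr hD).le) fun j => ?_
  rw [← div_eq_mul_inv, div_le_iff₀' hD]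
  exact h j

theorem GeomBelow.multiset_prod {ι : Type*} {R : Multiset ι} {f : ι → ℕ → ℝ}
    (h : ∀ r ∈ R, GeomBelow (f r)) : GeomBelow fun j => (R.map fun r => f r j).prod := by
  induction R using Multiset.induction_on with
  | empty => simpa using GeomBelow.const one_pos
  | cons r R ih =>
    have := (h r (Multiset.mem_cons_self r R)).mul
      (ih fun x hx => h x (Multiset.mem_cons_of_mem hx))
    simpa using this

theorem geomBelow_shift {f : ℕ → ℝ} (h0 : 0 < f 0) :
    GeomBelow (fun j => f (j + 1)) ↔ GeomBelow f := by
  constructor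
  · rintro ⟨A, hA, B, hB, h⟩
    refine ⟨min 1 (A * f 0 / B), lt_min one_pos (by positivity), B, hB, fun n => ?_⟩
    rcases n with _ | n
    · simp
    rw [Finset.prod_range_succ']
    calc _ ≤ A * f 0 / B * B ^ (n + 1) := by
          gcongr
          exact min_le_right _ _
      _ = A * B ^ n * f 0 := by
          rw [pow_succ]
          field_simp
      _ ≤ _ := by
          gcongr
          exact h n
  · rintro ⟨A, hA, B, hB, h⟩
    refine ⟨A * B / f 0, by positivity, B, hB, fun n => ?_⟩
    have h1 := h (n + 1)
    rw [Finset.prod_range_succ', ← div_le_iff₀ h0] at h1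
    refine le_trans (le_of_eq ?_) h1
    rw [pow_succ]
    ring

theorem GeomBelow.subseq {f : ℕ → ℝ} (hf : GeomBelow f) (h0 : ∀ j, 0 ≤ f j) {D : ℝ}
    (hD : 1 ≤ D) (h : ∀ j, f j ≤ D) {m : ℕ} (hm : 0 < m) : GeomBelow fun j => f (m * j) := by
  obtain ⟨A, hA, B, hB, h'⟩ := hf
  have hD0 : 0 < D := one_pos.trans_le hD
  obtain ⟨m, rfl⟩ := Nat.exists_eq_succ_of_ne_zero hm.ne'
  have key : ∀ n, ∏ j ∈ Finset.range ((m + 1) * n), f j ≤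
      (D ^ m) ^ n * ∏ j ∈ Finset.range n, f ((m + 1) * j) := by
    intro n
    induction n with
    | zero => simp
    | succ n ih =>
      rw [Nat.mul_succ, Finset.prod_range_add, Finset.prod_range_succ' (n := m),
        Finset.prod_range_succ _ n, pow_succ, add_zero]
      have h2 : ∏ k ∈ Finset.range m, f ((m + 1) * n + (k + 1)) ≤ D ^ m := by
        refine (Finset.prod_le_prod (fun _ _ => h0 _) fun k _ => h _).trans ?_
        simp
      calc _ ≤ ((D ^ m) ^ n * ∏ j ∈ Finset.range n, f ((m + 1) * j)) *
            (D ^ m * f ((m + 1) * n)) := by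
            refine mul_le_mul ih ?_ (mul_nonneg (Finset.prod_nonneg fun _ _ => h0 _) (h0 _))
              (mul_nonneg (by positivity) (Finset.prod_nonneg fun _ _ => h0 _))
            exact mul_le_mul_of_nonneg_right h2 (h0 _)
        _ = _ := by ring
  refine ⟨A, hA, B ^ (m + 1) / D ^ m, by positivity, fun n => ?_⟩
  rw [div_pow, ← mul_div_assoc, div_le_iff₀' (by positivity), ← pow_mul]
  exact (h' _).trans (key n)

open scoped Classical in
/-- The norm, with the value at zero replaced by one. -/
def gap (z : C) : ℝ := if z = 0 then 1 else ‖z‖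

theorem gap_of_ne {z : C} (hz : z ≠ 0) : gap z = ‖z‖ := if_neg hz

theorem gap_pos (z : C) : 0 < gap z := by
  unfold gap
  split_ifs with h
  · exact one_pos
  · exact norm_pos_iff.mpr h

theorem gap_one_sub_le {p : C} (hp : ‖p‖ = 1) (a : C) (j : ℕ) :
    gap (1 - p ^ j * a) ≤ 1 + ‖a‖ := by
  unfold gap
  split_ifs with h
  · linarith [norm_nonneg a]
  · refine (norm_sub_le _ _).trans ?_
    rw [norm_one, norm_mul, norm_pow, hp, one_pow, one_mul]

/-- The nonzero ones among the numbers `1 - p ^ j * a` are not too small on average. -/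
def Tame (p a : C) : Prop := GeomBelow fun j => gap (1 - p ^ j * a)

theorem tame_mul_iff {p a : C} : Tame p (p * a) ↔ Tame p a := by
  have h := geomBelow_shift (f := fun j => gap (1 - p ^ j * a)) (gap_pos _)
  unfold Tame
  simpa only [pow_succ, mul_assoc] using h

theorem tame_zpow_mul_iff {p : Cˣ} {a : C} (k : ℤ) :
    Tame (p : C) ((p ^ k : Cˣ) * a) ↔ Tame (p : C) a := by
  induction k with
  | zero => simp
  | succ k ih =>
    rw [← ih, zpow_add_one, mul_comm (p ^ (k : ℤ)) p, Units.val_mul, mul_assoc, tame_mul_iff]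
  | pred k ih =>
    rw [← ih, ← tame_mul_iff, ← mul_assoc, ← Units.val_mul, ← zpow_one_add]
    rw [add_sub_cancel]

theorem Tame.pow {p a : C} (hp : ‖p‖ = 1) (h : Tame p a) {m : ℕ} (hm : 0 < m) :
    Tame (p ^ m) a := by
  have := GeomBelow.subseq h (fun j => (gap_pos _).le) (D := 1 + ‖a‖)
    (by linarith [norm_nonneg a]) (gap_one_sub_le hp a) hm
  unfold Tame
  simpa only [pow_mul] using this

/-- The estimate for `a ^ s` follows from those for all numbers with the same power, since
`1 - z ^ s` is the product of the `1 - ω * z`, `ω ^ s = 1`. -/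
theorem Tame.of_pow_eq [IsAlgClosed C] {p : C} (hp : ‖p‖ = 1) {s : ℕ} (hs : 0 < s) {b : C}
    (h : ∀ r : C, r ^ s = b → Tame p r) : Tame (p ^ s) b := by
  set P : Polynomial C := Polynomial.X ^ s - Polynomial.C b with hP
  have hmonic : P.Monic := Polynomial.monic_X_pow_sub_C b hs.ne'
  have hsplit := (IsAlgClosed.splits P).eq_prod_roots_of_monic hmonic
  have hcard : P.roots.card = s := by
    rw [← (IsAlgClosed.splits P).natDegree_eq_card_roots, hP, Polynomial.natDegree_X_pow_sub_C]
  have hp0 : p ≠ 0 := by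
    rintro rfl
    simp at hp
  have hprod : ∀ j : ℕ, 1 - (p ^ s) ^ j * b = (P.roots.map fun r => 1 - p ^ j * r).prod := by
    intro j
    have h1 := congrArg (Polynomial.eval ((p ^ j)⁻¹)) hsplit
    rw [Polynomial.eval_multiset_prod, Multiset.map_map] at h1
    have h2 : (P.roots.map fun r => 1 - p ^ j * r) =
        P.roots.map fun r => p ^ j * ((p ^ j)⁻¹ - r) := by
      refine Multiset.map_congr rfl fun r _ => ?_
      rw [mul_sub, mul_inv_cancel₀ (pow_ne_zero j hp0)]
    rw [h2, Multiset.prod_map_mul, Multiset.map_const', Multiset.prod_replicate, hcard]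
    have h3 : (P.roots.map fun r => (p ^ j)⁻¹ - r).prod = ((p ^ j)⁻¹) ^ s - b := by
      rw [hP] at h1
      simpa [hP] using h1.symm
    rw [h3, mul_sub, ← mul_pow, mul_inv_cancel₀ (pow_ne_zero j hp0), one_pow, ← pow_mul, ← pow_mul,
      mul_comm s]
  have hG : GeomBelow fun j => (P.roots.map fun r => gap (1 - p ^ j * r)).prod := by
    refine GeomBelow.multiset_prod fun r hr => h r ?_
    have := (Polynomial.mem_roots'.mp hr).2
    rw [hP, Polynomial.IsRoot.def, Polynomial.eval_sub, Polynomial.eval_pow, Polynomial.eval_X,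
      Polynomial.eval_C, sub_eq_zero] at this
    exact this
  have hD : 1 ≤ (P.roots.map fun r => 1 + ‖r‖).prod := by
    have h1 := Multiset.prod_map_le_prod_map₀ (s := P.roots) (fun _ => (1 : ℝ)) (fun r => 1 + ‖r‖)
      (fun _ _ => zero_le_one) fun r _ => le_add_of_nonneg_right (norm_nonneg r)
    simpa using h1
  have hnn : ∀ j, 0 ≤ (P.roots.map fun r => gap (1 - p ^ j * r)).prod := fun j =>
    Multiset.prod_nonneg fun x hx => by
      obtain ⟨r, -, rfl⟩ := Multiset.mem_map.mp hx
      exact (gap_pos _).le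
  refine hG.of_le_mul hnn (one_pos.trans_le hD) fun j => ?_
  by_cases hz : 1 - (p ^ s) ^ j * b = 0
  · rw [hz, gap, if_pos rfl, mul_one]
    exact Multiset.prod_map_le_prod_map₀ _ _ (fun r _ => (gap_pos _).le)
      fun r _ => gap_one_sub_le hp r j
  · rw [gap_of_ne hz]
    refine le_trans (le_of_eq ?_) (le_mul_of_one_le_left (norm_nonneg _) hD)
    rw [hprod j] at hz ⊢
    have hne : ∀ r ∈ P.roots, 1 - p ^ j * r ≠ 0 := fun r hr h0 =>
      hz (Multiset.prod_eq_zero (Multiset.mem_map.mpr ⟨r, hr, h0⟩))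
    have h4 := map_multiset_prod (normHom : C →*₀ ℝ) (P.roots.map fun r => 1 - p ^ j * r)
    rw [Multiset.map_map] at h4
    refine Eq.trans ?_ h4.symm
    exact congrArg _ (Multiset.map_congr rfl fun r hr => gap_of_ne (hne r hr))

/-- The convergence of `∑ x ^ n / (q;q)_n` as a small divisor estimate. -/
theorem tame_of_isConvergent {q : Cˣ} (hq : ∀ n : ℕ, 0 < n → q ^ n ≠ 1)
    (hconv : IsConvergent
      (PowerSeries.mk fun n => (qPochhammer (q : C) (q : C) n)⁻¹)) : Tame (q : C) (q : C) := by
  obtain ⟨A, B, hA, hB, h⟩ := hconv.exists_le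
  have hne : ∀ j : ℕ, 1 - (q : C) ^ j * q ≠ 0 := by
    intro j hj
    refine hq (j + 1) j.succ_pos (Units.ext ?_)
    rw [Units.val_pow_eq_pow_val, pow_succ, Units.val_one]
    exact (sub_eq_zero.mp hj).symm
  refine ⟨(A + 1)⁻¹, by positivity, B⁻¹, by positivity, fun n => ?_⟩
  have h1 := h n
  rw [PowerSeries.coeff_mk, norm_inv, qPochhammer, norm_prod] at h1
  have h2 : ∏ j ∈ Finset.range n, gap (1 - (q : C) ^ j * q) =
      ∏ j ∈ Finset.range n, ‖1 - (q : C) ^ j * q‖ :=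
    Finset.prod_congr rfl fun j _ => gap_of_ne (hne j)
  have h3 : 0 < ∏ j ∈ Finset.range n, ‖1 - (q : C) ^ j * q‖ :=
    Finset.prod_pos fun j _ => norm_pos_iff.mpr (hne j)
  rw [h2, inv_pow, ← mul_inv, inv_le_comm₀ (by positivity) h3]
  refine h1.trans ?_
  gcongr
  linarith

/-- The estimate for `q` implies that for its roots, since `1 - p ^ j` divides `1 - q ^ j` with a
quotient of norm at most `n`. -/
theorem Tame.root {q p : Cˣ} (hq : ∀ n : ℕ, 0 < n → q ^ n ≠ 1) {n : ℕ} (hn : 0 < n)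
    (hp : p ^ n = q) (hpn : ‖(p : C)‖ = 1) (h : Tame (q : C) (q : C)) :
    Tame (p : C) (p : C) := by
  refine GeomBelow.of_le_mul h (fun j => (gap_pos _).le) (D := n) (by exact_mod_cast hn)
    fun j => ?_
  have hne : 1 - (q : C) ^ j * q ≠ 0 := by
    intro hj
    refine hq (j + 1) j.succ_pos (Units.ext ?_)
    rw [Units.val_pow_eq_pow_val, pow_succ, Units.val_one]
    exact (sub_eq_zero.mp hj).symm
  have hfac : 1 - (q : C) ^ j * q =
      (∑ i ∈ Finset.range n, ((p : C) ^ j * p) ^ i) * (1 - (p : C) ^ j * p) := by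
    have h1 := geom_sum_mul ((p : C) ^ j * p) n
    have h2 : ((p : C) ^ j * p) ^ n = (q : C) ^ j * q := by
      rw [← hp, Units.val_pow_eq_pow_val]
      ring
    rw [h2] at h1
    linear_combination h1
  have hne' : 1 - (p : C) ^ j * p ≠ 0 := fun h0 => hne (by rw [hfac, h0, mul_zero])
  rw [gap_of_ne hne, gap_of_ne hne', hfac, norm_mul]
  gcongr
  refine (norm_sum_le _ _).trans ?_
  simp [hpn]

theorem norm_qPochhammer {p a : C} (n : ℕ) (h : ∀ j : ℕ, 1 - p ^ j * a ≠ 0) :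
    ‖qPochhammer a p n‖ = ∏ j ∈ Finset.range n, gap (1 - p ^ j * a) := by
  rw [qPochhammer, norm_prod]
  exact Finset.prod_congr rfl fun j _ => (gap_of_ne (h j)).symm

theorem one_sub_ne_zero_of_mem_quotientSet {p : Cˣ} {E : Multiset C} {a : C}
    (ha : a ∈ quotientSet p E) (j : ℕ) : 1 - (p : C) ^ j * a ≠ 0 := by
  intro h
  classical
  rw [quotientSet, Finset.mem_filter] at ha
  refine ha.2 (-j) (by simp) ?_
  rw [zpow_neg, zpow_natCast, Units.val_inv_eq_inv_val, Units.val_pow_eq_pow_val]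
  exact eq_inv_of_mul_eq_one_right (sub_eq_zero.mp h).symm

/-- Admissibility amounts to small divisor estimates for all the quotients of exponents. -/
theorem isConvergent_phi_iff {p : Cˣ} (hpn : ‖(p : C)‖ = 1) (hp : Tame (p : C) (p : C))
    (E : Multiset C) : IsConvergent (phi (p : C) (quotientSet p E)) ↔
      ∀ x ∈ E, ∀ y ∈ E, Tame (p : C) (x * y⁻¹) := by
  classical
  set S := quotientSet p E with hS
  have hnorm : ∀ n, ‖PowerSeries.coeff n (phi (p : C) S)‖ =
      (∏ a ∈ S, ∏ j ∈ Finset.range n, gap (1 - (p : C) ^ j * a))⁻¹ := by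
    intro n
    rw [phi, PowerSeries.coeff_mk, norm_inv, norm_prod]
    exact congrArg _ (Finset.prod_congr rfl fun a ha =>
      norm_qPochhammer n (one_sub_ne_zero_of_mem_quotientSet ha))
  have hpos : ∀ n, 0 < ∏ a ∈ S, ∏ j ∈ Finset.range n, gap (1 - (p : C) ^ j * a) := fun n =>
    Finset.prod_pos fun a _ => Finset.prod_pos fun j _ => gap_pos _
  constructor
  · intro h x hx y hy
    by_cases ha : x * y⁻¹ ∈ S
    · obtain ⟨A, B, hA, hB, h⟩ := h.exists_le
      have hG : GeomBelow fun j => ∏ a ∈ S, gap (1 - (p : C) ^ j * a) := by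
        refine ⟨(A + 1)⁻¹, by positivity, B⁻¹, by positivity, fun n => ?_⟩
        have h1 := h n
        rw [hnorm] at h1
        rw [Finset.prod_comm, inv_pow, ← mul_inv, inv_le_comm₀ (by positivity) (hpos n)]
        refine h1.trans ?_
        gcongr
        linarith
      refine hG.of_le_mul (fun j => Finset.prod_nonneg fun a _ => (gap_pos _).le)
        (D := ∏ a ∈ S.erase (x * y⁻¹), (1 + ‖a‖))
        (Finset.prod_pos fun a _ => by positivity) fun j => ?_
      rw [← Finset.mul_prod_erase S _ ha, mul_comm]
      gcongr
      · exact (gap_pos _).le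
      · exact fun a _ => (gap_pos _).le
      · exact gap_one_sub_le hpn _ j
    · rw [hS, quotientSet, Finset.mem_filter] at ha
      push Not at ha
      obtain ⟨m, -, hm⟩ := ha (Finset.mem_image.mpr ⟨(x, y), Finset.mem_product.mpr
        ⟨Multiset.mem_toFinset.mpr hx, Multiset.mem_toFinset.mpr hy⟩, rfl⟩)
      rw [hm, ← mul_one ((p ^ m : Cˣ) : C), tame_zpow_mul_iff, ← tame_mul_iff, mul_one]
      exact hp
  · intro h
    have hG : GeomBelow fun j => (S.val.map fun a => gap (1 - (p : C) ^ j * a)).prod := by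
      refine GeomBelow.multiset_prod fun a ha => ?_
      have ha' : a ∈ S := ha
      rw [hS, quotientSet, Finset.mem_filter, Finset.mem_image] at ha'
      obtain ⟨⟨⟨x, y⟩, hxy, rfl⟩, -⟩ := ha'
      rw [Finset.mem_product] at hxy
      exact h x (Multiset.mem_toFinset.mp hxy.1) y (Multiset.mem_toFinset.mp hxy.2)
    obtain ⟨A, hA, B, hB, h'⟩ := hG
    refine isConvergent_of_le (A := A⁻¹) (B := B⁻¹) (inv_pos.mpr hB) fun n => ?_
    rw [hnorm, inv_pow, ← mul_inv, inv_le_inv₀ (hpos n) (by positivity), Finset.prod_comm]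
    exact h' n

/-! ### Characteristic polynomials and ramification -/

section

variable {q : Cˣ}

theorem norm_eq_one_of_pow_eq {p : Cˣ} {n : ℕ} (hn : 0 < n) (hp : p ^ n = q)
    (hq : ‖(q : C)‖ = 1) : ‖(p : C)‖ = 1 := by
  rw [← hp, Units.val_pow_eq_pow_val, norm_pow] at hq
  exact (pow_eq_one_iff_of_nonneg (norm_nonneg _) hn.ne').mp hq

/-- A side is already seen after the least ramification that makes its slope integral. -/
theorem charPoly_ramifyOp_mul {L : SkewPolynomial (Germ C q)} (hL : L ≠ 0) (p : Cˣ) (m s n : ℕ)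
    [NeZero s] [NeZero n] (hn : n = m * s) (d : ℤ) :
    charPoly (ramifyOp p n L) (m * d) = charPoly (ramifyOp (p ^ m) s L) d := by
  obtain ⟨w, a, b, h⟩ := exists_intFace_ramifyOp hL (p ^ m) s d
  have hs : (s : ℝ) ≠ 0 := by exact_mod_cast NeZero.ne s
  have hface := h.face_of_ramifyOp (m := (d : ℝ) / s) (by field_simp)
  obtain ⟨v, hv, h'⟩ := hface.exists_intFace p n (e := m * d) (by
    rw [hn]; push_cast; field_simp)
  have hvw : v = m * w := by
    have : (v : ℝ) = m * w := by
      rw [hv, hn]; push_cast; field_simp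
    exact_mod_cast this
  subst hvw
  ext i
  rw [h.coeff_charPoly, h'.coeff_charPoly, coeff_ramifyOp, coeff_ramifyOp]
  have h1 : zcoeff (Germ.ramify q p n (L.coeff i)) (m * w + m * d * i) =
      zcoeff (Germ.ramify q (p ^ m) s (L.coeff i)) (w + d * i) := by
    have hm : (m : ℤ) ≠ 0 := by
      rintro h0
      apply NeZero.ne n
      rw [hn, Nat.cast_eq_zero.mp h0, zero_mul]
    rw [show (m * w + m * d * i : ℤ) = m * (w + d * i) by ring]
    by_cases hdvd : (s : ℤ) ∣ w + d * i
    · obtain ⟨k, hk⟩ := hdvd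
      rw [hk, zcoeff_ramify_mul, ← mul_assoc, ← Nat.cast_mul, ← hn, zcoeff_ramify_mul]
    · rw [zcoeff_ramify_of_not_dvd _ hdvd, zcoeff_ramify_of_not_dvd]
      rw [hn]
      push_cast
      exact fun h0 => hdvd ((mul_dvd_mul_iff_left hm).mp h0)
  rw [h1, ← zpow_natCast p m, ← zpow_mul]
  congr 3
  ring

theorem pow_choose_two_mul {ζ : Cˣ} {s : ℕ} (hζ : ζ ^ s = 1) (j : ℕ) :
    ζ ^ ((s * j).choose 2 : ℤ) = (ζ ^ (s.choose 2 : ℤ)) ^ j := by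
  induction j with
  | zero => simp
  | succ j ih =>
    rw [Nat.mul_succ, choose_two_add, zpow_add, zpow_add, ih, pow_succ]
    have : ζ ^ (((s * j : ℕ) : ℤ) * (s : ℤ)) = 1 := by
      rw [mul_comm, zpow_mul, zpow_natCast ζ s, hζ, one_zpow]
    rw [this, mul_one]

/-- Another choice of the root of `q` multiplies the `s`-th powers of the exponents of a slope with
denominator `s` by a common factor. -/
theorem exists_eval_charPoly_eq_zero {L : SkewPolynomial (Germ C q)} (hL : L ≠ 0) {P P' : Cˣ}
    {s : ℕ} [NeZero s] (hP : P ^ s = q) (hP' : P' ^ s = q) {d : ℤ} (hds : IsCoprime d (s : ℤ)) :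
    ∃ ε : Cˣ, ∀ x y : C, x ≠ 0 → y ^ s = ε * x ^ s →
      (charPoly (ramifyOp P s L) d).eval x = 0 → (charPoly (ramifyOp P' s L) d).eval y = 0 := by
  obtain ⟨w, a, b, h⟩ := exists_intFace_ramifyOp hL P s d
  have hs : (s : ℝ) ≠ 0 := by exact_mod_cast NeZero.ne s
  have hface := h.face_of_ramifyOp (m := (d : ℝ) / s) (by field_simp)
  obtain ⟨v, hv, h'⟩ := hface.exists_intFace P' s (e := d) (by field_simp)
  have hvw : v = w := by
    have : (v : ℝ) = w := by
      rw [hv]; field_simp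
    exact_mod_cast this
  subst hvw
  set ζ := P' * P⁻¹ with hζ
  have hζs : ζ ^ s = 1 := by rw [hζ, mul_pow, inv_pow, hP, hP', mul_inv_cancel]
  have hP'ζ : P' = ζ * P := by rw [hζ, inv_mul_cancel_right]
  refine ⟨(ζ ^ (s.choose 2 : ℤ)) ^ d, fun x y hx hxy h0 => ?_⟩
  have key : ∀ i, (charPoly (ramifyOp P' s L) d).coeff i * y ^ i * x ^ a =
      ((ζ ^ (-(d * (a.choose 2 : ℤ))) : Cˣ) : C) * y ^ a *
        ((charPoly (ramifyOp P s L) d).coeff i * x ^ i) := by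
    intro i
    by_cases hi : (charPoly (ramifyOp P s L) d).coeff i = 0
    · have hi' : zcoeff ((ramifyOp P s L).coeff i) (v + d * i) = 0 := by
        by_contra hne
        exact (h.charPoly_coeff_ne_zero_iff i).mpr hne hi
      have hi'' : zcoeff ((ramifyOp P' s L).coeff i) (v + d * i) = 0 := by
        rw [coeff_ramifyOp] at hi' ⊢
        exact hi'
      rw [h'.coeff_charPoly, hi'', hi]
      ring
    · have hai := (h.mem i ((h.charPoly_coeff_ne_zero_iff i).mp hi)).1
      obtain ⟨j, rfl⟩ : ∃ j, i = a + s * j := by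
        obtain ⟨j, hj⟩ := h.dvd_index_sub hds hi
        have hj0 : 0 ≤ j := by
          have hs0 : (0 : ℤ) < s := by exact_mod_cast Nat.pos_of_ne_zero (NeZero.ne s)
          by_contra! hneg
          have := mul_neg_of_pos_of_neg hs0 hneg
          omega
        lift j to ℕ using hj0
        refine ⟨j, ?_⟩
        zify
        linarith
      rw [h.coeff_charPoly, h'.coeff_charPoly, coeff_ramifyOp, coeff_ramifyOp]
      have hz : zcoeff (Germ.ramify q P' s (L.coeff (a + s * j))) (v + d * (a + s * j : ℕ)) =
        zcoeff (Germ.ramify q P s (L.coeff (a + s * j))) (v + d * (a + s * j : ℕ)) := rfl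
      have hpow : (P' ^ (-(d * ((a + s * j).choose 2 : ℤ))) : Cˣ) =
          ζ ^ (-(d * (a.choose 2 : ℤ))) * (((ζ ^ (s.choose 2 : ℤ)) ^ d) ^ j)⁻¹ *
            P ^ (-(d * ((a + s * j).choose 2 : ℤ))) := by
        rw [hP'ζ, mul_zpow]
        congr 1
        have e1 : -(d * ((a + s * j).choose 2 : ℤ)) =
            -(d * (a.choose 2 : ℤ)) + ((s * j).choose 2 : ℤ) * (-d) + s * (-(d * a * j)) := by
          rw [choose_two_add]
          push_cast
          ring
        rw [e1, zpow_add, zpow_add, zpow_mul ζ (s : ℤ), zpow_natCast ζ s, hζs, one_zpow, mul_one,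
          zpow_mul ζ ((s * j).choose 2 : ℤ), pow_choose_two_mul hζs, zpow_neg]
        congr 1
        rw [← zpow_natCast _ j, ← zpow_natCast _ j, ← zpow_mul _ (j : ℤ), ← zpow_mul _ d,
          ← zpow_neg]
        congr 1
        ring
      rw [hz, hpow, Units.val_mul, Units.val_mul]
      generalize (ζ ^ (s.choose 2 : ℤ)) ^ d = ε at hxy ⊢
      have hε : (((ε ^ j)⁻¹ : Cˣ) : C) * (ε : C) ^ j = 1 := by
        rw [← Units.val_pow_eq_pow_val, Units.inv_mul]
      have hy : y ^ (a + s * j) = y ^ a * ((ε : C) ^ j * x ^ (s * j)) := by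
        rw [pow_add, pow_mul, hxy, mul_pow, pow_mul x]
      rw [hy, pow_add x]
      generalize (((ε ^ j)⁻¹ : Cˣ) : C) = η at hε ⊢
      linear_combination ((ζ ^ (-(d * (a.choose 2 : ℤ))) : Cˣ) : C) *
        ((P ^ (-(d * ((a + s * j).choose 2 : ℤ))) : Cˣ) : C) *
        zcoeff (Germ.ramify q P s (L.coeff (a + s * j))) (v + d * (a + s * j : ℕ)) *
        y ^ a * x ^ a * x ^ (s * j) * hε
  have hsum : (charPoly (ramifyOp P' s L) d).eval y * x ^ a =
      ((ζ ^ (-(d * (a.choose 2 : ℤ))) : Cˣ) : C) * y ^ a *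
        (charPoly (ramifyOp P s L) d).eval x := by
    rw [Polynomial.eval_eq_sum_range, Polynomial.eval_eq_sum_range, h.natDegree_charPoly,
      h'.natDegree_charPoly, Finset.sum_mul, Finset.mul_sum]
    exact Finset.sum_congr rfl fun i _ => key i
  rw [h0, mul_zero] at hsum
  exact (mul_eq_zero.mp hsum).resolve_right (pow_ne_zero a hx)

theorem mem_intExponents {p : Cˣ} {A : SkewPolynomial (Germ C p)} (hA : A ≠ 0) {e : ℤ} {x : C} :
    x ∈ intExponents A e ↔ (charPoly A e).eval x = 0 ∧ x ≠ 0 := by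
  obtain ⟨w, a, b, h⟩ := exists_face hA e
  obtain ⟨v, -, h'⟩ := h.exists_intFace p 1 (e := e) (by simp)
  have hne : charPoly A e ≠ 0 := by
    have hw : ∃ v : ℤ, IntFace A e v a b := by
      refine ⟨(A.coeff a).ord - e * a, (face_iff_intFace _ _ _ _ _).mp ?_⟩
      convert h using 1
      push_cast
      rw [h.left_eq]
      ring
    exact hw.choose_spec.charPoly_ne_zero
  classical
  rw [intExponents, Multiset.mem_filter, Polynomial.mem_roots hne, Polynomial.IsRoot.def]

theorem ramifyOp_ne_zero {L : SkewPolynomial (Germ C q)} (hL : L ≠ 0) (p : Cˣ) (s : ℕ)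
    [NeZero s] : ramifyOp p s L ≠ 0 := by
  obtain ⟨w, a, b, h⟩ := exists_intFace_ramifyOp hL p s 0
  rintro h0
  apply h.left_ne
  rw [h0, SkewPolynomial.coeff_zero, zcoeff_zero]

theorem isCoprime_num_den (μ : ℚ) : IsCoprime μ.num (μ.den : ℤ) :=
  Int.isCoprime_iff_gcd_eq_one.mpr μ.reduced

theorem exists_eq_mul_of_cast_eq {μ : ℚ} {n : ℕ} {e : ℤ} (he : (e : ℚ) = n * μ) :
    ∃ m : ℕ, n = m * μ.den ∧ e = m * μ.num := by
  have hden : (μ.den : ℚ) ≠ 0 := by exact_mod_cast μ.den_ne_zero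
  have h1 : e * μ.den = n * μ.num := by
    have h2 : (e : ℚ) * μ.den = n * μ.num := by
      rw [he, mul_assoc, Rat.mul_den_eq_num]
    exact_mod_cast h2
  have hco : IsCoprime (μ.den : ℤ) μ.num := (isCoprime_num_den μ).symm
  have h3 : (μ.den : ℤ) ∣ n := hco.dvd_of_dvd_mul_right ⟨e, by rw [← h1, mul_comm]⟩
  obtain ⟨m, rfl⟩ := Int.natCast_dvd_natCast.mp h3
  refine ⟨m, mul_comm _ _, ?_⟩
  have hd : (μ.den : ℤ) ≠ 0 := by exact_mod_cast μ.den_ne_zero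
  apply mul_right_cancel₀ hd
  rw [h1]
  push_cast
  ring

/-- The small divisor estimates, over the base `q` itself, for the quotients of the exponents of
an almost admissible slope. -/
theorem tame_of_isAlmostAdmissibleSlope [IsAlgClosed C] (hq : ‖(q : C)‖ = 1)
    (hq_root : ∀ n : ℕ, 0 < n → q ^ n ≠ 1) (hT : Tame (q : C) (q : C))
    {root : ℕ → Cˣ} (hroot : ∀ n : ℕ, 0 < n → root n ^ n = q) {L : SkewPolynomial (Germ C q)}
    (hL : L ≠ 0) {μ : ℚ} (hadm : IsAlmostAdmissibleSlope root L μ) {x x' : C} (hx0 : x ≠ 0)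
    (hx0' : x' ≠ 0) (hx : (charPoly (ramifyOp (root μ.den) μ.den L) μ.num).eval x = 0)
    (hx' : (charPoly (ramifyOp (root μ.den) μ.den L) μ.num).eval x' = 0) :
    Tame (q : C) ((x * x'⁻¹) ^ μ.den) := by
  obtain ⟨n, hn, e, he, hadm⟩ := hadm
  obtain ⟨m, hnm, rfl⟩ := exists_eq_mul_of_cast_eq he
  have hn0 : 0 < n := Nat.pos_of_ne_zero (NeZero.ne n)
  have hs0 : 0 < μ.den := μ.den_pos
  have hm0 : 0 < m := by
    rcases Nat.eq_zero_or_pos m with h | h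
    · rw [h, zero_mul] at hnm
      omega
    · exact h
  have hpn := norm_eq_one_of_pow_eq hn0 (hroot n hn0) hq
  rw [IsAdmissibleSlope, isConvergent_phi_iff hpn (hT.root hq_root hn0 (hroot n hn0) hpn)] at hadm
  have hP' : (root n ^ m) ^ μ.den = q := by rw [← pow_mul, ← hnm, hroot n hn0]
  have hds : IsCoprime μ.num (μ.den : ℤ) := isCoprime_num_den μ
  obtain ⟨ε, hε⟩ := exists_eval_charPoly_eq_zero hL (hroot _ hs0) hP' hds
  have hq' : (q : C) = ((root n : C) ^ m) ^ μ.den := by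
    rw [← hP', Units.val_pow_eq_pow_val, Units.val_pow_eq_pow_val]
  rw [hq']
  refine Tame.of_pow_eq (by rw [norm_pow, hpn, one_pow]) hs0 fun r hr => Tame.pow hpn ?_ hm0
  obtain ⟨y', hy'⟩ := IsAlgClosed.exists_pow_nat_eq ((ε : C) * x' ^ μ.den) hs0
  have hmem : ∀ y z : C, z ≠ 0 → y ^ μ.den = ε * z ^ μ.den →
      (charPoly (ramifyOp (root μ.den) μ.den L) μ.num).eval z = 0 →
      y ∈ intExponents (ramifyOp (root n) n L) (m * μ.num) := by
    intro y z hz hyz hev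
    rw [mem_intExponents (ramifyOp_ne_zero hL _ _), charPoly_ramifyOp_mul hL _ _ _ _ hnm]
    refine ⟨hε z y hz hyz hev, ?_⟩
    rintro rfl
    rw [zero_pow hs0.ne'] at hyz
    exact mul_ne_zero ε.ne_zero (pow_ne_zero _ hz) hyz.symm
  have hy0 : y' ≠ 0 := by
    rintro rfl
    rw [zero_pow hs0.ne'] at hy'
    exact mul_ne_zero ε.ne_zero (pow_ne_zero _ hx0') hy'.symm
  have hy : (r * y') ^ μ.den = ε * x ^ μ.den := by
    rw [mul_pow, hr, hy', mul_pow, inv_pow]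
    field_simp
  have := hadm _ (hmem _ _ hx0 hy hx) _ (hmem _ _ hx0' hy' hx')
  rwa [mul_inv_cancel_right₀ hy0] at this

/-- The characteristic polynomial of a slope with denominator `s` is, up to a power of `T`, a
polynomial in `T ^ s`. -/
theorem exists_charPoly_eq [IsAlgClosed C] {L : SkewPolynomial (Germ C q)} {p : Cˣ} {s : ℕ}
    [NeZero s] {d w : ℤ} {a b : ℕ} (h : IntFace (ramifyOp p s L) d w a b)
    (hds : IsCoprime d (s : ℤ)) :
    ∃ β : C, β ≠ 0 ∧ ∃ cs : Multiset Cˣ, b = a + s * cs.card ∧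
      charPoly (ramifyOp p s L) d = Polynomial.C β * Polynomial.X ^ a *
        (cs.map fun c : Cˣ => Polynomial.X ^ s - Polynomial.C ((c : C) ^ s)).prod := by
  have hs0 : 0 < s := Nat.pos_of_ne_zero (NeZero.ne s)
  set φ := charPoly (ramifyOp p s L) d with hφ
  set R : Polynomial C :=
    ∑ j ∈ Finset.range (b + 1), Polynomial.monomial j (φ.coeff (a + s * j)) with hR
  have hvan : ∀ i, b < i → φ.coeff i = 0 := by
    intro i hi
    by_contra hne
    have := (h.mem i ((h.charPoly_coeff_ne_zero_iff i).mp hne)).2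
    omega
  have hRc : ∀ j, R.coeff j = φ.coeff (a + s * j) := by
    intro j
    rw [hR, Polynomial.finsetSum_coeff]
    simp_rw [Polynomial.coeff_monomial]
    rw [Finset.sum_ite_eq']
    split_ifs with hj
    · rfl
    · rw [hvan]
      rw [Finset.mem_range, not_lt] at hj
      have : j ≤ s * j := Nat.le_mul_of_pos_left j hs0
      omega
  have hφR : φ = Polynomial.X ^ a * Polynomial.expand C s R := by
    ext i
    rw [Polynomial.coeff_X_pow_mul', Polynomial.coeff_expand hs0]
    by_cases hi : φ.coeff i = 0
    · rw [hi]
      split_ifs with h1 h2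
      · obtain ⟨j, hj⟩ := h2
        rw [hj, Nat.mul_div_cancel_left _ hs0, hRc, ← hj, Nat.add_sub_cancel' h1, hi]
      · rfl
      · rfl
    · have hai := (h.mem i ((h.charPoly_coeff_ne_zero_iff i).mp hi)).1
      have h2 : s ∣ i - a := by
        have := h.dvd_index_sub hds hi
        rw [← Nat.cast_sub hai] at this
        exact_mod_cast this
      rw [if_pos hai, if_pos h2]
      obtain ⟨j, hj⟩ := h2
      rw [hj, Nat.mul_div_cancel_left _ hs0, hRc, ← hj, Nat.add_sub_cancel' hai]
  have hR0 : R.coeff 0 ≠ 0 := by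
    rw [hRc, mul_zero, add_zero]
    exact (h.charPoly_coeff_ne_zero_iff a).mpr h.left_ne
  have hRne : R ≠ 0 := by
    intro h0
    rw [h0] at hR0
    exact hR0 (Polynomial.coeff_zero 0)
  have hpre : ∀ z ∈ R.roots, ∃ c : Cˣ, (c : C) ^ s = z := by
    intro z hz
    obtain ⟨c, hc⟩ := IsAlgClosed.exists_pow_nat_eq z hs0
    have hz0 : z ≠ 0 := by
      rintro rfl
      rw [Polynomial.mem_roots hRne, Polynomial.IsRoot.def, ← Polynomial.coeff_zero_eq_eval_zero]
        at hz
      exact hR0 hz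
    have hc0 : c ≠ 0 := by
      rintro rfl
      rw [zero_pow hs0.ne'] at hc
      exact hz0 hc.symm
    exact ⟨Units.mk0 c hc0, hc⟩
  obtain ⟨cs, hcs⟩ : ∃ cs : Multiset Cˣ, cs.map (fun c : Cˣ => (c : C) ^ s) = R.roots := by
    have key : ∀ m : Multiset C, (∀ z ∈ m, ∃ c : Cˣ, (c : C) ^ s = z) →
        ∃ cs : Multiset Cˣ, cs.map (fun c : Cˣ => (c : C) ^ s) = m := by
      intro m
      induction m using Multiset.induction_on with
      | empty => exact fun _ => ⟨0, rfl⟩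
      | cons z m ih =>
        intro hm
        obtain ⟨cs, hcs⟩ := ih fun y hy => hm y (Multiset.mem_cons_of_mem hy)
        obtain ⟨c, hc⟩ := hm z (Multiset.mem_cons_self z m)
        exact ⟨c ::ₘ cs, by rw [Multiset.map_cons, hc, hcs]⟩
    exact key _ hpre
  have hRprod := (IsAlgClosed.splits R).eq_prod_roots
  have hexp : Polynomial.expand C s R = Polynomial.C R.leadingCoeff *
      (cs.map fun c : Cˣ => Polynomial.X ^ s - Polynomial.C ((c : C) ^ s)).prod := by
    conv_lhs => rw [hRprod, ← hcs]
    rw [map_mul, Polynomial.expand_C, map_multiset_prod, Multiset.map_map, Multiset.map_map]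
    congr 2
    refine Multiset.map_congr rfl fun c _ => ?_
    simp
  refine ⟨R.leadingCoeff, Polynomial.leadingCoeff_ne_zero.mpr hRne, cs, ?_, ?_⟩
  · rw [← h.natDegree_charPoly, ← hφ, hφR, Polynomial.natDegree_mul (by simp)
      ((Polynomial.expand_ne_zero hs0).mpr hRne), Polynomial.natDegree_X_pow,
      Polynomial.natDegree_expand, (IsAlgClosed.splits R).natDegree_eq_card_roots, ← hcs,
      Multiset.card_map, mul_comm]
  · rw [hφR, hexp]
    ring

end

/-! ### Factorization along one slope -/

/-- A finite multiset can be listed so that no element is related to a later one by a given strict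
order. -/
theorem exists_coe_eq_pairwise_not {α : Type*} (R : α → α → Prop) (hirr : ∀ x, ¬ R x x)
    (htr : ∀ x y z, R x y → R y z → R x z) (m : Multiset α) :
    ∃ l : List α, (l : Multiset α) = m ∧ l.Pairwise fun x y => ¬ R x y := by
  classical
  induction m using Multiset.induction_on with
  | empty => exact ⟨[], rfl, List.Pairwise.nil⟩
  | cons x m ih =>
    obtain ⟨l, rfl, hl⟩ := ih
    -- `x` is placed after the elements `y` with `R x y` and before all the others
    refine ⟨l.filter (fun y => R x y) ++ x :: l.filter (fun y => ¬ R x y), ?_, ?_⟩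
    · rw [Multiset.cons_coe, Multiset.coe_eq_coe]
      refine List.perm_middle.trans (List.Perm.cons x ?_)
      have := List.filter_append_perm (fun y => decide (R x y)) l
      simpa using this
    · rw [List.pairwise_append, List.pairwise_cons]
      refine ⟨hl.sublist List.filter_sublist, ⟨fun y hy => ?_, hl.sublist List.filter_sublist⟩,
        fun y hy z hz hyz => ?_⟩
      · simpa using (List.mem_filter.mp hy).2
      · have hxy : R x y := by simpa using (List.mem_filter.mp hy).2
        rcases List.mem_cons.mp hz with rfl | hz
        · exact hirr _ (htr _ _ _ hxy hyz)
        · have hxz : ¬ R x z := by simpa using (List.mem_filter.mp hz).2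
          exact hxz (htr _ _ _ hxy hyz)

section

variable {q : Cˣ}

/-- The product of the polynomials `T ^ s - c ^ s * q ^ k`, for `c` in a list. -/
def slopePoly (q : Cˣ) (s : ℕ) (k : ℤ) (cs : List Cˣ) : Polynomial C :=
  (cs.map fun c => Polynomial.X ^ s - Polynomial.C ((c ^ s * q ^ k : Cˣ) : C)).prod

theorem slopePoly_cons (s : ℕ) (k : ℤ) (c : Cˣ) (cs : List Cˣ) :
    slopePoly q s k (c :: cs) =
      (Polynomial.X ^ s - Polynomial.C ((c ^ s * q ^ k : Cˣ) : C)) * slopePoly q s k cs := by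
  rw [slopePoly, List.map_cons, List.prod_cons, slopePoly]

theorem slopePoly_comp {p : Cˣ} {s : ℕ} (hp : p ^ s = q) (k w : ℤ) (cs : List Cˣ) :
    ∃ γ : C, γ ≠ 0 ∧ (slopePoly q s k cs).comp
      (Polynomial.C ((p ^ w : Cˣ) : C) * Polynomial.X) =
        Polynomial.C γ * slopePoly q s (k - w) cs := by
  induction cs with
  | nil => exact ⟨1, one_ne_zero, by simp [slopePoly]⟩
  | cons c cs ih =>
    obtain ⟨γ, hγ, h⟩ := ih
    refine ⟨((q ^ w : Cˣ) : C) * γ, mul_ne_zero (Units.ne_zero _) hγ, ?_⟩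
    have h1 : ((p ^ w : Cˣ) : C) ^ s = ((q ^ w : Cˣ) : C) := by
      rw [← Units.val_pow_eq_pow_val, ← hp, ← zpow_natCast, ← zpow_natCast, ← zpow_mul, ← zpow_mul,
        mul_comm]
    have h2 : ((c ^ s * q ^ k : Cˣ) : C) =
        ((q ^ w : Cˣ) : C) * ((c ^ s * q ^ (k - w) : Cˣ) : C) := by
      rw [← Units.val_mul]
      congr 1
      rw [mul_left_comm, ← zpow_add]
      congr 2
      ring
    rw [slopePoly_cons, slopePoly_cons, Polynomial.mul_comp, h, Polynomial.sub_comp,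
      Polynomial.X_pow_comp, Polynomial.C_comp, mul_pow, ← Polynomial.C_pow, h1, h2,
      Polynomial.C_mul, Polynomial.C_mul]
    ring

/-- Up to a rescaling of the variable by an integral power of `p = q ^ (1 / s)`, the exponents of
the slope `d / s` of `L` are the `s`-th roots of the numbers `c ^ s`, for `c` in the list. -/
def HasSlopePoly (p : Cˣ) (s : ℕ) [NeZero s] (d : ℤ) (L : SkewPolynomial (Germ C q))
    (cs : List Cˣ) : Prop :=
  ∃ β : C, β ≠ 0 ∧ ∃ (a : ℕ) (k : ℤ), charPoly (ramifyOp p s L) d =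
    Polynomial.C β * Polynomial.X ^ a * slopePoly q s k cs

/-- Division of the characteristic polynomial by that of a right factor. -/
theorem HasSlopePoly.of_mul {p : Cˣ} {s : ℕ} [NeZero s] (hp : p ^ s = q) {d : ℤ}
    {L B : SkewPolynomial (Germ C q)} (hL : L ≠ 0) {w : ℤ} {a' b' : ℕ}
    (hB : IntFace (ramifyOp p s B) d w a' b') {γ : C} (hγ : γ ≠ 0) {R : Polynomial C}
    (hR : R ≠ 0)
    (hBR : charPoly (ramifyOp p s B) d = Polynomial.C γ * Polynomial.X ^ a' * R)
    {β : C} (hβ : β ≠ 0) {a : ℕ} {k : ℤ} {cs : List Cˣ}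
    (hLB : charPoly (ramifyOp p s (L * B)) d =
      Polynomial.C β * Polynomial.X ^ a * (R * slopePoly q s k cs))
    (ha : a' ≤ a) : HasSlopePoly p s d L cs := by
  obtain ⟨v, a₁, b₁, hf⟩ := exists_intFace_ramifyOp hL p s d
  rw [ramifyOp_mul hp, hf.charPoly_mul hB, hBR] at hLB
  obtain ⟨a, rfl⟩ := Nat.exists_eq_add_of_le ha
  have h1 : (charPoly (ramifyOp p s L) d).comp
      (Polynomial.C ((p ^ w : Cˣ) : C) * Polynomial.X) =
        Polynomial.C (β * γ⁻¹) * Polynomial.X ^ a * slopePoly q s k cs := by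
    have hne : Polynomial.C γ * Polynomial.X ^ a' * R ≠ 0 :=
      mul_ne_zero (mul_ne_zero (Polynomial.C_ne_zero.mpr hγ) (by simp)) hR
    apply mul_right_cancel₀ hne
    rw [hLB]
    have : Polynomial.C (β * γ⁻¹) * Polynomial.C γ = Polynomial.C β := by
      rw [← Polynomial.C_mul, inv_mul_cancel_right₀ hγ]
    rw [← this, pow_add]
    ring
  have h2 : charPoly (ramifyOp p s L) d = ((charPoly (ramifyOp p s L) d).comp
      (Polynomial.C ((p ^ w : Cˣ) : C) * Polynomial.X)).comp
        (Polynomial.C ((p ^ (-w) : Cˣ) : C) * Polynomial.X) := by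
    rw [Polynomial.comp_assoc, Polynomial.mul_comp, Polynomial.C_comp, Polynomial.X_comp,
      ← mul_assoc, ← Polynomial.C_mul, ← Units.val_mul, ← zpow_add, add_neg_cancel, zpow_zero,
      Units.val_one, Polynomial.C_1, one_mul, Polynomial.comp_X]
  obtain ⟨δ, hδ, h3⟩ := slopePoly_comp hp k (-w) cs
  refine ⟨β * γ⁻¹ * ((p ^ (-w) : Cˣ) : C) ^ a * δ, ?_, a, k - -w, ?_⟩
  · exact mul_ne_zero (mul_ne_zero (mul_ne_zero hβ (inv_ne_zero hγ))
      (pow_ne_zero _ (Units.ne_zero _))) hδ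
  · rw [h2, h1, Polynomial.mul_comp, Polynomial.mul_comp, Polynomial.C_comp,
      Polynomial.X_pow_comp, h3, mul_pow]
    simp only [Polynomial.C_mul, Polynomial.C_pow]
    ring

/-- The small divisor estimate needed for the extraction of the first element of a sorted list of
exponents. -/
theorem geomBelow_norm_eval {p : Cˣ} {s : ℕ} (hp : p ^ s = q) (hpn : ‖(p : C)‖ = 1) {β : C}
    (hβ : β ≠ 0) (a : ℕ) (k : ℤ) (c : Cˣ) (cs : List Cˣ)
    (hne : ∀ c' ∈ cs, ∀ m : ℕ, 0 < m → c' ^ s ≠ c ^ s * q ^ m)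
    (htame : ∀ c' ∈ cs, Tame (q : C) (((c : C) * (c' : C)⁻¹) ^ s)) :
    GeomBelow fun j => ‖(Polynomial.C β * Polynomial.X ^ a * slopePoly q s k cs).eval
      (((c * p ^ k : Cˣ) : C) * (p : C) ^ (j + 1))‖ := by
  have hx : ∀ j : ℕ, ‖((c * p ^ k : Cˣ) : C) * (p : C) ^ (j + 1)‖ = ‖(c : C)‖ := by
    intro j
    rw [Units.val_mul, Units.val_zpow_eq_zpow_val, norm_mul, norm_mul, norm_zpow, norm_pow, hpn,
      one_zpow, one_pow, mul_one, mul_one]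
  induction cs with
  | nil =>
    have hpos : 0 < ‖β‖ * ‖(c : C)‖ ^ a :=
      mul_pos (norm_pos_iff.mpr hβ) (pow_pos (norm_pos_iff.mpr c.ne_zero) a)
    refine (GeomBelow.const hpos).mono (fun _ => hpos.le) fun j => ?_
    rw [slopePoly, List.map_nil, List.prod_nil, mul_one, Polynomial.eval_mul, Polynomial.eval_C,
      Polynomial.eval_pow, Polynomial.eval_X, norm_mul, norm_pow, hx]
  | cons c' cs ih =>
    have ih' := ih (fun x hx => hne x (List.mem_cons_of_mem _ hx))
      fun x hx => htame x (List.mem_cons_of_mem _ hx)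
    have hpos : 0 < ‖((c' ^ s * q ^ k : Cˣ) : C)‖ := norm_pos_iff.mpr (Units.ne_zero _)
    have h1 : GeomBelow fun j => ‖((c' ^ s * q ^ k : Cˣ) : C)‖ *
        gap (1 - (q : C) ^ j * (q * ((c : C) * (c' : C)⁻¹) ^ s)) :=
      (GeomBelow.const hpos).mul (tame_mul_iff.mpr (htame c' List.mem_cons_self))
    refine (h1.mul ih').mono
      (fun j => mul_nonneg (mul_nonneg hpos.le (gap_pos _).le) (norm_nonneg _)) fun j => ?_
    have hsplit : ∀ P Q S : Polynomial C, ∀ x : C,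
        ‖(P * (Q * S)).eval x‖ = ‖Q.eval x‖ * ‖(P * S).eval x‖ := by
      intro P Q S x
      rw [mul_left_comm, Polynomial.eval_mul, norm_mul]
    rw [slopePoly_cons, hsplit]
    refine mul_le_mul_of_nonneg_right (le_of_eq ?_) (norm_nonneg _)
    have hpk : ((p ^ k : Cˣ) : C) ^ s = ((q ^ k : Cˣ) : C) := by
      rw [← Units.val_pow_eq_pow_val, ← hp, ← zpow_natCast, ← zpow_natCast, ← zpow_mul, ← zpow_mul,
        mul_comm]
    have hps : (p : C) ^ s = q := by rw [← Units.val_pow_eq_pow_val, hp]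
    have hne' : 1 - (q : C) ^ j * (q * ((c : C) * (c' : C)⁻¹) ^ s) ≠ 0 := by
      intro h0
      refine hne c' List.mem_cons_self (j + 1) j.succ_pos (Units.ext ?_)
      push_cast
      have hc' := pow_ne_zero s c'.ne_zero
      rw [mul_pow, inv_pow] at h0
      field_simp at h0
      linear_combination h0
    rw [gap_of_ne hne', ← norm_mul, ← norm_neg]
    congr 1
    rw [Polynomial.eval_sub, Polynomial.eval_pow, Polynomial.eval_X, Polynomial.eval_C, mul_pow,
      Units.val_mul, Units.val_mul, mul_pow, mul_pow (c : C) ((p ^ k : Cˣ) : C), hpk, ← pow_mul,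
      mul_comm (j + 1) s, pow_mul, hps,
      Units.val_pow_eq_pow_val, inv_pow]
    have hc' := pow_ne_zero s c'.ne_zero
    field_simp
    ring

theorem coeff_mul_eq_zero_of_lt {A B : SkewPolynomial (Germ C q)} {m n : ℕ}
    (hA : ∀ i, m < i → A.coeff i = 0) (hB : ∀ i, n < i → B.coeff i = 0) (i : ℕ) (hi : m + n < i) :
    (A * B).coeff i = 0 := by
  rw [coeff_mul_eq_sum]
  refine Finset.sum_eq_zero fun z hz => ?_
  have hz' : z.1 + z.2 = i := Finset.HasAntidiagonal.mem_antidiagonal.mp hz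
  rcases lt_or_ge m z.1 with h | h
  · rw [hA _ h, zero_mul]
  · rw [hB z.2 (by omega), smul_zero, mul_zero]

theorem coeff_one_of_pos (i : ℕ) (hi : 0 < i) :
    (1 : SkewPolynomial (Germ C q)).coeff i = 0 := by
  rw [SkewPolynomial.coeff_one, if_neg (by omega)]

theorem intFace_C (p : Cˣ) (s : ℕ) [NeZero s] (d : ℤ) {g : Germ C q} (hg : g ≠ 0) :
    ∃ w, IntFace (ramifyOp p s (SkewPolynomial.C g)) d w 0 0 := by
  have hne : (SkewPolynomial.C g : SkewPolynomial (Germ C q)) ≠ 0 := by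
    intro h0
    have := congrArg (fun P => SkewPolynomial.coeff P 0) h0
    simp [hg] at this
  obtain ⟨w, a, b, h⟩ := exists_intFace_ramifyOp hne p s d
  have hzero : ∀ i, 0 < i → (ramifyOp p s (SkewPolynomial.C g)).coeff i = 0 := by
    intro i hi
    rw [coeff_ramifyOp, SkewPolynomial.coeff_C, if_neg (by omega), map_zero]
  obtain rfl : b = 0 := by
    by_contra hb
    exact h.right_ne (by rw [hzero b (Nat.pos_of_ne_zero hb), zcoeff_zero])
  obtain rfl : a = 0 := Nat.le_zero.mp h.le
  exact ⟨w, h⟩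

/-- `F` is a product `G_l ⋯ G_1` of operators associated to the modules `N_{d,c,s}`, for `c` in a
list of length `l`, and its Newton polygon has a side of slope `d / s` over `[0, l * s]`, where
`l * s` bounds the order of `F`. -/
def IsSlopeProduct (p : Cˣ) (s : ℕ) [NeZero s] (d : ℤ) (F : SkewPolynomial (Germ C q))
    (cs : List Cˣ) : Prop :=
  ∃ Gs : List (SkewPolynomial (Germ C q)), F = Gs.reverse.prod ∧
    List.Forall₂ (fun G c => IsAssociated G (SimpleModule.Sigma q p d c s)) Gs cs ∧
    (∀ i, s * cs.length < i → F.coeff i = 0) ∧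
    ∃ w, IntFace (ramifyOp p s F) d w 0 (s * cs.length)

/-- Factorization along one slope: the irreducible right factors attached to a sorted list of
exponents can be split off one after the other. -/
theorem exists_slope_factorization {p : Cˣ} {s : ℕ} [NeZero s] (hp : p ^ s = q)
    (hpn : ‖(p : C)‖ = 1) {d : ℤ} (hds : IsCoprime d (s : ℤ)) (cs : List Cˣ)
    (hsort : cs.Pairwise fun c c' => ∀ m : ℕ, 0 < m → c' ^ s ≠ c ^ s * q ^ m)
    (hself : ∀ c ∈ cs, ∀ m : ℕ, 0 < m → c ^ s ≠ c ^ s * q ^ m)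
    (htame : ∀ c ∈ cs, ∀ c' ∈ cs, Tame (q : C) (((c : C) * (c' : C)⁻¹) ^ s))
    {L : SkewPolynomial (Germ C q)} (hL0 : L.coeff 0 ≠ 0) (hL : HasSlopePoly p s d L cs) :
    ∃ L' F : SkewPolynomial (Germ C q),
      L = L' * F ∧ L'.coeff 0 ≠ 0 ∧ HasSlopePoly p s d L' [] ∧ IsSlopeProduct p s d F cs := by
  induction cs generalizing L with
  | nil =>
    refine ⟨L, 1, by simp, hL0, hL, [], rfl, List.Forall₂.nil, fun i hi => ?_, ?_⟩
    · exact coeff_one_of_pos i (by simpa using hi)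
    · exact intFace_C p s d (one_ne_zero : (1 : Germ C q) ≠ 0)
  | cons c cs ih =>
    obtain ⟨β, hβ, a, k, hpoly⟩ := hL
    rw [List.pairwise_cons] at hsort
    have hpk : (c * p ^ k) ^ s = c ^ s * q ^ k := by
      rw [mul_pow, ← hp, ← zpow_natCast (p ^ k), ← zpow_natCast p s, ← zpow_mul, ← zpow_mul,
        mul_comm k]
    have hpkC : ((c * p ^ k : Cˣ) : C) ^ s = ((c ^ s * q ^ k : Cˣ) : C) := by
      rw [← hpk, Units.val_pow_eq_pow_val]
    have hroot : (charPoly (ramifyOp p s L) d).eval ((c * p ^ k : Cˣ) : C) = 0 := by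
      rw [hpoly, slopePoly_cons]
      simp only [Polynomial.eval_mul, Polynomial.eval_sub, Polynomial.eval_pow, Polynomial.eval_X,
        Polynomial.eval_C]
      rw [hpkC, sub_self, zero_mul, mul_zero]
    have hdiv := geomBelow_norm_eval hp hpn hβ a k c (c :: cs) (by
      intro c' hc'
      rcases List.mem_cons.mp hc' with rfl | hc'
      · exact hself _ List.mem_cons_self
      · exact hsort.1 c' hc') (htame c List.mem_cons_self)
    rw [← hpoly] at hdiv
    obtain ⟨L₁, B, hLB, hL₁, hass, hBs, w, hfB, γ, hγ, hBpoly⟩ :=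
      exists_right_factor hp hpn hds (c * p ^ k) hL0 hroot hdiv
    have hL₁ne : L₁ ≠ 0 := by
      rintro rfl
      exact hL₁ (SkewPolynomial.coeff_zero 0)
    rw [hpkC] at hBpoly
    have hL₁poly : HasSlopePoly p s d L₁ cs := by
      refine HasSlopePoly.of_mul (k := k) hp hL₁ne hfB hγ
        (R := Polynomial.X ^ s - Polynomial.C ((c ^ s * q ^ k : Cˣ) : C))
        (Polynomial.X_pow_sub_C_ne_zero (Nat.pos_of_ne_zero (NeZero.ne s)) _)
        (by rw [hBpoly, pow_zero, mul_one]) hβ ?_ (Nat.zero_le a)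
      rw [← hLB, hpoly, slopePoly_cons]
    obtain ⟨L', _, hLG, hL', hL'poly, Gs, rfl, hall, hdeg, v, hface⟩ := ih hsort.2
      (fun x hx => hself x (List.mem_cons_of_mem _ hx))
      (fun x hx y hy => htame x (List.mem_cons_of_mem _ hx) y (List.mem_cons_of_mem _ hy))
      hL₁ hL₁poly
    have hprod : (B :: Gs).reverse.prod = Gs.reverse.prod * B := by
      rw [List.reverse_cons, List.prod_append, List.prod_singleton]
    refine ⟨L', (B :: Gs).reverse.prod, ?_, hL', hL'poly, B :: Gs, rfl,
      List.Forall₂.cons hass.mul_zpow hall, ?_, v + w, ?_⟩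
    · rw [hprod, ← mul_assoc, ← hLG, hLB]
    · rw [hprod, List.length_cons, Nat.mul_succ]
      exact coeff_mul_eq_zero_of_lt hdeg hBs
    · rw [hprod, ramifyOp_mul hp, List.length_cons, Nat.mul_succ]
      exact hface.mul hfB

end

/-! ### Passing from one slope to another -/

section

variable {q : Cˣ}

/-- `d / s` is not a slope of `F`: the corresponding side is a point. -/
def IsFlat (p : Cˣ) (s : ℕ) [NeZero s] (d : ℤ) (F : SkewPolynomial (Germ C q)) : Prop :=
  ∃ w a, IntFace (ramifyOp p s F) d w a a

theorem IsFlat.mul {p : Cˣ} {s : ℕ} [NeZero s] (hp : p ^ s = q) {d : ℤ}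
    {A B : SkewPolynomial (Germ C q)} (hA : IsFlat p s d A) (hB : IsFlat p s d B) :
    IsFlat p s d (A * B) := by
  obtain ⟨w, a, h⟩ := hA
  obtain ⟨w', a', h'⟩ := hB
  exact ⟨w + w', a + a', by rw [ramifyOp_mul hp]; exact h.mul h'⟩

theorem IsFlat.of_mul {p : Cˣ} {s : ℕ} [NeZero s] (hp : p ^ s = q) {d : ℤ}
    {A B : SkewPolynomial (Germ C q)} (hA : A ≠ 0) (hB : B ≠ 0) (h : IsFlat p s d (A * B)) :
    IsFlat p s d A := by
  obtain ⟨w, a, h⟩ := h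
  obtain ⟨v, a₁, b₁, h₁⟩ := exists_intFace_ramifyOp hA p s d
  obtain ⟨v', a₂, b₂, h₂⟩ := exists_intFace_ramifyOp hB p s d
  rw [ramifyOp_mul hp] at h
  obtain ⟨-, ha, hb⟩ := h.unique (h₁.mul h₂)
  have e1 := h₁.le
  have e2 := h₂.le
  obtain rfl : a₁ = b₁ := by omega
  exact ⟨v, a₁, h₁⟩

theorem IntFace.charPoly_eq_of_flat {p : Cˣ} {A : SkewPolynomial (Germ C p)} {e w : ℤ} {a : ℕ}
    (h : IntFace A e w a a) : ∃ γ : C, γ ≠ 0 ∧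
      charPoly A e = Polynomial.C γ * Polynomial.X ^ a := by
  refine ⟨(charPoly A e).coeff a, (h.charPoly_coeff_ne_zero_iff a).mpr h.left_ne, ?_⟩
  ext i
  rw [Polynomial.coeff_C_mul_X_pow]
  split_ifs with hi
  · rw [hi]
  · by_contra h0
    have := h.mem i ((h.charPoly_coeff_ne_zero_iff i).mp h0)
    omega

theorem HasSlopePoly.isFlat {p : Cˣ} {s : ℕ} [NeZero s] {d : ℤ} {L : SkewPolynomial (Germ C q)}
    (hL : L ≠ 0) (h : HasSlopePoly p s d L []) : IsFlat p s d L := by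
  obtain ⟨β, -, a, k, h⟩ := h
  rw [slopePoly, List.map_nil, List.prod_nil, mul_one] at h
  obtain ⟨w, a₁, b₁, hf⟩ := exists_intFace_ramifyOp hL p s d
  have key : ∀ i, (charPoly (ramifyOp p s L) d).coeff i ≠ 0 → i = a := by
    intro i hi
    by_contra hne
    rw [h, Polynomial.coeff_C_mul_X_pow, if_neg hne] at hi
    exact hi rfl
  obtain rfl := key a₁ ((hf.charPoly_coeff_ne_zero_iff _).mpr hf.left_ne)
  obtain rfl := key b₁ ((hf.charPoly_coeff_ne_zero_iff _).mpr hf.right_ne)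
  exact ⟨w, _, hf⟩

/-- The extraction of a right factor without the slope `d / s` leaves its exponents unchanged, up to
an integral power of `p`. -/
theorem HasSlopePoly.of_mul_flat {p : Cˣ} {s : ℕ} [NeZero s] (hp : p ^ s = q) {d : ℤ}
    {L B : SkewPolynomial (Germ C q)} (hL : L ≠ 0) (hB : IsFlat p s d B) {cs : List Cˣ}
    (h : HasSlopePoly p s d (L * B) cs) : HasSlopePoly p s d L cs := by
  obtain ⟨w, a', hB⟩ := hB
  obtain ⟨γ, hγ, hBpoly⟩ := hB.charPoly_eq_of_flat
  obtain ⟨β, hβ, a, k, hpoly⟩ := h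
  refine HasSlopePoly.of_mul (k := k) (a := a) (R := 1) hp hL hB hγ one_ne_zero
    (by rw [mul_one, hBpoly]) hβ (by rw [one_mul, hpoly]) ?_
  -- the coefficient of `T ^ a` does not vanish, while the left side is divisible by `T ^ a'`
  by_contra! hlt
  obtain ⟨v, a₁, b₁, hf⟩ := exists_intFace_ramifyOp hL p s d
  rw [ramifyOp_mul hp, hf.charPoly_mul hB, hBpoly] at hpoly
  have h1 := congrArg (fun P => Polynomial.coeff P a) hpoly
  have h2 : (slopePoly q s k cs).coeff 0 ≠ 0 := by
    rw [Polynomial.coeff_zero_eq_eval_zero, slopePoly, Polynomial.eval_list_prod, List.map_map]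
    refine List.prod_ne_zero fun h0 => ?_
    obtain ⟨c, -, hc⟩ := List.mem_map.mp h0
    have hs := NeZero.ne s
    simp only [Function.comp_apply, Polynomial.eval_sub, Polynomial.eval_pow, Polynomial.eval_X,
      Polynomial.eval_C, zero_pow hs, zero_sub, neg_eq_zero] at hc
    exact Units.ne_zero _ hc
  rw [← mul_assoc] at h1
  simp only [Polynomial.coeff_mul_X_pow', if_neg (not_le.mpr hlt)] at h1
  rw [mul_assoc, Polynomial.coeff_C_mul, Polynomial.coeff_X_pow_mul', if_pos le_rfl,
    Nat.sub_self] at h1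
  exact mul_ne_zero hβ h2 h1.symm

theorem IsSlopeProduct.ne_zero {p : Cˣ} {s : ℕ} [NeZero s] {d : ℤ}
    {F : SkewPolynomial (Germ C q)} {cs : List Cˣ} (h : IsSlopeProduct p s d F cs) : F ≠ 0 := by
  obtain ⟨-, -, -, -, w, hf⟩ := h
  rintro rfl
  apply hf.left_ne
  rw [coeff_ramifyOp, SkewPolynomial.coeff_zero, map_zero, zcoeff_zero]

/-- A product attached to one slope has no other slope. -/
theorem IsSlopeProduct.isFlat {p : Cˣ} {μ ν : ℚ} {F : SkewPolynomial (Germ C q)} {cs : List Cˣ}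
    (h : IsSlopeProduct p μ.den μ.num F cs) (hμν : ν ≠ μ) (p' : Cˣ) :
    IsFlat p' ν.den ν.num F := by
  have hF := h.ne_zero
  obtain ⟨-, -, -, hdeg, w, hf⟩ := h
  have hface := hf.face_of_ramifyOp (rat_num_eq_den_mul μ)
  obtain ⟨v, a, b, hv⟩ := exists_intFace_ramifyOp hF p' ν.den ν.num
  rcases hv.le.eq_or_lt with rfl | hab
  · exact ⟨v, a, hv⟩
  · refine absurd ?_ hμν
    exact_mod_cast hface.slope_unique hdeg (hv.face_of_ramifyOp (rat_num_eq_den_mul ν)) hab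

theorem hasSlope_iff_not_isFlat {L : SkewPolynomial (Germ C q)} (hL : L ≠ 0) (p : Cˣ) (μ : ℚ) :
    HasSlope L (μ : ℝ) ↔ ¬ IsFlat p μ.den μ.num L := by
  obtain ⟨v, a, b, hv⟩ := exists_intFace_ramifyOp hL p μ.den μ.num
  rw [(hv.face_of_ramifyOp (rat_num_eq_den_mul μ)).hasSlope_iff]
  constructor
  · rintro hab ⟨w, a', h⟩
    obtain ⟨-, h1, h2⟩ := hv.unique h
    omega
  · intro h
    refine lt_of_le_of_ne hv.le ?_
    rintro rfl
    exact h ⟨v, a, hv⟩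

/-- Factorization along several slopes, in an arbitrary order. -/
theorem exists_factorization (hq : ‖(q : C)‖ = 1) {root : ℕ → Cˣ}
    (hroot : ∀ n : ℕ, 0 < n → root n ^ n = q) (cs : ℚ → List Cˣ) {ls : List ℚ} (hnd : ls.Nodup)
    (hsort : ∀ μ ∈ ls, (cs μ).Pairwise fun c c' =>
      ∀ m : ℕ, 0 < m → c' ^ μ.den ≠ c ^ μ.den * q ^ m)
    (hself : ∀ μ ∈ ls, ∀ c ∈ cs μ, ∀ m : ℕ, 0 < m → c ^ μ.den ≠ c ^ μ.den * q ^ m)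
    (htame : ∀ μ ∈ ls, ∀ c ∈ cs μ, ∀ c' ∈ cs μ,
      Tame (q : C) (((c : C) * (c' : C)⁻¹) ^ μ.den))
    {L : SkewPolynomial (Germ C q)} (hL0 : L.coeff 0 ≠ 0)
    (hL : ∀ μ ∈ ls, HasSlopePoly (root μ.den) μ.den μ.num L (cs μ)) :
    ∃ (L' : SkewPolynomial (Germ C q)) (Fs : List (SkewPolynomial (Germ C q))),
      L = L' * Fs.prod ∧ L'.coeff 0 ≠ 0 ∧
      (∀ μ ∈ ls, IsFlat (root μ.den) μ.den μ.num L') ∧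
      List.Forall₂ (fun F μ => IsSlopeProduct (root μ.den) μ.den μ.num F (cs μ)) Fs ls := by
  induction ls with
  | nil => exact ⟨L, [], by simp, hL0, by simp, List.Forall₂.nil⟩
  | cons μ ls ih =>
    have hne : ∀ {A : SkewPolynomial (Germ C q)}, A.coeff 0 ≠ 0 → A ≠ 0 := by
      rintro A hA rfl
      exact hA (SkewPolynomial.coeff_zero 0)
    obtain ⟨hμ, hnd⟩ := List.nodup_cons.mp hnd
    obtain ⟨L₁, Fs, hLF, hL₁, hflat, hall⟩ := ih hnd
      (fun ν hν => hsort ν (List.mem_cons_of_mem _ hν))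
      (fun ν hν => hself ν (List.mem_cons_of_mem _ hν))
      (fun ν hν => htame ν (List.mem_cons_of_mem _ hν))
      (fun ν hν => hL ν (List.mem_cons_of_mem _ hν))
    have hp := hroot μ.den μ.den_pos
    have hFs : ∀ (Fs : List (SkewPolynomial (Germ C q))) (ls : List ℚ), μ ∉ ls →
        List.Forall₂ (fun F μ => IsSlopeProduct (root μ.den) μ.den μ.num F (cs μ)) Fs ls →
        IsFlat (root μ.den) μ.den μ.num Fs.prod := by
      intro Fs ls hμ hall
      induction hall with
      | nil =>
        obtain ⟨w, hw⟩ := intFace_C (root μ.den) μ.den μ.num (one_ne_zero : (1 : Germ C q) ≠ 0)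
        exact ⟨w, 0, hw⟩
      | cons h _ ih =>
        rw [List.prod_cons]
        exact IsFlat.mul hp (h.isFlat (List.ne_of_not_mem_cons hμ) _)
          (ih (List.not_mem_of_not_mem_cons hμ))
    have hL₁poly : HasSlopePoly (root μ.den) μ.den μ.num L₁ (cs μ) := by
      refine HasSlopePoly.of_mul_flat hp (hne hL₁) (hFs Fs ls hμ hall) ?_
      rw [← hLF]
      exact hL μ List.mem_cons_self
    obtain ⟨L', F, hL₁F, hL', hL'poly, hF⟩ := exists_slope_factorization hp
      (norm_eq_one_of_pow_eq μ.den_pos hp hq) (isCoprime_num_den μ) (cs μ)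
      (hsort μ List.mem_cons_self) (hself μ List.mem_cons_self) (htame μ List.mem_cons_self)
      hL₁ hL₁poly
    refine ⟨L', F :: Fs, ?_, hL', fun ν hν => ?_, List.Forall₂.cons hF hall⟩
    · rw [List.prod_cons, ← mul_assoc, ← hL₁F, hLF]
    · rcases List.mem_cons.mp hν with rfl | hν
      · exact hL'poly.isFlat (hne hL')
      · refine IsFlat.of_mul (hroot ν.den ν.den_pos) (hne hL') hF.ne_zero ?_
        rw [← hL₁F]
        exact hflat ν hν

/-- An operator without slopes has order zero. -/
theorem eq_C_of_not_hasSlope {L : SkewPolynomial (Germ C q)} (hL0 : L.coeff 0 ≠ 0)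
    (h : ∀ μ : ℚ, ¬ HasSlope L (μ : ℝ)) : L = SkewPolynomial.C (L.coeff 0) := by
  by_contra hne
  obtain ⟨i₀, hi₀, hi₀'⟩ : ∃ i, L.coeff i ≠ 0 ∧ i ≠ 0 := by
    by_contra! hall
    apply hne
    ext i
    rw [SkewPolynomial.coeff_C]
    split_ifs with hi
    · rw [hi]
    · by_contra h0
      exact hi (hall i h0)
  have hLne : L ≠ 0 := by
    rintro rfl
    exact hL0 (SkewPolynomial.coeff_zero 0)
  -- the least slope of the lines from the point of index zero to another point
  obtain ⟨i, hi, hmin⟩ := (L.support.filter fun i => i ≠ 0).exists_min_image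
    (fun i => (((L.coeff i).ord : ℝ) - (L.coeff 0).ord) / i)
    ⟨i₀, Finset.mem_filter.mpr ⟨SkewPolynomial.mem_support_iff.mpr hi₀, hi₀'⟩⟩
  rw [Finset.mem_filter, SkewPolynomial.mem_support_iff] at hi
  set m := (((L.coeff i).ord : ℝ) - (L.coeff 0).ord) / i with hm
  obtain ⟨w, a, b, hf⟩ := exists_face hLne m
  have hbound : ∀ j, L.coeff j ≠ 0 → ((L.coeff 0).ord : ℝ) + m * j ≤ (L.coeff j).ord := by
    intro j hj
    rcases eq_or_ne j 0 with rfl | hj0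
    · simp
    · have h1 := hmin j (Finset.mem_filter.mpr ⟨SkewPolynomial.mem_support_iff.mpr hj, hj0⟩)
      have hjpos : (0 : ℝ) < j := by exact_mod_cast Nat.pos_of_ne_zero hj0
      rw [le_div_iff₀ hjpos] at h1
      linarith
  have hw : w = (L.coeff 0).ord := by
    apply le_antisymm
    · simpa using hf.bound 0 hL0
    · have := hbound a hf.left_ne
      rw [hf.left_eq] at this
      linarith
  have hi0 : (i : ℝ) ≠ 0 := by exact_mod_cast hi.2
  have h1 := hf.mem 0 hL0 (by rw [hw]; simp)
  have h2 := hf.mem i hi.1 (by rw [hw, hm]; field_simp; ring)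
  have hab : a < b := by
    have := Nat.pos_of_ne_zero hi.2
    omega
  obtain ⟨μ, hμ⟩ := hf.slope_rat hab
  exact h μ (by rw [← hμ]; exact hf.hasSlope_iff.mpr hab)

/-- A germ on the left can be absorbed in the leftmost factor, if there is one. -/
theorem IsSlopeProduct.C_mul {p : Cˣ} {s : ℕ} [NeZero s] (hp : p ^ s = q) {d : ℤ} {g : Germ C q}
    (hg : g ≠ 0) {F : SkewPolynomial (Germ C q)} {cs : List Cˣ} (hcs : cs ≠ [])
    (h : IsSlopeProduct p s d F cs) : IsSlopeProduct p s d (SkewPolynomial.C g * F) cs := by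
  obtain ⟨Gs, rfl, hall, hdeg, w, hf⟩ := h
  obtain ⟨Gs', hGs', hall'⟩ : ∃ Gs' : List (SkewPolynomial (Germ C q)),
      SkewPolynomial.C g * Gs.reverse.prod = Gs'.reverse.prod ∧
      List.Forall₂ (fun G c => IsAssociated G (SimpleModule.Sigma q p d c s)) Gs' cs := by
    clear hdeg hf
    induction hall with
    | nil => exact absurd rfl hcs
    | @cons G c Gs cs hG hall ih =>
      rcases eq_or_ne cs [] with rfl | hne
      · obtain rfl := List.forall₂_nil_right_iff.mp hall
        exact ⟨[SkewPolynomial.C g * G], by simp, List.Forall₂.cons (hG.C_mul hg) List.Forall₂.nil⟩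
      · obtain ⟨Gs', h1, h2⟩ := ih hne
        refine ⟨G :: Gs', ?_, List.Forall₂.cons hG h2⟩
        rw [List.reverse_cons, List.reverse_cons, List.prod_append, List.prod_append,
          List.prod_singleton, ← mul_assoc, h1]
  obtain ⟨v, hv⟩ := intFace_C p s d hg
  refine ⟨Gs', hGs', hall', fun i hi => ?_, v + w, ?_⟩
  · rw [coeff_C_mul, hdeg i hi, mul_zero]
  · have := hv.mul hf
    rwa [← ramifyOp_mul hp, zero_add, zero_add] at this

/-- Factors inherit almost admissible slopes: up to a common factor, their exponents are among
those of the product. -/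
theorem IsAlmostAdmissibleSlope.of_mul (hq : ‖(q : C)‖ = 1)
    (hq_root : ∀ n : ℕ, 0 < n → q ^ n ≠ 1) (hT : Tame (q : C) (q : C)) {root : ℕ → Cˣ}
    (hroot : ∀ n : ℕ, 0 < n → root n ^ n = q) {A B D : SkewPolynomial (Germ C q)} {μ : ℚ}
    (h0 : A * B * D ≠ 0) (h : IsAlmostAdmissibleSlope root (A * B * D) μ) :
    IsAlmostAdmissibleSlope root B μ := by
  obtain ⟨n, hn, e, he, h⟩ := h
  have hn0 : 0 < n := Nat.pos_of_ne_zero (NeZero.ne n)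
  have hp := hroot n hn0
  have hpn := norm_eq_one_of_pow_eq hn0 hp hq
  refine ⟨n, hn, e, he, ?_⟩
  rw [IsAdmissibleSlope, isConvergent_phi_iff hpn (hT.root hq_root hn0 hp hpn)] at h ⊢
  have hA : A ≠ 0 := by rintro rfl; exact h0 (by rw [zero_mul, zero_mul])
  have hB : B ≠ 0 := by rintro rfl; exact h0 (by rw [mul_zero, zero_mul])
  have hD : D ≠ 0 := by rintro rfl; exact h0 (by rw [mul_zero])
  obtain ⟨w₁, a₁, b₁, h₁⟩ := exists_intFace_ramifyOp hA (root n) n e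
  obtain ⟨w₂, a₂, b₂, h₂⟩ := exists_intFace_ramifyOp hB (root n) n e
  obtain ⟨w₃, a₃, b₃, h₃⟩ := exists_intFace_ramifyOp hD (root n) n e
  have key : ∀ x ∈ intExponents (ramifyOp (root n) n B) e,
      x * ((root n ^ (-w₃) : Cˣ) : C) ∈ intExponents (ramifyOp (root n) n (A * B * D)) e := by
    intro x hx
    rw [mem_intExponents (ramifyOp_ne_zero hB _ _)] at hx
    rw [mem_intExponents (ramifyOp_ne_zero h0 _ _)]
    refine ⟨?_, mul_ne_zero hx.2 (Units.ne_zero _)⟩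
    rw [ramifyOp_mul hp, ramifyOp_mul hp, (h₁.mul h₂).charPoly_mul h₃, h₁.charPoly_mul h₂]
    have h1 : ((root n ^ w₃ : Cˣ) : C) * (x * ((root n ^ (-w₃) : Cˣ) : C)) = x := by
      rw [mul_left_comm, ← Units.val_mul, ← zpow_add, add_neg_cancel, zpow_zero, Units.val_one,
        mul_one]
    simp only [Polynomial.eval_mul, Polynomial.eval_comp, Polynomial.eval_C, Polynomial.eval_X]
    rw [h1, hx.1, mul_zero, zero_mul]
  intro x hx y hy
  have h1 := h _ (key x hx) _ (key y hy)
  rwa [mul_inv, mul_mul_mul_comm, mul_inv_cancel₀ (Units.ne_zero _), mul_one] at h1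

/-- The exponents of a slope, one for each factor `T ^ s - c ^ s` of the characteristic polynomial,
in an order in which no `s`-th power of an exponent is followed by its product with a positive power
of `q`. -/
theorem exists_sorted_exponents [IsAlgClosed C] (hq_root : ∀ n : ℕ, 0 < n → q ^ n ≠ 1) {p : Cˣ}
    {s : ℕ} [NeZero s] {d w : ℤ} {L : SkewPolynomial (Germ C q)} {a b : ℕ}
    (h : IntFace (ramifyOp p s L) d w a b) (hds : IsCoprime d (s : ℤ)) :
    ∃ cs : List Cˣ, b = a + s * cs.length ∧
      (∃ β : C, β ≠ 0 ∧ charPoly (ramifyOp p s L) d =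
        Polynomial.C β * Polynomial.X ^ a * slopePoly q s 0 cs) ∧
      cs.Pairwise fun c c' => ∀ m : ℕ, 0 < m → c' ^ s ≠ c ^ s * q ^ m := by
  obtain ⟨β, hβ, cs, hb, hpoly⟩ := exists_charPoly_eq h hds
  obtain ⟨l, rfl, hl⟩ := exists_coe_eq_pairwise_not
    (fun c c' : Cˣ => ∃ m : ℕ, 0 < m ∧ c' ^ s = c ^ s * q ^ m) (by
      rintro c ⟨m, hm, h⟩
      exact hq_root m hm (mul_eq_left.mp h.symm)) (by
      rintro c c' c'' ⟨m, hm, h⟩ ⟨m', hm', h'⟩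
      exact ⟨m + m', by omega, by rw [h', h, pow_add, mul_assoc]⟩) cs
  refine ⟨l, by simpa using hb, ⟨β, hβ, ?_⟩, hl.imp fun h m hm h' => h ⟨m, hm, h'⟩⟩
  rw [hpoly, slopePoly, Multiset.map_coe, Multiset.prod_coe]
  simp

theorem intExponents_eq_sum_roots {p : Cˣ} {s : ℕ} (hs : s ≠ 0) {A : SkewPolynomial (Germ C p)}
    {e : ℤ} {β : C} (hβ : β ≠ 0) {a : ℕ} {cs : List Cˣ}
    (h : charPoly A e = Polynomial.C β * Polynomial.X ^ a * slopePoly q s 0 cs) :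
    intExponents A e =
      (cs.map fun c : Cˣ => (Polynomial.X ^ s - Polynomial.C ((c : C) ^ s)).roots).sum := by
  classical
  have hne : ∀ c : Cˣ, (Polynomial.X ^ s - Polynomial.C ((c : C) ^ s) : Polynomial C) ≠ 0 :=
    fun c => Polynomial.X_pow_sub_C_ne_zero (Nat.pos_of_ne_zero hs) _
  have hslope : slopePoly q s 0 cs ≠ 0 ∧ (slopePoly q s 0 cs).roots =
      (cs.map fun c : Cˣ => (Polynomial.X ^ s - Polynomial.C ((c : C) ^ s)).roots).sum ∧
      ∀ x ∈ (slopePoly q s 0 cs).roots, x ≠ 0 := by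
    clear h
    induction cs with
    | nil => simp [slopePoly]
    | cons c cs ih =>
      have h1 : ((c ^ s * q ^ (0 : ℤ) : Cˣ) : C) = (c : C) ^ s := by simp
      rw [slopePoly_cons, h1]
      have h2 := mul_ne_zero (hne c) ih.1
      refine ⟨h2, by rw [Polynomial.roots_mul h2, ih.2.1, List.map_cons, List.sum_cons], ?_⟩
      intro x hx
      rw [Polynomial.roots_mul h2, Multiset.mem_add] at hx
      rcases hx with hx | hx
      · rintro rfl
        rw [Polynomial.mem_roots (hne c), Polynomial.IsRoot.def] at hx
        simp [hs] at hx
      · exact ih.2.2 x hx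
  have hX : (Polynomial.C β * Polynomial.X ^ a : Polynomial C) ≠ 0 :=
    mul_ne_zero (Polynomial.C_ne_zero.mpr hβ) (by simp)
  rw [intExponents, h, Polynomial.roots_mul (mul_ne_zero hX hslope.1), ← hslope.2.1,
    Polynomial.roots_C_mul_X_pow hβ, Multiset.filter_add]
  have h1 : (a • ({0} : Multiset C)).filter (· ≠ 0) = 0 := by
    rw [Multiset.filter_eq_nil]
    intro x hx
    rw [Multiset.nsmul_singleton] at hx
    simp [Multiset.eq_of_mem_replicate hx]
  rw [h1, zero_add, Multiset.filter_eq_self]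
  exact hslope.2.2

end

end QDiff

end

theorem mainTheorem5 {C : Type*} [NormedField C] [IsAlgClosed C]
    (hC : IsUltrametricDist C ∨ ∃ e : C ≃+* ℂ, ∀ z : C, ‖e z‖ = ‖z‖)
    (q : Cˣ) (hq : ‖(q : C)‖ = 1) (hq_root : ∀ n : ℕ, 0 < n → q ^ n ≠ 1)
    (root : ℕ → Cˣ) (hroot : ∀ n : ℕ, 0 < n → root n ^ n = q)
    (hconv : QDiff.IsConvergent
      (PowerSeries.mk fun n => (QDiff.qPochhammer (q : C) (q : C) n)⁻¹))
    (L : SkewPolynomial (QDiff.Germ C q)) (hL : L.coeff 0 ≠ 0)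
    (k : ℕ) (hk : 0 < k) (μ : Fin k → ℚ) (r : Fin k → ℕ)
    (hNP : QDiff.HasNewtonPolygon L μ r)
    (hadm : QDiff.IsAlmostAdmissible root L)
    (ϖ : Equiv.Perm (Fin k)) :
    ∃ F : Fin k → SkewPolynomial (QDiff.Germ C q),
      L = (List.ofFn F).prod ∧
      ∀ i : Fin k,
        QDiff.IsAlmostAdmissible root (F i) ∧
        QDiff.IsPure (F i) (μ (ϖ i)) ∧
        QDiff.HasOrder (F i) (r (ϖ i)) ∧
        ∃ (l : ℕ) (c : Fin l → Cˣ) (G : Fin l → SkewPolynomial (QDiff.Germ C q)),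
          F i = (List.ofFn G).reverse.prod ∧
          (∀ j : Fin l, (c j : C) ∈ QDiff.exponents root L (μ (ϖ i))) ∧
          QDiff.exponents root L (μ (ϖ i)) =
            ∑ j : Fin l, (Polynomial.X ^ (μ (ϖ i)).den -
              Polynomial.C ((c j : C) ^ (μ (ϖ i)).den)).roots ∧
          (∀ j j' : Fin l, (∃ m : ℕ, 0 < m ∧ c j * (c j')⁻¹ = q ^ m) → j < j') ∧
          ∀ j : Fin l,
            QDiff.IsAssociated (G j)
              (QDiff.SimpleModule.Sigma q (root (μ (ϖ i)).den) (μ (ϖ i)).num (c j)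
                (μ (ϖ i)).den) := by
  have hL0 : L ≠ 0 := by
    rintro rfl
    exact hL (SkewPolynomial.coeff_zero 0)
  have hT := QDiff.tame_of_isConvergent hq_root hconv
  have hden : ∀ ν : ℚ, 0 < ν.den := fun ν => ν.den_pos
  choose w a b hface using fun ν : ℚ =>
    QDiff.exists_intFace_ramifyOp hL0 (root ν.den) ν.den ν.num
  choose cs hb hpoly hsort using fun ν : ℚ =>
    QDiff.exists_sorted_exponents hq_root (hface ν) (QDiff.isCoprime_num_den ν)
  choose β hβ hpoly using hpoly
  have hside : ∀ ν : ℚ, ∀ n, QDiff.HasSide L (ν : ℝ) n ↔ 0 < n ∧ b ν = a ν + n := fun ν =>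
    ((hface ν).face_of_ramifyOp (QDiff.rat_num_eq_den_mul ν)).hasSide_iff
  have hr : ∀ i, r i = (μ i).den * (cs (μ i)).length ∧ 0 < r i := by
    intro i
    have h1 := (hside (μ i) (r i)).mp ((hNP.2 _ _).mpr ⟨i, rfl, rfl⟩)
    have h2 := hb (μ i)
    exact ⟨by omega, h1.1⟩
  have hslope : ∀ i, QDiff.HasSlope L (μ i : ℝ) := fun i =>
    ⟨r i, (hNP.2 _ _).mpr ⟨i, rfl, rfl⟩⟩
  have hexp : ∀ ν : ℚ, QDiff.exponents root L ν = ((cs ν).map fun c : Cˣ =>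
      (Polynomial.X ^ ν.den - Polynomial.C ((c : C) ^ ν.den)).roots).sum := fun ν =>
    QDiff.intExponents_eq_sum_roots ν.den_ne_zero (hβ ν) (hpoly ν)
  have hmem : ∀ ν : ℚ, ∀ c ∈ cs ν, (c : C) ∈ QDiff.exponents root L ν := by
    intro ν c hc
    obtain ⟨l₁, l₂, hl⟩ := List.append_of_mem hc
    rw [hexp, hl, List.map_append, List.sum_append, List.map_cons, List.sum_cons,
      Multiset.mem_add, Multiset.mem_add, Polynomial.mem_roots
      (Polynomial.X_pow_sub_C_ne_zero (hden ν) _), Polynomial.IsRoot.def]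
    right; left
    simp
  have hroots : ∀ ν : ℚ, ∀ c ∈ cs ν,
      (QDiff.charPoly (QDiff.ramifyOp (root ν.den) ν.den L) ν.num).eval (c : C) = 0 :=
    fun ν c hc => ((QDiff.mem_intExponents (QDiff.ramifyOp_ne_zero hL0 _ _)).mp (hmem ν c hc)).1
  have hinj : Function.Injective fun i => μ (ϖ i) := hNP.1.injective.comp ϖ.injective
  have hself : ∀ (ν : ℚ) (c : Cˣ) (m : ℕ), 0 < m → c ^ ν.den ≠ c ^ ν.den * q ^ m :=
    fun ν c m hm h => hq_root m hm (mul_eq_left.mp h.symm)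
  obtain ⟨L', Fs, hLF, hL', hflat, hall⟩ := QDiff.exists_factorization hq hroot cs
    (ls := List.ofFn fun i => μ (ϖ i)) (List.nodup_ofFn.mpr hinj)
    (fun ν _ => hsort ν) (fun ν _ c _ => hself ν c)
    (by
      intro ν hν c hc c' hc'
      obtain ⟨i, rfl⟩ := List.mem_ofFn.mp hν
      exact QDiff.tame_of_isAlmostAdmissibleSlope hq hq_root hT hroot hL0
        (hadm _ (hslope (ϖ i))) c.ne_zero c'.ne_zero (hroots _ c hc) (hroots _ c' hc'))
    hL (fun ν _ => ⟨β ν, hβ ν, a ν, 0, hpoly ν⟩)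
  have hL'0 : L' ≠ 0 := by
    rintro rfl
    exact hL (by rw [hLF, zero_mul, SkewPolynomial.coeff_zero])
  have hFs0 : Fs.prod ≠ 0 := by
    intro h0
    exact hL0 (by rw [hLF, h0, mul_zero])
  -- the remaining left factor has no slope, hence is a germ
  have hnoslope : ∀ ν : ℚ, ¬ QDiff.HasSlope L' (ν : ℝ) := by
    intro ν hν
    rw [QDiff.hasSlope_iff_not_isFlat hL'0 (root ν.den)] at hν
    by_cases hmem : ν ∈ List.ofFn fun i => μ (ϖ i)
    · exact hν (hflat ν hmem)
    · refine hν (QDiff.IsFlat.of_mul (hroot _ (hden ν)) hL'0 hFs0 ?_)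
      rw [← hLF]
      by_contra hnf
      rw [← QDiff.hasSlope_iff_not_isFlat hL0] at hnf
      obtain ⟨n, hn⟩ := hnf
      obtain ⟨i, hi, -⟩ := (hNP.2 _ _).mp hn
      refine hmem (List.mem_ofFn.mpr ⟨ϖ.symm i, ?_⟩)
      rw [Equiv.apply_symm_apply]
      exact_mod_cast hi.symm
  have hLC := QDiff.eq_C_of_not_hasSlope hL' hnoslope
  -- this germ is absorbed in the leftmost factor
  obtain ⟨Fs', hLF', hall'⟩ : ∃ Fs' : List (SkewPolynomial (QDiff.Germ C q)), L = Fs'.prod ∧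
      List.Forall₂ (fun F ν => QDiff.IsSlopeProduct (root ν.den) ν.den ν.num F (cs ν)) Fs'
        (List.ofFn fun i => μ (ϖ i)) := by
    obtain ⟨k, rfl⟩ := Nat.exists_eq_succ_of_ne_zero hk.ne'
    rw [List.ofFn_succ] at hall ⊢
    obtain ⟨F, Fs', hF, hFs', rfl⟩ := List.forall₂_cons_right_iff.mp hall
    refine ⟨SkewPolynomial.C (L'.coeff 0) * F :: Fs', ?_, List.Forall₂.cons ?_ hFs'⟩
    · rw [hLF, List.prod_cons, List.prod_cons, mul_assoc, ← hLC]
    · refine QDiff.IsSlopeProduct.C_mul (hroot _ (hden _)) hL' ?_ hF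
      intro h0
      have := hr (ϖ 0)
      rw [h0, List.length_nil, mul_zero] at this
      omega
  have hlen : Fs'.length = k := by
    rw [hall'.length_eq, List.length_ofFn]
  have hF : ∀ i : Fin k, QDiff.IsSlopeProduct (root (μ (ϖ i)).den) (μ (ϖ i)).den (μ (ϖ i)).num
      (Fs'[(i : ℕ)]'(by rw [hlen]; exact i.2)) (cs (μ (ϖ i))) := by
    intro i
    have := (List.forall₂_iff_get.mp hall').2 i (by rw [hlen]; exact i.2)
      (by rw [List.length_ofFn]; exact i.2)
    simpa using this
  refine ⟨fun i => Fs'[(i : ℕ)]'(by rw [hlen]; exact i.2), ?_, fun i => ?_⟩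
  · rw [hLF']
    congr 1
    exact List.ext_getElem (hlen.trans List.length_ofFn.symm) fun j _ _ => by simp
  have hi : (i : ℕ) < Fs'.length := by rw [hlen]; exact i.2
  obtain ⟨Gs, hFG, hG, hdeg, v, hv⟩ := hF i
  have hfaceF := hv.face_of_ramifyOp (QDiff.rat_num_eq_den_mul (μ (ϖ i)))
  have hne := (hF i).ne_zero
  have hpure : QDiff.IsPure (Fs'[(i : ℕ)]) (μ (ϖ i)) := by
    intro m
    constructor
    · intro hm
      obtain ⟨w', a', b', h'⟩ := QDiff.exists_face hne m
      exact hfaceF.slope_unique hdeg h' (h'.hasSlope_iff.mp hm)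
    · rintro rfl
      rw [hfaceF.hasSlope_iff, ← (hr (ϖ i)).1]
      exact (hr (ϖ i)).2
  refine ⟨?_, hpure, ?_, ?_⟩
  · intro ν hν
    have hνμ : ν = μ (ϖ i) := by
      have := (hpure ν).mp hν
      exact_mod_cast this
    have hsplit : L = (Fs'.take i).prod * Fs'[(i : ℕ)] * (Fs'.drop (i + 1)).prod := by
      rw [← List.prod_take_succ, List.prod_take_mul_prod_drop, hLF']
    have hadm' := hadm ν (by rw [hνμ]; exact hslope (ϖ i))
    rw [hsplit] at hadm'
    exact hadm'.of_mul hq hq_root hT hroot (by rw [← hsplit]; exact hL0)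
  · rw [(hr (ϖ i)).1]
    exact ⟨hfaceF.right_ne, hdeg⟩
  have hlenG : Gs.length = (cs (μ (ϖ i))).length := hG.length_eq
  refine ⟨(cs (μ (ϖ i))).length, fun j => (cs (μ (ϖ i)))[(j : ℕ)],
    fun j => Gs[(j : ℕ)]'(by rw [hlenG]; exact j.2), ?_, fun j => ?_, ?_, ?_, fun j => ?_⟩
  · refine hFG.trans ?_
    congr 2
    exact List.ext_getElem (hlenG.trans List.length_ofFn.symm) fun j _ _ => by simp
  · exact hmem _ _ (List.getElem_mem _)
  · rw [hexp, ← Fin.sum_univ_fun_getElem]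
  · rintro j j' ⟨m, hm, hjm⟩
    beta_reduce at hjm
    by_contra! hle
    have hjm' := mul_inv_eq_iff_eq_mul.mp hjm
    rcases hle.eq_or_lt with rfl | hlt
    · rw [mul_inv_cancel] at hjm
      exact hq_root m hm hjm.symm
    · refine (List.pairwise_iff_getElem.mp (hsort (μ (ϖ i)))) j' j j'.2 j.2 hlt
        (m * (μ (ϖ i)).den) (Nat.mul_pos hm (hden _)) ?_
      rw [hjm', mul_pow, ← pow_mul, mul_comm]
  · have := (List.forall₂_iff_get.mp hG).2 j (by rw [hlenG]; exact j.2) j.2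
    simpa using this
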